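/- Fix $q\in\mathbb C$ with $0<|q|<1$. Write $(a)_\infty=\prod_{j\ge0}(1-aq^j)$, $\theta(x)=(x)_\infty(q/x)_\infty$, and, for $k\in\mathbb Z$, $(a)_k=(1-a)(1-aq)\cdots(1-aq^{k-1})$ if $k\ge0$ and $(a)_k=\big((1-aq^{-1})(1-aq^{-2})\cdots(1-aq^{k})\big)^{-1}$ if $k<0$; moreover $(az^\pm)_k=(az)_k(a/z)_k$ for $k\in\mathbb Z\cup\{\infty\}$. Let $b_1,\dots,b_6\in\mathbb C$ satisfy $b_1\cdots b_6=q$, $b_i/b_j\notin q^{\mathbb Z}$ for $i<j$, and $b_ib_j\notin q^{\mathbb Z}$ for $i\le j$. Let $V$ be the space of rational functions $f$ of $x=(z+z^{-1})/2$ that are regular (also at $x=\infty$) except for possible simple poles at the points $x=(z+z^{-1})/2$ with $z\in b_jq^{\mathbb Z_{<0}}$, $1\le j\le 6$. There is a unique linear functional $\mathbf J:V\to\mathbb C$ (Rahman's functional) such that $$\mathbf J\big((b_1z^\pm)_{k_1}\cdots(b_6z^\pm)_{k_6}\big)=\frac{\prod_{1\le i<j\le6}(b_ib_j)_{k_i+k_j}}{\prod_{j=1}^6q^{\binom{k_j}2}b_j^{k_j}}$$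 for all integers $k_1,\dots,k_6$ with $k_1+\dots+k_6=0$. For $f\in V$, let $n_j$ be the largest positive integer such that $f((z+z^{-1})/2)$ has a pole at $z=b_jq^{-n_j}$, and $n_j=0$ if there is none. A contour for $f$ is a closed piecewise $C^1$ curve in $\mathbb C\setminus\{0\}$ that passes through none of the points $b_jq^{k-n_j}$ $(1\le j\le6,\ k\in\mathbb Z_{\ge0})$ or their reciprocals, and has winding number $1$ about each point $b_jq^{k-n_j}$ and winding number $0$ about each of their reciprocals. Every $f\in V$ has a contour. For $\lambda=(\lambda_1,\dots,\lambda_6)\in\mathbb C^6$ with $\lambda_1\cdots\lambda_6=q$ and $\lambda_1^2,\lambda_2^2,\lambda_1/\lambda_2\notin q^{\mathbb Z}$, let $$C=\frac{\prod_{j=3}^6\theta(\lambda_j\lambda_2)\left\{\prod_{j=1}^6\theta(\lambda_1b_j)-q\lambda_1^{-2}\prod_{j=1}^6\theta(\lambda_1/b_j)\right\}}{\lambda_2\,\theta(\lambda_1^2)\,\theta(\lambda_1/\lambda_2)\,(q)_\infty\prod_{1\le i<j\le6}(b_ib_j)_\infty}+\mathrm{idem}(\lambda_1;\lambda_2),$$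 where $\mathrm{idem}(\lambda_1;\lambda_2)$ denotes the preceding expression with $\lambda_1$ and $\lambda_2$ interchanged. Call $\lambda$ generic if these three conditions hold and $C\ne0$. The generic $\lambda$ form an open dense subset of $\{\lambda\in\mathbb C^6:\lambda_1\cdots\lambda_6=q\}$, and for every generic $\lambda$, every $f\in V$ and every contour for $f$, $$\mathbf J(f)=\frac1C\oint f\left(\frac{z+z^{-1}}2\right)\frac{z-z^{-1}}{z^2}\prod_{j=1}^6\frac{\theta(\lambda_jz)}{(b_jz^\pm)_\infty}\,\frac{dz}{2\pi\mathrm i z}.$$ -/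

import Mathlib

open scoped Topology

namespace Rahman

noncomputable section

/-- The infinite `q`-shifted factorial `(a)_∞ = ∏_{j ≥ 0} (1 - a q^j)`. -/
def qInf (q a : ℂ) : ℂ := ∏' j : ℕ, (1 - a * q ^ j)

/-- The `q`-shifted factorial `(a)_k` with integer index `k`: it is
`(1 - a)(1 - a q) ⋯ (1 - a q^(k-1))` for `k ≥ 0` and
`((1 - a q^(-1))(1 - a q^(-2)) ⋯ (1 - a q^k))⁻¹` for `k < 0`. -/
def qPoch (q a : ℂ) : ℤ → ℂ
  | Int.ofNat n => ∏ i ∈ Finset.range n, (1 - a * q ^ i)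
  | Int.negSucc n => (∏ i ∈ Finset.range (n + 1), (1 - a * q ^ (-((i : ℤ) + 1))))⁻¹

/-- The theta function `θ(x) = (x)_∞ (q/x)_∞`. -/
def theta (q x : ℂ) : ℂ := qInf q x * qInf q (q / x)

/-- The change of variable `z ↦ (z + z⁻¹)/2`. -/
def jouk (z : ℂ) : ℂ := (z + z⁻¹) / 2

/-- The product of `F i j` over all pairs `i < j` of indices. -/
def pairProd (F : Fin 6 → Fin 6 → ℂ) : ℂ := ∏ i : Fin 6, ∏ j ∈ Finset.Ioi i, F i j

/-- Genericity of the parameters `b`: `b_i / b_j ∉ q^ℤ` for `i < j` and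
`b_i b_j ∉ q^ℤ` for `i ≤ j`. -/
def GenericParams (q : ℂ) (b : Fin 6 → ℂ) : Prop :=
  (∀ i j : Fin 6, i < j → ∀ n : ℤ, b i / b j ≠ q ^ n) ∧
  (∀ i j : Fin 6, i ≤ j → ∀ n : ℤ, b i * b j ≠ q ^ n)

/-- The points `x = (z + z⁻¹)/2` with `z` in `b_j q^(ℤ_{<0})` for some `j`. -/
def poleSet (q : ℂ) (b : Fin 6 → ℂ) : Set ℂ :=
  {x | ∃ j : Fin 6, ∃ n : ℕ, 1 ≤ n ∧ x = jouk (b j * q ^ (-(n : ℤ)))}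

lemma squarefree_lcm {A B : Polynomial ℂ} (hA : Squarefree A) (hB : Squarefree B) :
    Squarefree (EuclideanDomain.lcm A B) := by
  classical
  refine IsRadical.squarefree ?_ ?_
  · intro h
    rcases EuclideanDomain.lcm_eq_zero_iff.1 h with h | h
    · exact hA.ne_zero h
    · exact hB.ne_zero h
  · intro n x h
    exact EuclideanDomain.lcm_dvd
      (hA.isRadical n x ((EuclideanDomain.dvd_lcm_left A B).trans h))
      (hB.isRadical n x ((EuclideanDomain.dvd_lcm_right A B).trans h))

lemma denom_add_dvd_lcm (f g : RatFunc ℂ) :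
    (f + g).denom ∣ EuclideanDomain.lcm f.denom g.denom := by
  have h0 : EuclideanDomain.lcm f.denom g.denom ≠ 0 := by
    intro h
    rcases EuclideanDomain.lcm_eq_zero_iff.1 h with h | h
    · exact f.denom_ne_zero h
    · exact g.denom_ne_zero h
  obtain ⟨p, hp⟩ := (RatFunc.denom_dvd h0).1 (EuclideanDomain.dvd_lcm_left f.denom g.denom)
  obtain ⟨r, hr⟩ := (RatFunc.denom_dvd h0).1 (EuclideanDomain.dvd_lcm_right f.denom g.denom)
  refine (RatFunc.denom_dvd h0).2 ⟨p + r, ?_⟩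
  rw [map_add, add_div]
  exact congrArg₂ _ hp hr

/-- The space `V` of rational functions of `x = (z + z⁻¹)/2` that are regular except for
possible simple poles at the points of `poleSet q b`, and that are regular at infinity
(the degree of the numerator is at most that of the denominator). -/
def V (q : ℂ) (b : Fin 6 → ℂ) : Submodule ℂ (RatFunc ℂ) where
  carrier := {f | Squarefree f.denom ∧ (∀ x, f.denom.IsRoot x → x ∈ poleSet q b) ∧
    f.num.natDegree ≤ f.denom.natDegree}
  zero_mem' := by
    simp [Polynomial.IsRoot]
  add_mem' := by
    rintro f g ⟨hf1, hf2, hf3⟩ ⟨hg1, hg2, hg3⟩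
    refine ⟨(squarefree_lcm hf1 hg1).squarefree_of_dvd (denom_add_dvd_lcm f g), ?_, ?_⟩
    · intro x hx
      have h := hx.dvd (RatFunc.denom_add_dvd f g)
      rcases Polynomial.root_mul.1 h with h | h
      · exact hf2 x h
      · exact hg2 x h
    · by_cases hg : g = 0
      · simpa [hg] using hf3
      by_cases hfg : f + g = 0
      · simp [hfg]
      have h := RatFunc.intDegree_add_le hg hfg
      simp only [RatFunc.intDegree] at h
      omega
  smul_mem' := by
    rintro c f ⟨h1, h2, h3⟩
    by_cases hc : c = 0
    · simp [hc, Polynomial.IsRoot]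
    by_cases hf : f = 0
    · simp [hf, Polynomial.IsRoot]
    have hd : (c • f).denom ∣ f.denom := by
      have := RatFunc.denom_mul_dvd (RatFunc.C c) f
      rwa [RatFunc.denom_C, one_mul, ← RatFunc.smul_eq_C_mul] at this
    refine ⟨h1.squarefree_of_dvd hd, fun x hx => h2 x (hx.dvd hd), ?_⟩
    have h := RatFunc.intDegree_mul (x := RatFunc.C c) (y := f) (by simpa using hc) hf
    rw [← RatFunc.smul_eq_C_mul, RatFunc.intDegree_C] at h
    simp only [RatFunc.intDegree] at h
    omega

/-- A linear functional `J` on `V` is Rahman's functional if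
`J ((b_1 z^±)_{k_1} ⋯ (b_6 z^±)_{k_6})
  = ∏_{i<j} (b_i b_j)_{k_i+k_j} / ∏_j q^{k_j(k_j-1)/2} b_j^{k_j}`
for all integers `k_1, …, k_6` with sum `0`. The argument of `J` is the element `f` of `V`
which satisfies `f((z + z⁻¹)/2) = (b_1 z^±)_{k_1} ⋯ (b_6 z^±)_{k_6}` for all but finitely
many `z`. -/
def IsRahmanFunctional (q : ℂ) (b : Fin 6 → ℂ) (J : V q b →ₗ[ℂ] ℂ) : Prop :=
  ∀ k : Fin 6 → ℤ, ∑ j, k j = 0 → ∀ f : V q b,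
    (∀ᶠ z in Filter.cofinite, (f : RatFunc ℂ).eval (RingHom.id ℂ) (jouk z) =
      ∏ j, (qPoch q (b j * z) (k j) * qPoch q (b j / z) (k j))) →
    J f = pairProd (fun i j => qPoch q (b i * b j) (k i + k j)) /
      ∏ j, (q ^ (k j * (k j - 1) / 2) * b j ^ k j)

/-- The number `n_j`: the largest positive integer `n` such that `f((z + z⁻¹)/2)` has a pole
at `z = b_j q^(-n)`, and `0` if there is none. -/
def poleDepth (q : ℂ) (b : Fin 6 → ℂ) (f : RatFunc ℂ) (j : Fin 6) : ℕ :=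
  sSup {n : ℕ | f.denom.IsRoot (jouk (b j * q ^ (-(n : ℤ))))}

/-- The contour integral `∫_γ F(z) dz`. -/
def contourIntegral (F : ℂ → ℂ) {x y : ℂ} (γ : Path x y) : ℂ :=
  curveIntegral (fun z => ContinuousLinearMap.toSpanSingleton ℂ (F z)) γ

/-- The path `γ` is piecewise continuously differentiable. -/
def IsPiecewiseC1 {x y : ℂ} (γ : Path x y) : Prop :=
  ∃ (n : ℕ) (t : ℕ → ℝ), Monotone t ∧ t 0 = 0 ∧ t n = 1 ∧
    ∀ i < n, ContDiffOn ℝ 1 γ.extend (Set.Icc (t i) (t (i + 1)))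

/-- The winding number of the closed path `γ` around `p`. -/
def windingNumber {x : ℂ} (γ : Path x x) (p : ℂ) : ℂ :=
  (2 * Real.pi * Complex.I)⁻¹ * contourIntegral (fun z => (z - p)⁻¹) γ

/-- The contours of integration that belong to `f`: closed piecewise `C^1` curves in
`ℂ ∖ {0}` that encircle, once in the positive direction, the points `b_j q^(k - n_j)`, `k ≥ 0`,
and have their reciprocals outside, with `n_j = poleDepth q b f j`. -/
structure IsContour (q : ℂ) (b : Fin 6 → ℂ) (f : RatFunc ℂ) {x : ℂ} (γ : Path x x) :
    Prop where
  piecewiseC1 : IsPiecewiseC1 γ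
  ne_zero : ∀ t, γ t ≠ 0
  inside : ∀ (j : Fin 6) (k : ℕ), ∀ p, p = b j * q ^ ((k : ℤ) - poleDepth q b f j) →
    (∀ t, γ t ≠ p) ∧ windingNumber γ p = 1
  outside : ∀ (j : Fin 6) (k : ℕ), ∀ p, p = (b j * q ^ ((k : ℤ) - poleDepth q b f j))⁻¹ →
    (∀ t, γ t ≠ p) ∧ windingNumber γ p = 0

/-- The non-symmetric weight `(z - z⁻¹)/z^2 ∏_j θ(λ_j z)/(b_j z^±)_∞`. -/
def weight (q : ℂ) (b l : Fin 6 → ℂ) (z : ℂ) : ℂ :=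
  (z - z⁻¹) / z ^ 2 * ∏ j, (theta q (l j * z) / (qInf q (b j * z) * qInf q (b j / z)))

/-- The first term of the constant `C`, with `λ_i`, `λ_k` in the roles of `λ_1`, `λ_2`;
the indices `2, 3, 4, 5` stand for `λ_3, …, λ_6`. -/
def constTerm (q : ℂ) (b l : Fin 6 → ℂ) (i k : Fin 6) : ℂ :=
  ((∏ j ∈ ({2, 3, 4, 5} : Finset (Fin 6)), theta q (l j * l k)) *
      (∏ j, theta q (l i * b j) - q / l i ^ 2 * ∏ j, theta q (l i / b j))) /
    (l k * theta q (l i ^ 2) * theta q (l i / l k) * qInf q q *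
      pairProd (fun r s => qInf q (b r * b s)))

/-- The constant `C`: the sum of `constTerm` and the same expression with `λ_1` and `λ_2`
interchanged. -/
def const (q : ℂ) (b l : Fin 6 → ℂ) : ℂ := constTerm q b l 0 1 + constTerm q b l 1 0

/-- The genericity condition on `λ`: no denominator in `C` vanishes, and `C ≠ 0`. -/
def GenericLambda (q : ℂ) (b l : Fin 6 → ℂ) : Prop :=
  (∀ n : ℤ, l 0 ^ 2 ≠ q ^ n) ∧ (∀ n : ℤ, l 1 ^ 2 ≠ q ^ n) ∧ (∀ n : ℤ, l 0 / l 1 ≠ q ^ n) ∧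
    const q b l ≠ 0

end

end Rahman

/-! Existence rests on one evaluation, `loopInt_weight`: for parameters b in general position with
product q, the integral of the weight alone over a separating contour is C. Multiplying the weight
by (b_1 z^±)_{k_1} ⋯ (b_6 z^±)_{k_6} with ∑ k_j = 0 gives the weight with b_j replaced by b_j
q^{k_j} (`weight_mul_qPoch`). These parameters are again in general position with product q, so the
integral is C at the shifted parameters, and quasi-periodicity of θ shows that C has been multiplied
exactly by the prescribed moment (`const_zpow_mul`). After division by C the integral is therefore a
functional with the required values.

For the evaluation itself, the factor 1/∏ (b_j z^±)_∞ is invariant under z ↦ 1/z, so only the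
antisymmetric part of z⁻² ∏ θ(λ_j z) matters (`pairing_eq_neg_inv`). Since ∏ λ_j = q, this part
satisfies g(qz) = q⁻³ z⁻⁶ g(z) and g(1/z) = -g(z). Such a g is determined by its Laurent
coefficients of index 1 and 2 (`ThetaForm.eq_zero`), so any three of them are dependent, and g can
be interpolated by the functions z⁻¹ θ(z²) θ(az) θ(a/z) with two nodes a
(`ThetaForm.eq_interpolation`). The nodes λ_1, λ_2 produce the two terms of C. When a is one of the
b_m, the factors (b_m z^±)_∞ cancel and a five-parameter Nassrallah–Rahman integral remains. A
second interpolation, with nodes b_1, b_2, reaches every a (`pairing_thetaBasis`).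

The Nassrallah–Rahman integral (`loopInt_nrWeight`) is found from a q-difference: for a suitable F,
the integral of q F(qz) - F(z) vanishes, because scaling the contour by q crosses no pole of F. This
relates the integrals before and after one parameter is multiplied by q, with the factor demanded by
the product formula. Iteration sends all parameters to 0. The limit is the constant term of (1 -
z⁻²) θ(z²), obtained from a finite form of the Jacobi triple product (`circleIntegral_theta_sq`).

Contours may be exchanged by a residue theorem in comparative form, `SimplePoles.loopInt_eq`: with
simple poles only, the winding numbers determine the integral. They are constructed in
`exists_separating_path` by appending small loops to a small circle.

For uniqueness (`IsRahmanFunctional.unique`), test functions with k_i = -k_j = m + 1 and all other k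
equal to 0 yield, inductively in m, every simple fraction with an allowed pole, and these together
with 1 span V. Genericity of λ is the nonvanishing of one holomorphic function, `genericityForm`; it
is not identically zero, whence openness and density. Existence needs a single generic λ, and
uniqueness transfers the formula to all of them. -/

namespace Rahman

/-! ### Infinite q-products and theta functions. -/

section QSeries

variable {q : ℂ}

lemma summable_mul_pow (hq : ‖q‖ < 1) (a : ℂ) : Summable fun j : ℕ => ‖-(a * q ^ j)‖ := by
  simpa [norm_mul, norm_pow] using
    (summable_geometric_of_lt_one (norm_nonneg q) hq).mul_left ‖a‖

lemma multipliable_qInf (hq : ‖q‖ < 1) (a : ℂ) : Multipliable fun j : ℕ => 1 - a * q ^ j := by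
  simpa [sub_eq_add_neg] using multipliable_one_add_of_summable (summable_mul_pow hq a)

lemma differentiable_qInf (hq : ‖q‖ < 1) : Differentiable ℂ (qInf q) := by
  intro a
  have hu : Summable fun j : ℕ => (‖a‖ + 1) * ‖q‖ ^ j :=
    (summable_geometric_of_lt_one (norm_nonneg q) hq).mul_left _
  have h := Summable.hasProdLocallyUniformlyOn_nat_one_add (f := fun j x => -(x * q ^ j))
    (Metric.isOpen_ball (x := (0 : ℂ)) (ε := ‖a‖ + 1)) hu
    (.of_forall fun n x hx => by
      have : ‖x‖ ≤ ‖a‖ + 1 := by simpa using (Metric.mem_ball.1 hx).le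
      simpa using mul_le_mul_of_nonneg_right this (by positivity))
    (fun _ => by fun_prop)
  have h2 : DifferentiableOn ℂ (fun x => ∏' j : ℕ, (1 + -(x * q ^ j)))
      (Metric.ball (0 : ℂ) (‖a‖ + 1)) :=
    h.differentiableOn (.of_forall fun _ => by
      simpa [Finset.prod_fn] using DifferentiableOn.finsetProd (fun _ _ => by fun_prop))
      Metric.isOpen_ball
  have h3 : qInf q = fun x => ∏' j : ℕ, (1 + -(x * q ^ j)) := by
    funext x; simp [qInf, sub_eq_add_neg]
  rw [h3]
  exact h2.differentiableAt (Metric.isOpen_ball.mem_nhds (by simp))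

lemma continuous_qInf (hq : ‖q‖ < 1) : Continuous (qInf q) := (differentiable_qInf hq).continuous

@[simp] lemma qInf_zero_right : qInf q 0 = 1 := by simp [qInf]

lemma qInf_eq (hq : ‖q‖ < 1) (a : ℂ) : qInf q a = (1 - a) * qInf q (a * q) := by
  have h := tprod_eq_zero_mul' (f := fun j : ℕ => 1 - a * q ^ j)
    (by simpa [pow_succ', mul_assoc] using multipliable_qInf hq (a * q))
  simpa [qInf, pow_succ', mul_assoc] using h

lemma qInf_eq_prod (hq : ‖q‖ < 1) (a : ℂ) (n : ℕ) :
    qInf q a = (∏ i ∈ Finset.range n, (1 - a * q ^ i)) * qInf q (a * q ^ n) := by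
  induction n with
  | zero => simp
  | succ n ih =>
    rw [ih, Finset.prod_range_succ, qInf_eq hq (a * q ^ n), pow_succ]
    ring_nf

lemma qInf_ne_zero (hq : ‖q‖ < 1) {a : ℂ} (h : ∀ j : ℕ, a * q ^ j ≠ 1) : qInf q a ≠ 0 := by
  have := tprod_one_add_ne_zero_of_summable (f := fun j : ℕ => -(a * q ^ j))
    (fun j => by simpa [← sub_eq_add_neg, sub_eq_zero] using (h j).symm) (summable_mul_pow hq a)
  simpa [qInf, sub_eq_add_neg] using this

lemma qInf_eq_zero_iff (hq : ‖q‖ < 1) {a : ℂ} : qInf q a = 0 ↔ ∃ j : ℕ, a * q ^ j = 1 := by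
  constructor
  · intro h
    by_contra! h'
    exact qInf_ne_zero hq h' h
  · rintro ⟨j, hj⟩
    rw [qInf_eq_prod hq a (j + 1), Finset.prod_range_succ, hj]
    simp

lemma qInf_ne_zero_of_norm_lt (hq : ‖q‖ < 1) {a : ℂ} (ha : ‖a‖ < 1) : qInf q a ≠ 0 := by
  refine qInf_ne_zero hq fun j h => ?_
  have h1 : ‖a * q ^ j‖ ≤ ‖a‖ := by
    rw [norm_mul, norm_pow]
    exact mul_le_of_le_one_right (norm_nonneg a) (pow_le_one₀ (norm_nonneg q) hq.le)
  rw [h, norm_one] at h1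
  linarith

lemma qInf_self_ne_zero (hq : ‖q‖ < 1) : qInf q q ≠ 0 := qInf_ne_zero_of_norm_lt hq hq

lemma qInf_ne_zero_of_zpow (hq : ‖q‖ < 1) {a : ℂ} (h : ∀ n : ℤ, a ≠ q ^ n) :
    qInf q a ≠ 0 := by
  refine qInf_ne_zero hq fun j hj => h (-j) ?_
  rw [zpow_neg, zpow_natCast]
  exact eq_inv_of_mul_eq_one_left hj

lemma theta_q_div (hq0 : q ≠ 0) (x : ℂ) : theta q (q / x) = theta q x := by
  rw [theta, theta, div_div_cancel₀ hq0, mul_comm]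

lemma theta_inv (hq0 : q ≠ 0) (hq : ‖q‖ < 1) {x : ℂ} (hx : x ≠ 0) :
    theta q x⁻¹ = -x⁻¹ * theta q x := by
  rw [theta, theta, qInf_eq hq x⁻¹, qInf_eq hq x]
  rw [show q / x⁻¹ = x * q by field_simp, show x⁻¹ * q = q / x by field_simp]
  field_simp
  ring

lemma theta_q_mul (hq0 : q ≠ 0) (hq : ‖q‖ < 1) {x : ℂ} (hx : x ≠ 0) :
    theta q (q * x) = -x⁻¹ * theta q x := by
  rw [← theta_q_div hq0, show q / (q * x) = x⁻¹ by field_simp, theta_inv hq0 hq hx]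

lemma theta_eq_zero_iff (hq0 : q ≠ 0) (hq : ‖q‖ < 1) {x : ℂ} (hx : x ≠ 0) :
    theta q x = 0 ↔ ∃ n : ℤ, x = q ^ n := by
  rw [theta, mul_eq_zero, qInf_eq_zero_iff hq, qInf_eq_zero_iff hq]
  constructor
  · rintro (⟨j, hj⟩ | ⟨j, hj⟩)
    · refine ⟨-j, ?_⟩
      rw [zpow_neg, zpow_natCast]
      exact eq_inv_of_mul_eq_one_left hj
    · refine ⟨(j + 1 : ℕ), ?_⟩
      rw [zpow_natCast, pow_succ']
      field_simp at hj
      rw [← hj]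
  · rintro ⟨n, rfl⟩
    rcases le_or_gt n 0 with h | h
    · obtain ⟨m, rfl⟩ := Int.exists_eq_neg_ofNat h
      exact Or.inl ⟨m, by simp [hq0]⟩
    · obtain ⟨m, rfl⟩ : ∃ m : ℕ, n = m + 1 := ⟨(n - 1).toNat, by omega⟩
      right
      refine ⟨m, ?_⟩
      rw [zpow_add₀ hq0]
      field_simp
      simp

lemma theta_ne_zero (hq0 : q ≠ 0) (hq : ‖q‖ < 1) {x : ℂ} (hx : x ≠ 0) (h : ∀ n : ℤ, x ≠ q ^ n) :
    theta q x ≠ 0 := by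
  rw [Ne, theta_eq_zero_iff hq0 hq hx]
  exact fun ⟨n, hn⟩ => h n hn

lemma theta_one (hq : ‖q‖ < 1) : theta q 1 = 0 := by
  rw [theta, qInf_eq hq 1]; simp

lemma differentiableAt_theta (hq : ‖q‖ < 1) {x : ℂ} (hx : x ≠ 0) :
    DifferentiableAt ℂ (theta q) x := by
  unfold theta
  exact ((differentiable_qInf hq) x).mul
    (((differentiable_qInf hq) (q / x)).comp x (by fun_prop (disch := assumption)))

lemma theta_zpow_mul (hq0 : q ≠ 0) (hq : ‖q‖ < 1) {x : ℂ} (hx : x ≠ 0) (n : ℤ) :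
    theta q (q ^ n * x) = (-1) ^ n * (q ^ (n * (n - 1) / 2))⁻¹ * x ^ (-n) * theta q x := by
  have step : ∀ m : ℤ, theta q (q ^ (m + 1) * x) = -(q ^ m * x)⁻¹ * theta q (q ^ m * x) := by
    intro m
    rw [zpow_add_one₀ hq0, mul_comm (q ^ m), mul_assoc, theta_q_mul hq0 hq (by positivity)]
  have tri : ∀ m : ℤ, (m + 1) * (m + 1 - 1) / 2 = m * (m - 1) / 2 + m := by
    intro m
    rw [show (m + 1) * (m + 1 - 1) = m * (m - 1) + m * 2 by ring,
      Int.add_mul_ediv_right _ _ (by norm_num)]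
  -- An equivalence between consecutive exponents, so that one computation serves both directions of
  -- the induction over ℤ.
  have key : ∀ m : ℤ, (theta q (q ^ m * x) =
        (-1) ^ m * (q ^ (m * (m - 1) / 2))⁻¹ * x ^ (-m) * theta q x) ↔
      (theta q (q ^ (m + 1) * x) =
        (-1) ^ (m + 1) * (q ^ ((m + 1) * (m + 1 - 1) / 2))⁻¹ * x ^ (-(m + 1)) * theta q x) := by
    intro m
    rw [step, tri, zpow_add₀ hq0, zpow_add_one₀ (by norm_num : (-1 : ℂ) ≠ 0), neg_add,
      zpow_add₀ hx, mul_inv, mul_inv, zpow_neg_one]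
    rw [show (-1 : ℂ) ^ m * -1 * ((q ^ (m * (m - 1) / 2))⁻¹ * (q ^ m)⁻¹) * (x ^ (-m) * x⁻¹) *
      theta q x = -((q ^ m)⁻¹ * x⁻¹) * ((-1) ^ m * (q ^ (m * (m - 1) / 2))⁻¹ * x ^ (-m) *
      theta q x) by ring]
    have h0 : -((q ^ m)⁻¹ * x⁻¹) ≠ 0 := by
      simp [hq0, hx, zpow_ne_zero]
    exact ⟨fun h => by rw [h], fun h => mul_left_cancel₀ h0 h⟩
  induction n using Int.induction_on with
  | zero => simp
  | succ n ih => exact (key _).1 ih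
  | pred n ih => exact (key (-n - 1)).2 (by simpa using ih)

lemma qPoch_natCast (a : ℂ) (n : ℕ) :
    qPoch q a n = ∏ i ∈ Finset.range n, (1 - a * q ^ i) := rfl

lemma qPoch_neg_natCast (a : ℂ) (n : ℕ) :
    qPoch q a (-(n : ℤ)) = (∏ i ∈ Finset.range n, (1 - a * q ^ (-((i : ℤ) + 1))))⁻¹ := by
  cases n with
  | zero => simp [qPoch]
  | succ n => rfl

/-- `(a)_k (a q^k)_∞ = (a)_∞`, when no factor in the denominator of `(a)_k` vanishes. -/
lemma qPoch_mul_qInf (hq0 : q ≠ 0) (hq : ‖q‖ < 1) {a : ℂ} {k : ℤ}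
    (h : ∀ n : ℕ, (n : ℤ) < -k → a * q ^ (-((n : ℤ) + 1)) ≠ 1) :
    qPoch q a k * qInf q (a * q ^ k) = qInf q a := by
  rcases le_or_gt 0 k with hk | hk
  · lift k to ℕ using hk
    rw [qPoch_natCast, zpow_natCast, ← qInf_eq_prod hq]
  · obtain ⟨n, rfl⟩ : ∃ n : ℕ, k = -(n : ℤ) := ⟨(-k).toNat, by omega⟩
    rw [qPoch_neg_natCast, qInf_eq_prod hq (a * q ^ (-(n : ℤ))) n]
    have h1 : a * q ^ (-(n : ℤ)) * q ^ n = a := by simp [hq0]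
    -- The first n factors of (a q^{-n})_∞, read in reverse order, are those inverted in (a)_{-n}.
    have h2 : ∏ i ∈ Finset.range n, (1 - a * q ^ (-(n : ℤ)) * q ^ i) =
        ∏ i ∈ Finset.range n, (1 - a * q ^ (-((i : ℤ) + 1))) := by
      rw [← Finset.prod_range_reflect]
      refine Finset.prod_congr rfl fun i hi => ?_
      have : i < n := Finset.mem_range.1 hi
      rw [← zpow_natCast q, mul_assoc, ← zpow_add₀ hq0]
      congr 3
      omega
    rw [h1, h2, inv_mul_cancel_left₀]
    refine Finset.prod_ne_zero_iff.2 fun i hi => ?_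
    have hi' : i < n := Finset.mem_range.1 hi
    rw [sub_ne_zero]
    exact (h i (by omega)).symm

end QSeries

/-! ### Closed curves in an annulus and a residue theorem in terms of winding numbers. -/

open MeasureTheory Set

/-- The open annulus `r < |z| < R`. -/
def annulus (r R : ℝ) : Set ℂ := {z | r < ‖z‖ ∧ ‖z‖ < R}

lemma isOpen_annulus (r R : ℝ) : IsOpen (annulus r R) :=
  (isOpen_lt continuous_const continuous_norm).inter (isOpen_lt continuous_norm continuous_const)

lemma annulus_mono {r r' R R' : ℝ} (hr : r' ≤ r) (hR : R ≤ R') :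
    annulus r R ⊆ annulus r' R' := fun _ hz => ⟨hr.trans_lt hz.1, hz.2.trans_le hR⟩

lemma ne_zero_of_mem_annulus {r R : ℝ} (hr : 0 ≤ r) {z : ℂ} (hz : z ∈ annulus r R) : z ≠ 0 :=
  norm_pos_iff.1 (hr.trans_lt hz.1)

/-- `g` is a closed curve on `[0, 1]` with derivative `g'` off a countable set. -/
structure IsLoop (g g' : ℝ → ℂ) : Prop where
  cont : ContinuousOn g (Icc 0 1)
  deriv : ∃ s : Set ℝ, s.Countable ∧
    ∀ t ∈ Ioo (0 : ℝ) 1 \ s, HasDerivAt g (g' t) t ∧ ContinuousAt g' t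
  int : IntervalIntegrable g' volume 0 1
  closed : g 0 = g 1

/-- The integral of `F` along the curve `g` with derivative `g'`. -/
noncomputable def loopInt (F : ℂ → ℂ) (g g' : ℝ → ℂ) : ℂ := ∫ t in (0 : ℝ)..1, F (g t) * g' t

lemma IsLoop.intervalIntegrable {g g' : ℝ → ℂ} (h : IsLoop g g') {F : ℂ → ℂ}
    (hF : ContinuousOn (fun t => F (g t)) (Icc 0 1)) :
    IntervalIntegrable (fun t => F (g t) * g' t) volume 0 1 :=
  h.int.continuousOn_mul (by rwa [uIcc_of_le zero_le_one])

lemma loopInt_congr {F F' : ℂ → ℂ} {g g' : ℝ → ℂ}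
    (h : ∀ t ∈ Icc (0 : ℝ) 1, F (g t) = F' (g t)) : loopInt F g g' = loopInt F' g g' :=
  intervalIntegral.integral_congr fun t ht => by
    rw [uIcc_of_le zero_le_one] at ht
    simp only [h t ht]

lemma loopInt_const_mul (c : ℂ) (F : ℂ → ℂ) (g g' : ℝ → ℂ) :
    loopInt (fun z => c * F z) g g' = c * loopInt F g g' := by
  simp only [loopInt, mul_assoc, intervalIntegral.integral_const_mul]

lemma IsLoop.loopInt_add {g g' : ℝ → ℂ} (h : IsLoop g g') {F G : ℂ → ℂ}
    (hF : ContinuousOn (fun t => F (g t)) (Icc 0 1))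
    (hG : ContinuousOn (fun t => G (g t)) (Icc 0 1)) :
    loopInt (fun z => F z + G z) g g' = loopInt F g g' + loopInt G g g' := by
  simp only [loopInt, add_mul]
  exact intervalIntegral.integral_add (h.intervalIntegrable hF) (h.intervalIntegrable hG)

/-- A closed curve that avoids the origin has a continuous logarithm. -/
lemma IsLoop.exists_log {g g' : ℝ → ℂ} (h : IsLoop g g') (h0 : ∀ t ∈ Icc (0 : ℝ) 1, g t ≠ 0) :
    ∃ W : ℝ → ℂ, ContinuousOn W (Icc 0 1) ∧ (∀ t ∈ Icc (0 : ℝ) 1, Complex.exp (W t) = g t) ∧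
      (∃ s : Set ℝ, s.Countable ∧ ∀ t ∈ Ioo (0 : ℝ) 1 \ s, HasDerivAt W (g' t / g t) t) ∧
      loopInt (fun z => z⁻¹) g g' = W 1 - W 0 := by
  have hint : IntervalIntegrable (fun t => g' t / g t) volume 0 1 := by
    refine (h.intervalIntegrable (F := fun z => z⁻¹) (h.cont.inv₀ h0)).congr ?_
    exact fun t _ => by simp [div_eq_inv_mul]
  obtain ⟨s, hs, hd⟩ := h.deriv
  set W : ℝ → ℂ := fun t => Complex.log (g 0) + ∫ x in (0 : ℝ)..t, g' x / g x with hW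
  have hWc : ContinuousOn W (Icc 0 1) := by
    refine continuousOn_const.add ?_
    have := intervalIntegral.continuousOn_primitive_interval' hint left_mem_uIcc
    rwa [uIcc_of_le zero_le_one] at this
  have hWd : ∀ t ∈ Ioo (0 : ℝ) 1 \ s, HasDerivAt W (g' t / g t) t := by
    intro t ht
    have hsub : uIcc 0 t ⊆ uIcc (0 : ℝ) 1 := by
      rw [uIcc_of_le zero_le_one, uIcc_of_le ht.1.1.le]
      exact Icc_subset_Icc_right ht.1.2.le
    refine HasDerivAt.const_add _ (intervalIntegral.integral_hasDerivAt_right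
      (hint.mono_set hsub) ?_ ?_)
    · refine ⟨Ioc 0 1, Filter.mem_of_superset (Ioo_mem_nhds ht.1.1 ht.1.2) Ioo_subset_Ioc_self, ?_⟩
      exact hint.1.aestronglyMeasurable
    · exact (hd t ht).2.div (hd t ht).1.continuousAt (h0 t ⟨ht.1.1.le, ht.1.2.le⟩)
  -- The function exp(-W) g has derivative zero off a countable set and equals 1 at 0.
  have hexp : ∀ t ∈ Icc (0 : ℝ) 1, Complex.exp (W t) = g t := by
    intro t ht
    have hEd : ∀ u ∈ Ioo 0 t \ s, HasDerivAt (fun u => Complex.exp (-W u) * g u) 0 u := by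
      intro u hu
      have hu' : u ∈ Ioo (0 : ℝ) 1 \ s := ⟨⟨hu.1.1, hu.1.2.trans_le ht.2⟩, hu.2⟩
      have h1 := ((hWd u hu').neg.cexp.mul (hd u hu').1)
      have := h0 u ⟨hu'.1.1.le, hu'.1.2.le⟩
      refine h1.congr_deriv ?_
      field_simp
      simp
    have hsub : Icc 0 t ⊆ Icc (0 : ℝ) 1 := Icc_subset_Icc_right ht.2
    have hEc : ContinuousOn (fun u => Complex.exp (-W u) * g u) (Icc 0 t) :=
      ((hWc.mono hsub).neg.cexp).mul (h.cont.mono hsub)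
    have := integral_eq_of_hasDerivAt_off_countable_of_le _ (fun _ => (0 : ℂ)) ht.1 hs hEc hEd
      (by simp)
    have hW0 : Complex.exp (-W 0) * g 0 = 1 := by
      have h00 := h0 0 (by simp)
      simp [hW, Complex.exp_neg, Complex.exp_log h00, h00]
    rw [intervalIntegral.integral_zero, hW0, eq_comm, sub_eq_zero, Complex.exp_neg] at this
    field_simp at this
    exact this.symm
  refine ⟨W, hWc, hexp, ⟨s, hs, hWd⟩, ?_⟩
  simp [hW, loopInt, div_eq_inv_mul]

lemma isOpen_exp_strip (r R : ℝ) : IsOpen {w : ℂ | Complex.exp w ∈ annulus r R} :=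
  (isOpen_annulus r R).preimage Complex.continuous_exp

/-- Only Re w enters, so this is a vertical strip. Convexity provides primitives on it. -/
lemma convex_exp_strip (r R : ℝ) : Convex ℝ {w : ℂ | Complex.exp w ∈ annulus r R} := by
  have h : {w : ℂ | Complex.exp w ∈ annulus r R} =
      Complex.reLm ⁻¹' {x : ℝ | r < Real.exp x ∧ Real.exp x < R} := by
    ext w; simp [annulus, Complex.norm_exp]
  rw [h]
  refine Convex.linear_preimage (OrdConnected.convex ⟨?_⟩) _
  intro x hx y hy z hz
  exact ⟨hx.1.trans_le (Real.exp_le_exp.2 hz.1), (Real.exp_le_exp.2 hz.2).trans_lt hy.2⟩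

/-- The integral of a holomorphic function on an annulus along a closed curve is proportional to
the winding number of the curve around the origin. -/
lemma exists_loopInt_eq_mul {r R : ℝ} (hr : 0 ≤ r) {Ψ : ℂ → ℂ}
    (hΨ : DifferentiableOn ℂ Ψ (annulus r R)) :
    ∃ κ : ℂ, ∀ g g' : ℝ → ℂ, IsLoop g g' → (∀ t ∈ Icc (0 : ℝ) 1, g t ∈ annulus r R) →
      loopInt Ψ g g' = κ * loopInt (fun z => z⁻¹) g g' := by
  set S : Set ℂ := {w : ℂ | Complex.exp w ∈ annulus r R} with hS
  have hSo : IsOpen S := isOpen_exp_strip r R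
  have hSc : Convex ℝ S := convex_exp_strip r R
  have hdiff : DifferentiableOn ℂ (fun w => Ψ (Complex.exp w) * Complex.exp w) S :=
    (hΨ.comp Complex.differentiable_exp.differentiableOn fun w hw => hw).mul
      Complex.differentiable_exp.differentiableOn
  obtain ⟨Φ, hΦ⟩ := hSc.exists_forall_hasDerivWithinAt hdiff
  have hΦ' : ∀ w ∈ S, HasDerivAt Φ (Ψ (Complex.exp w) * Complex.exp w) w := fun w hw =>
    (hΦ w hw).hasDerivAt (hSo.mem_nhds hw)
  have hper : ∀ w ∈ S, w + 2 * Real.pi * Complex.I ∈ S := by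
    intro w hw
    simpa [hS, Complex.exp_add, Complex.exp_two_pi_mul_I] using hw
  have hper' : ∀ (m : ℤ), ∀ w ∈ S, w + m * (2 * Real.pi * Complex.I) ∈ S := by
    intro m w hw
    simpa [hS, Complex.exp_add, Complex.exp_int_mul, Complex.exp_two_pi_mul_I] using hw
  -- The primitive Φ need not be periodic, but its derivative is, so its increment over 2πi is
  -- constant.
  have hconst : ∃ κ : ℂ, ∀ w ∈ S, Φ (w + 2 * Real.pi * Complex.I) - Φ w = κ := by
    have hd : ∀ w ∈ S, HasDerivAt (fun w => Φ (w + 2 * Real.pi * Complex.I) - Φ w) 0 w := by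
      intro w hw
      have h1 := (hΦ' _ (hper w hw)).comp_add_const w (2 * Real.pi * Complex.I)
      have h2 := h1.sub (hΦ' w hw)
      rwa [Complex.exp_add, Complex.exp_two_pi_mul_I, mul_one, sub_self] at h2
    exact hSo.exists_is_const_of_deriv_eq_zero hSc.isPreconnected
      (fun w hw => (hd w hw).differentiableAt.differentiableWithinAt)
      (fun w hw => (hd w hw).deriv)
  obtain ⟨κ, hκ⟩ := hconst
  have hκm : ∀ (m : ℤ), ∀ w ∈ S, Φ (w + m * (2 * Real.pi * Complex.I)) - Φ w = m * κ := by
    intro m w hw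
    induction m using Int.induction_on with
    | zero => simp
    | succ n ih =>
      have := hκ _ (hper' n w hw)
      push_cast at this ih ⊢
      rw [add_mul, add_mul, one_mul, ← add_assoc, one_mul]
      linear_combination this + ih
    | pred n ih =>
      have := hκ _ (hper' (-n - 1) w hw)
      have e : w + ((-n - 1 : ℤ) : ℂ) * (2 * Real.pi * Complex.I) + 2 * Real.pi * Complex.I =
        w + ((-n : ℤ) : ℂ) * (2 * Real.pi * Complex.I) := by push_cast; ring
      rw [e] at this
      push_cast at this ih ⊢
      linear_combination ih - this
  refine ⟨κ / (2 * Real.pi * Complex.I), fun g g' hg hU => ?_⟩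
  obtain ⟨W, hWc, hexp, ⟨s, hs, hWd⟩, hlog⟩ :=
    hg.exists_log fun t ht => ne_zero_of_mem_annulus hr (hU t ht)
  have hWS : ∀ t ∈ Icc (0 : ℝ) 1, W t ∈ S := fun t ht => by
    simpa [hS, hexp t ht] using hU t ht
  have hI : loopInt Ψ g g' = Φ (W 1) - Φ (W 0) := by
    refine integral_eq_of_hasDerivAt_off_countable_of_le (fun t => Φ (W t)) _ zero_le_one hs
      ?_ ?_ ?_
    · exact ContinuousOn.comp (t := S) (fun w hw => (hΦ' w hw).continuousAt.continuousWithinAt)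
        hWc hWS
    · intro t ht
      have ht' : t ∈ Icc (0 : ℝ) 1 := ⟨ht.1.1.le, ht.1.2.le⟩
      have h1 := (hΦ' _ (hWS t ht')).comp t (hWd t ht)
      have h2 : g t ≠ 0 := ne_zero_of_mem_annulus hr (hU t ht')
      refine h1.congr_deriv ?_
      rw [hexp t ht']
      field_simp
    · exact hg.intervalIntegrable (hΨ.continuousOn.comp hg.cont hU)
  -- The lifted curve ends m periods away from its start; m is the winding number about the origin,
  -- and both integrals are proportional to it.
  obtain ⟨m, hm⟩ := Complex.exp_eq_exp_iff_exists_int.1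
    (show Complex.exp (W 1) = Complex.exp (W 0) by
      rw [hexp 1 (by simp), hexp 0 (by simp), hg.closed])
  rw [hI, hlog, hm, hκm m _ (hWS 0 (by simp))]
  have := Complex.two_pi_I_ne_zero
  field_simp
  ring

/-- The integrals of a function with finitely many simple poles along two closed curves in an
annulus agree if the winding numbers around the origin and the poles do. -/
lemma loopInt_div_prod_eq {r R : ℝ} (hr : 0 ≤ r) {g₁ g₁' g₂ g₂' : ℝ → ℂ}
    (h₁ : IsLoop g₁ g₁') (h₂ : IsLoop g₂ g₂')
    (hU₁ : ∀ t ∈ Icc (0 : ℝ) 1, g₁ t ∈ annulus r R) (hU₂ : ∀ t ∈ Icc (0 : ℝ) 1, g₂ t ∈ annulus r R)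
    (h0 : loopInt (fun z => z⁻¹) g₁ g₁' = loopInt (fun z => z⁻¹) g₂ g₂') (P : Finset ℂ) :
    ∀ Ψ : ℂ → ℂ, DifferentiableOn ℂ Ψ (annulus r R) → (∀ p ∈ P, p ∈ annulus r R) →
      (∀ p ∈ P, (∀ t ∈ Icc (0 : ℝ) 1, g₁ t ≠ p) ∧ (∀ t ∈ Icc (0 : ℝ) 1, g₂ t ≠ p) ∧
        loopInt (fun z => (z - p)⁻¹) g₁ g₁' = loopInt (fun z => (z - p)⁻¹) g₂ g₂') →
      loopInt (fun z => Ψ z / ∏ p ∈ P, (z - p)) g₁ g₁' =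
        loopInt (fun z => Ψ z / ∏ p ∈ P, (z - p)) g₂ g₂' := by
  classical
  induction P using Finset.induction_on with
  | empty =>
    intro Ψ hΨ _ _
    obtain ⟨κ, hκ⟩ := exists_loopInt_eq_mul hr hΨ
    simp only [Finset.prod_empty, div_one]
    rw [hκ _ _ h₁ hU₁, hκ _ _ h₂ hU₂, h0]
  | insert p P hp ih =>
    intro Ψ hΨ hPU hw
    set Q : ℂ → ℂ := fun z => ∏ s ∈ P, (z - s) with hQ
    have hQd : Differentiable ℂ Q := by
      simp only [hQ]; fun_prop
    have hQp : Q p ≠ 0 := Finset.prod_ne_zero_iff.2 fun s hs => sub_ne_zero.2 fun h => hp (h ▸ hs)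
    -- Splits off the residue at p: with this c, Φ vanishes at p, and Ψ / ((z - p) Q) becomes
    -- `dslope Φ p` / Q, which has one pole fewer, plus c / (z - p).
    set c := Ψ p / Q p with hc
    set Φ : ℂ → ℂ := fun z => Ψ z - c * Q z with hΦ
    have hΦd : DifferentiableOn ℂ Φ (annulus r R) :=
      hΨ.sub ((hQd.differentiableOn).const_mul c)
    have hΦp : Φ p = 0 := by simp only [hΦ, hc]; field_simp; ring
    have hpU := hPU p (Finset.mem_insert_self p P)
    have hΨ₁ : DifferentiableOn ℂ (dslope Φ p) (annulus r R) :=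
      (Complex.differentiableOn_dslope ((isOpen_annulus r R).mem_nhds hpU)).2 hΦd
    have hPU' : ∀ s ∈ P, s ∈ annulus r R := fun s hs => hPU s (Finset.mem_insert_of_mem hs)
    have hw' := fun s hs => hw s (Finset.mem_insert_of_mem (s := P) (b := p) (a := s) hs)
    have hwp := hw p (Finset.mem_insert_self p P)
    have key : ∀ g g' : ℝ → ℂ, IsLoop g g' → (∀ t ∈ Icc (0 : ℝ) 1, g t ∈ annulus r R) →
        (∀ t ∈ Icc (0 : ℝ) 1, g t ≠ p) → (∀ s ∈ P, ∀ t ∈ Icc (0 : ℝ) 1, g t ≠ s) →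
        loopInt (fun z => Ψ z / ∏ s ∈ insert p P, (z - s)) g g' =
          loopInt (fun z => dslope Φ p z / Q z) g g' + c * loopInt (fun z => (z - p)⁻¹) g g' := by
      intro g g' hg hgU hgp hgP
      have hQg : ∀ t ∈ Icc (0 : ℝ) 1, Q (g t) ≠ 0 := fun t ht =>
        Finset.prod_ne_zero_iff.2 fun s hs => sub_ne_zero.2 (hgP s hs t ht)
      have hpg : ∀ t ∈ Icc (0 : ℝ) 1, g t - p ≠ 0 := fun t ht => sub_ne_zero.2 (hgp t ht)
      rw [← loopInt_const_mul, ← hg.loopInt_add]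
      · refine loopInt_congr fun t ht => ?_
        have h1 := sub_smul_dslope Φ p (g t)
        rw [hΦp, sub_zero, smul_eq_mul] at h1
        rw [Finset.prod_insert hp]
        have h2 := hQg t ht
        have h3 := hpg t ht
        change Ψ (g t) / ((g t - p) * Q (g t)) = _
        field_simp
        linear_combination -h1
      · exact (hΨ₁.continuousOn.comp hg.cont hgU).div
          (hQd.continuous.comp_continuousOn hg.cont) hQg
      · exact continuousOn_const.mul ((hg.cont.sub continuousOn_const).inv₀ hpg)
    rw [key _ _ h₁ hU₁ hwp.1 fun s hs => (hw' s hs).1,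
      key _ _ h₂ hU₂ hwp.2.1 fun s hs => (hw' s hs).2.1, hwp.2.2, ih _ hΨ₁ hPU' hw']

/-- On every annulus around the origin, `F` has only finitely many singularities; they are simple
poles and lie in `Z`. -/
def SimplePoles (F : ℂ → ℂ) (Z : Set ℂ) : Prop :=
  ∀ r R : ℝ, 0 < r → ∃ (P : Finset ℂ) (Ψ : ℂ → ℂ), (∀ p ∈ P, p ∈ Z) ∧
    DifferentiableOn ℂ Ψ (annulus r R) ∧
    ∀ z ∈ annulus r R, z ∉ Z → F z * ∏ p ∈ P, (z - p) = Ψ z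

lemma SimplePoles.of_differentiable {F : ℂ → ℂ} (h : ∀ z ≠ 0, DifferentiableAt ℂ F z) :
    SimplePoles F ∅ := fun r R hr => ⟨∅, F, by simp, fun z hz =>
  (h z (ne_zero_of_mem_annulus hr.le hz)).differentiableWithinAt, by simp⟩

lemma SimplePoles.mono {F : ℂ → ℂ} {Z Z' : Set ℂ} (h : SimplePoles F Z) (hZ : Z ⊆ Z') :
    SimplePoles F Z' := fun r R hr => by
  obtain ⟨P, Ψ, h1, h2, h3⟩ := h r R hr
  exact ⟨P, Ψ, fun p hp => hZ (h1 p hp), h2, fun z hz hzZ => h3 z hz fun h => hzZ (hZ h)⟩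

lemma SimplePoles.congr {F F' : ℂ → ℂ} {Z : Set ℂ} (h : SimplePoles F Z)
    (hF : ∀ z ≠ 0, z ∉ Z → F' z = F z) : SimplePoles F' Z := fun r R hr => by
  obtain ⟨P, Ψ, h1, h2, h3⟩ := h r R hr
  exact ⟨P, Ψ, h1, h2, fun z hz hzZ => by
    rw [hF z (ne_zero_of_mem_annulus hr.le hz) hzZ, h3 z hz hzZ]⟩

/-- Disjointness keeps the poles simple: the two finite lists of poles have no common member, so the
denominators multiply to a product over the union. -/
lemma SimplePoles.mul {F G : ℂ → ℂ} {Z W : Set ℂ} (hF : SimplePoles F Z) (hG : SimplePoles G W)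
    (hd : Disjoint Z W) : SimplePoles (fun z => F z * G z) (Z ∪ W) := by
  classical
  intro r R hr
  obtain ⟨P, Ψ, h1, h2, h3⟩ := hF r R hr
  obtain ⟨Q, Φ, k1, k2, k3⟩ := hG r R hr
  have hPQ : Disjoint P Q := Finset.disjoint_left.2 fun p hp hq =>
    Set.disjoint_left.1 hd (h1 p hp) (k1 p hq)
  refine ⟨P ∪ Q, fun z => Ψ z * Φ z, ?_, h2.mul k2, fun z hz hzZ => ?_⟩
  · intro p hp
    rcases Finset.mem_union.1 hp with h | h
    · exact Or.inl (h1 p h)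
    · exact Or.inr (k1 p h)
  · beta_reduce
    rw [Finset.prod_union hPQ, ← h3 z hz fun h => hzZ (Or.inl h),
      ← k3 z hz fun h => hzZ (Or.inr h)]
    ring

lemma SimplePoles.mul_differentiable {F G : ℂ → ℂ} {Z : Set ℂ} (hF : SimplePoles F Z)
    (hG : ∀ z ≠ 0, DifferentiableAt ℂ G z) : SimplePoles (fun z => F z * G z) Z := by
  simpa using hF.mul (SimplePoles.of_differentiable hG) (Set.disjoint_empty Z)

lemma SimplePoles.prod {ι : Type*} (s : Finset ι) {F : ι → ℂ → ℂ} {Z : ι → Set ℂ}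
    (hF : ∀ i ∈ s, SimplePoles (F i) (Z i))
    (hd : ∀ i ∈ s, ∀ j ∈ s, i ≠ j → Disjoint (Z i) (Z j)) :
    SimplePoles (fun z => ∏ i ∈ s, F i z) (⋃ i ∈ s, Z i) := by
  classical
  induction s using Finset.induction_on with
  | empty => simpa using SimplePoles.of_differentiable (F := fun _ => 1) (by fun_prop)
  | insert a s ha ih =>
    simp only [Finset.prod_insert ha, Finset.set_biUnion_insert]
    refine (hF a (by simp)).mul (ih (fun i hi => hF i (by simp [hi]))
      fun i hi j hj => hd i (by simp [hi]) j (by simp [hj])) ?_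
    rw [Set.disjoint_iUnion₂_right]
    exact fun i hi => hd a (by simp) i (by simp [hi]) fun h => ha (h ▸ hi)

lemma exists_annulus {g : ℝ → ℂ} (hc : ContinuousOn g (Icc 0 1))
    (h0 : ∀ t ∈ Icc (0 : ℝ) 1, g t ≠ 0) :
    ∃ r R : ℝ, 0 < r ∧ ∀ t ∈ Icc (0 : ℝ) 1, g t ∈ annulus r R := by
  have hne : (Icc (0 : ℝ) 1).Nonempty := ⟨0, by simp⟩
  obtain ⟨a, ha, hmin⟩ := isCompact_Icc.exists_isMinOn hne hc.norm
  obtain ⟨b, hb, hmax⟩ := isCompact_Icc.exists_isMaxOn hne hc.norm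
  have hpos : 0 < ‖g a‖ := norm_pos_iff.2 (h0 a ha)
  refine ⟨‖g a‖ / 2, ‖g b‖ + 1, by positivity, fun t ht => ⟨?_, ?_⟩⟩
  · have : ‖g a‖ ≤ ‖g t‖ := hmin ht
    linarith
  · have : ‖g t‖ ≤ ‖g b‖ := hmax ht
    linarith

lemma SimplePoles.continuousOn_comp {F : ℂ → ℂ} {Z : Set ℂ} (hF : SimplePoles F Z) {g : ℝ → ℂ}
    (hc : ContinuousOn g (Icc 0 1)) (h0 : ∀ t ∈ Icc (0 : ℝ) 1, g t ≠ 0)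
    (hZ : ∀ t ∈ Icc (0 : ℝ) 1, g t ∉ Z) : ContinuousOn (fun t => F (g t)) (Icc 0 1) := by
  obtain ⟨r, R, hr, hU⟩ := exists_annulus hc h0
  obtain ⟨P, Ψ, h1, h2, h3⟩ := hF r R hr
  have hne : ∀ t ∈ Icc (0 : ℝ) 1, ∏ p ∈ P, (g t - p) ≠ 0 := fun t ht =>
    Finset.prod_ne_zero_iff.2 fun p hp => sub_ne_zero.2 fun h => hZ t ht (h ▸ h1 p hp)
  have hprod : Continuous fun z : ℂ => ∏ p ∈ P, (z - p) := by fun_prop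
  refine ((h2.continuousOn.comp hc hU).div (hprod.comp_continuousOn hc) hne).congr fun t ht => ?_
  exact eq_div_of_mul_eq (hne t ht) (h3 _ (hU t ht) (hZ t ht))

/-- The residue theorem in the form that is used here: the integral of a function with simple
poles along a closed curve is determined by the winding numbers. -/
theorem SimplePoles.loopInt_eq {F : ℂ → ℂ} {Z : Set ℂ} (hF : SimplePoles F Z)
    {g₁ g₁' g₂ g₂' : ℝ → ℂ} (h₁ : IsLoop g₁ g₁') (h₂ : IsLoop g₂ g₂')
    (hn₁ : ∀ t ∈ Icc (0 : ℝ) 1, g₁ t ≠ 0) (hn₂ : ∀ t ∈ Icc (0 : ℝ) 1, g₂ t ≠ 0)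
    (h0 : loopInt (fun z => z⁻¹) g₁ g₁' = loopInt (fun z => z⁻¹) g₂ g₂')
    (hw : ∀ p ∈ Z, (∀ t ∈ Icc (0 : ℝ) 1, g₁ t ≠ p) ∧ (∀ t ∈ Icc (0 : ℝ) 1, g₂ t ≠ p) ∧
        loopInt (fun z => (z - p)⁻¹) g₁ g₁' = loopInt (fun z => (z - p)⁻¹) g₂ g₂') :
    loopInt F g₁ g₁' = loopInt F g₂ g₂' := by
  classical
  obtain ⟨r₁, R₁, hr₁, hU₁⟩ := exists_annulus h₁.cont hn₁
  obtain ⟨r₂, R₂, hr₂, hU₂⟩ := exists_annulus h₂.cont hn₂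
  set r := min r₁ r₂
  set R := max R₁ R₂
  have hr : 0 < r := lt_min hr₁ hr₂
  replace hU₁ : ∀ t ∈ Icc (0 : ℝ) 1, g₁ t ∈ annulus r R := fun t ht =>
    annulus_mono (min_le_left _ _) (le_max_left _ _) (hU₁ t ht)
  replace hU₂ : ∀ t ∈ Icc (0 : ℝ) 1, g₂ t ∈ annulus r R := fun t ht =>
    annulus_mono (min_le_right _ _) (le_max_right _ _) (hU₂ t ht)
  obtain ⟨P, Ψ, hPZ, hΨ, hFΨ⟩ := hF r R hr
  -- `SimplePoles` does not force the listed poles into the annulus. Factors belonging to outside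
  -- points have no zero there and are moved into the holomorphic part.
  set P₁ := P.filter (· ∈ annulus r R)
  set P₂ := P.filter (· ∉ annulus r R)
  have hsplit : ∀ z : ℂ, ∏ p ∈ P, (z - p) = (∏ p ∈ P₁, (z - p)) * ∏ p ∈ P₂, (z - p) := fun z =>
    (Finset.prod_filter_mul_prod_filter_not P _ _).symm
  have hP₂ : ∀ z ∈ annulus r R, ∏ p ∈ P₂, (z - p) ≠ 0 := fun z hz =>
    Finset.prod_ne_zero_iff.2 fun p hp => sub_ne_zero.2 fun h =>
      (Finset.mem_filter.1 hp).2 (h ▸ hz)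
  have hΨ' : DifferentiableOn ℂ (fun z => Ψ z / ∏ p ∈ P₂, (z - p)) (annulus r R) :=
    hΨ.div (by fun_prop) hP₂
  have key : ∀ g g' : ℝ → ℂ, (∀ t ∈ Icc (0 : ℝ) 1, g t ∈ annulus r R) →
      (∀ p ∈ Z, ∀ t ∈ Icc (0 : ℝ) 1, g t ≠ p) →
      loopInt F g g' = loopInt (fun z => (Ψ z / ∏ p ∈ P₂, (z - p)) / ∏ p ∈ P₁, (z - p)) g g' := by
    intro g g' hgU hgZ
    refine loopInt_congr fun t ht => ?_
    have hne : ∏ p ∈ P₁, (g t - p) ≠ 0 := Finset.prod_ne_zero_iff.2 fun p hp =>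
      sub_ne_zero.2 (hgZ p (hPZ p (Finset.mem_filter.1 hp).1) t ht)
    have h2 := hP₂ _ (hgU t ht)
    rw [← hFΨ _ (hgU t ht) fun h => hgZ _ h t ht rfl, hsplit]
    field_simp
  rw [key _ _ hU₁ fun p hp => (hw p hp).1, key _ _ hU₂ fun p hp => (hw p hp).2.1]
  refine loopInt_div_prod_eq hr.le h₁ h₂ hU₁ hU₂ h0 P₁ _ hΨ' (fun p hp => ?_) fun p hp => ?_
  · exact (Finset.mem_filter.1 hp).2
  · exact hw p (hPZ p (Finset.mem_filter.1 hp).1)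

/-! ### Piecewise C¹ paths as closed curves. -/

lemma contourIntegral_eq_loopInt (F : ℂ → ℂ) {x y : ℂ} (γ : Path x y) :
    contourIntegral F γ = loopInt F γ.extend (derivWithin γ.extend (Icc 0 1)) := by
  simp only [contourIntegral, curveIntegral_def, curveIntegralFun_def, loopInt]
  refine intervalIntegral.integral_congr fun t _ => ?_
  simp [mul_comm, unitInterval]

/-- A point of `(0, 1)` that is not a node of the partition lies inside one of its intervals. -/
lemma exists_mem_Ioo_of_partition {n : ℕ} {t : ℕ → ℝ} (h0 : t 0 = 0) (h1 : t n = 1) {u : ℝ}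
    (hu : u ∈ Ioo (0 : ℝ) 1) (hu' : u ∉ range t) : ∃ i < n, u ∈ Ioo (t i) (t (i + 1)) := by
  classical
  have hex : ∃ i, u < t i := ⟨n, h1 ▸ hu.2⟩
  have hpos : Nat.find hex ≠ 0 := by
    intro h
    have := Nat.find_spec hex
    rw [h, h0] at this
    exact absurd this hu.1.not_gt
  obtain ⟨i, hi⟩ := Nat.exists_eq_succ_of_ne_zero hpos
  have hle : Nat.find hex ≤ n := Nat.find_min' hex (h1 ▸ hu.2)
  refine ⟨i, by omega, ?_, ?_⟩
  · have := Nat.find_min hex (m := i) (by omega)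
    exact lt_of_le_of_ne (not_lt.1 this) fun h => hu' ⟨i, h⟩
  · have := Nat.find_spec hex
    rwa [hi] at this

/-- The nodes of the partition form the exceptional set. Inside a piece the derivative within [0,
1], the derivative within the piece and the ordinary derivative coincide, and the second is
continuous up to the ends of the piece, which gives integrability. -/
lemma IsPiecewiseC1.derivWithin_extend {x y : ℂ} {γ : Path x y} (h : IsPiecewiseC1 γ) :
    (∃ s : Set ℝ, s.Countable ∧ ∀ t ∈ Ioo (0 : ℝ) 1 \ s,
      HasDerivAt γ.extend (derivWithin γ.extend (Icc 0 1) t) t ∧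
        ContinuousAt (derivWithin γ.extend (Icc 0 1)) t) ∧
    IntervalIntegrable (derivWithin γ.extend (Icc 0 1)) volume 0 1 := by
  obtain ⟨n, t, hmono, h0, h1, hC⟩ := h
  have hd : ∀ i < n, ∀ u ∈ Ioo (t i) (t (i + 1)),
      derivWithin γ.extend (Icc 0 1) =ᶠ[𝓝 u] deriv γ.extend ∧ ContDiffAt ℝ 1 γ.extend u := by
    intro i hi u hu
    have ha : 0 ≤ t i := h0 ▸ hmono (Nat.zero_le i)
    have hb : t (i + 1) ≤ 1 := h1 ▸ hmono hi
    refine ⟨?_, (hC i hi).contDiffAt (Icc_mem_nhds hu.1 hu.2)⟩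
    filter_upwards [isOpen_Ioo.mem_nhds hu] with v hv
    exact derivWithin_of_mem_nhds (Icc_mem_nhds (ha.trans_lt hv.1) (hv.2.trans_le hb))
  refine ⟨⟨range t, countable_range t, ?_⟩, ?_⟩
  · intro u hu
    obtain ⟨i, hi, hui⟩ := exists_mem_Ioo_of_partition h0 h1 hu.1 hu.2
    obtain ⟨he, hcd⟩ := hd i hi u hui
    refine ⟨?_, ?_⟩
    · rw [he.self_of_nhds]
      exact (hcd.differentiableAt one_ne_zero).hasDerivAt
    · refine ContinuousAt.congr ?_ he.symm
      have h2 := ((hC i hi).mono Ioo_subset_Icc_self).continuousOn_deriv_of_isOpen isOpen_Ioo le_rfl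
      exact h2.continuousAt (isOpen_Ioo.mem_nhds hui)
  · rw [← h0, ← h1]
    refine IntervalIntegrable.trans_iterate fun i hi => ?_
    -- The partition is only weakly monotone, so a piece may be a single point.
    rcases (hmono (Nat.le_succ i)).eq_or_lt with heq | hlt
    · rw [← Nat.succ_eq_add_one, ← heq]
    · have hc := (hC i hi).continuousOn_derivWithin (uniqueDiffOn_Icc hlt) le_rfl
      refine (hc.intervalIntegrable_of_Icc hlt.le).congr_uIoo fun u hu => ?_
      rw [uIoo_of_lt hlt] at hu
      rw [h0, h1, (hd i hi u hu).1.self_of_nhds,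
        derivWithin_of_mem_nhds (Icc_mem_nhds hu.1 hu.2)]

lemma IsPiecewiseC1.isLoop {x : ℂ} {γ : Path x x} (h : IsPiecewiseC1 γ) :
    IsLoop γ.extend (derivWithin γ.extend (Icc 0 1)) :=
  ⟨γ.continuous_extend.continuousOn, h.derivWithin_extend.1, h.derivWithin_extend.2, by simp⟩

lemma IsPiecewiseC1.of_contDiffOn {x y : ℂ} {γ : Path x y}
    (h : ContDiffOn ℝ 1 γ.extend (Icc 0 1)) : IsPiecewiseC1 γ := by
  refine ⟨1, fun i => i, Nat.mono_cast, by simp, by simp, fun i hi => ?_⟩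
  obtain rfl : i = 0 := by omega
  simpa using h

lemma IsPiecewiseC1.trans {x y z : ℂ} {γ : Path x y} {δ : Path y z} (hγ : IsPiecewiseC1 γ)
    (hδ : IsPiecewiseC1 δ) : IsPiecewiseC1 (γ.trans δ) := by
  obtain ⟨n, t, hmono, h0, h1, hC⟩ := hγ
  obtain ⟨m, s, smono, s0, s1, sC⟩ := hδ
  have ht1 : ∀ i ≤ n, t i ≤ 1 := fun i hi => h1 ▸ hmono hi
  have hs0 : ∀ i, 0 ≤ s i := fun i => s0 ▸ smono (Nat.zero_le i)
  -- Both formulas give 1/2 at i = n, because t n = 1 and s 0 = 0.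
  refine ⟨n + m, fun i => if i ≤ n then t i / 2 else (1 + s (i - n)) / 2, ?_, ?_, ?_, ?_⟩
  · refine monotone_nat_of_le_succ fun i => ?_
    split_ifs with ha hb hb
    · have := hmono (Nat.le_succ i); simp only [Nat.succ_eq_add_one] at this; linarith
    · have := ht1 i ha; have := hs0 (i + 1 - n); linarith
    · omega
    · have := smono (show i - n ≤ i + 1 - n by omega); linarith
  · simp [h0]
  · rcases Nat.eq_zero_or_pos m with rfl | hm
    · rw [s0] at s1; norm_num at s1
    · beta_reduce
      rw [if_neg (by omega)]; simp [s1]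
  · intro i hi
    beta_reduce
    rcases lt_or_ge i n with hin | hin
    · rw [if_pos hin.le, if_pos (by omega : i + 1 ≤ n)]
      have hmaps : MapsTo (fun u : ℝ => 2 * u) (Icc (t i / 2) (t (i + 1) / 2))
          (Icc (t i) (t (i + 1))) := fun u hu => ⟨by linarith [hu.1], by linarith [hu.2]⟩
      refine ((hC i hin).comp (contDiff_const.mul contDiff_id).contDiffOn hmaps).congr
        fun u hu => ?_
      have := ht1 (i + 1) hin
      exact Path.extend_trans_of_le_half _ _ (by linarith [hu.2])
    · have e : (if i ≤ n then t i / 2 else (1 + s (i - n)) / 2) = (1 + s (i - n)) / 2 := by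
        split_ifs with h
        · obtain rfl : i = n := by omega
          simp [s0, h1]
        · rfl
      have e' : i + 1 - n = i - n + 1 := by omega
      rw [e, if_neg (by omega), e']
      have hmaps : MapsTo (fun u : ℝ => 2 * u - 1)
          (Icc ((1 + s (i - n)) / 2) ((1 + s (i - n + 1)) / 2))
          (Icc (s (i - n)) (s (i - n + 1))) := fun u hu => ⟨by linarith [hu.1], by linarith [hu.2]⟩
      refine ((sC (i - n) (by omega)).comp
        ((contDiff_const.mul contDiff_id).sub contDiff_const).contDiffOn hmaps).congr
        fun u hu => ?_
      have := hs0 (i - n)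
      exact Path.extend_trans_of_half_le _ _ (by linarith [hu.1])

/-! ### Integrals over circles, and curves obtained by scaling and inversion. -/

/-- The parametrization `t ↦ p + w exp(2πit)` of a circle. -/
noncomputable def circ (p w : ℂ) (t : ℝ) : ℂ := p + w * Complex.exp (2 * Real.pi * Complex.I * t)

/-- The derivative of `circ p w`. -/
noncomputable def circ' (w : ℂ) (t : ℝ) : ℂ :=
  w * (Complex.exp (2 * Real.pi * Complex.I * t) * (2 * Real.pi * Complex.I))

lemma hasDerivAt_circ (p w : ℂ) (t : ℝ) : HasDerivAt (circ p w) (circ' w t) t := by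
  have h1 : HasDerivAt (fun t : ℝ => 2 * Real.pi * Complex.I * (t : ℂ))
      (2 * Real.pi * Complex.I) t := by
    simpa using (Complex.ofRealCLM.hasDerivAt (x := t)).const_mul (2 * Real.pi * Complex.I)
  exact (h1.cexp.const_mul w).const_add p

lemma continuous_circ (p w : ℂ) : Continuous (circ p w) := by unfold circ; fun_prop

lemma continuous_circ' (w : ℂ) : Continuous (circ' w) := by unfold circ'; fun_prop

@[simp] lemma circ_zero (p w : ℂ) : circ p w 0 = p + w := by simp [circ]

@[simp] lemma circ_one (p w : ℂ) : circ p w 1 = p + w := by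
  simp [circ, Complex.exp_two_pi_mul_I]

lemma norm_circ_sub (p w : ℂ) (t : ℝ) : ‖circ p w t - p‖ = ‖w‖ := by
  have : (2 * Real.pi * Complex.I * t : ℂ) = ((2 * Real.pi * t : ℝ) : ℂ) * Complex.I := by
    push_cast; ring
  rw [circ, add_sub_cancel_left, norm_mul, this, Complex.norm_exp_ofReal_mul_I, mul_one]

lemma isLoop_circ (p w : ℂ) : IsLoop (circ p w) (circ' w) where
  cont := (continuous_circ p w).continuousOn
  deriv := ⟨∅, countable_empty, fun t _ => ⟨hasDerivAt_circ p w t, (continuous_circ' w).continuousAt⟩⟩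
  int := (continuous_circ' w).intervalIntegrable _ _
  closed := by simp

/-- The substitution z ↦ p + w z carries the unit circle to the circle with centre p starting at p +
w; w is complex, so any starting point is allowed. -/
lemma loopInt_circ (F : ℂ → ℂ) (p w : ℂ) :
    loopInt F (circ p w) (circ' w) = ∮ z in C(0, 1), w * F (p + w * z) := by
  rw [loopInt, circleIntegral]
  have h := intervalIntegral.smul_integral_comp_mul_left (a := 0) (b := 1)
    (fun θ : ℝ => deriv (circleMap 0 1) θ • (w * F (p + w * circleMap 0 1 θ))) (2 * Real.pi)
  rw [mul_zero, mul_one] at h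
  rw [← h, ← intervalIntegral.integral_smul]
  refine intervalIntegral.integral_congr fun t _ => ?_
  have e : (((2 * Real.pi * t : ℝ) : ℂ) * Complex.I) = 2 * Real.pi * Complex.I * t := by
    push_cast; ring
  simp only [circ, circ', deriv_circleMap, circleMap_zero, smul_eq_mul, e, Complex.real_smul]
  push_cast
  simp only [one_mul]
  ring

lemma loopInt_circ_inv_sub {p w s : ℂ} (hs : ‖s - p‖ ≠ ‖w‖) :
    loopInt (fun z => (z - s)⁻¹) (circ p w) (circ' w) =
      if ‖s - p‖ < ‖w‖ then 2 * Real.pi * Complex.I else 0 := by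
  rw [loopInt_circ]
  rcases eq_or_ne w 0 with rfl | hw
  · simp [circleIntegral, (norm_nonneg (s - p)).not_gt]
  have hw' : 0 < ‖w‖ := norm_pos_iff.2 hw
  have e : ∀ z : ℂ, w * (p + w * z - s)⁻¹ = (z - (s - p) / w)⁻¹ := by
    intro z
    rw [show p + w * z - s = w * (z - (s - p) / w) by field_simp; ring, mul_inv,
      mul_inv_cancel_left₀ hw]
  simp only [e]
  split_ifs with h
  · refine circleIntegral.integral_sub_inv_of_mem_ball ?_
    rw [mem_ball_zero_iff, norm_div, div_lt_one hw']
    exact h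
  · have hlt : 1 < ‖(s - p) / w‖ := by
      rw [norm_div, one_lt_div hw']
      exact lt_of_le_of_ne (not_lt.1 h) hs.symm
    have hne : ∀ z ∈ Metric.closedBall (0 : ℂ) 1, z - (s - p) / w ≠ 0 := by
      intro z hz h0
      rw [sub_eq_zero] at h0
      rw [mem_closedBall_zero_iff, h0] at hz
      linarith
    refine Complex.circleIntegral_eq_zero_of_differentiable_on_off_countable zero_le_one
      countable_empty ?_ ?_
    · exact (continuousOn_id.sub continuousOn_const).inv₀ hne
    · intro z hz
      exact (differentiableAt_id.sub_const _).inv (hne z (Metric.ball_subset_closedBall hz.1))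

lemma loopInt_inv_circ_zero {w : ℂ} (hw : w ≠ 0) :
    loopInt (fun z => z⁻¹) (circ 0 w) (circ' w) = 2 * Real.pi * Complex.I := by
  have := loopInt_circ_inv_sub (p := 0) (w := w) (s := 0) (by simpa using (norm_pos_iff.2 hw).ne)
  simpa [norm_pos_iff.2 hw] using this

/-- The winding number of a closed curve is the same around the origin and around points closer
to the origin than the curve. -/
lemma IsLoop.loopInt_inv_sub_eq {g g' : ℝ → ℂ} (h : IsLoop g g') {p : ℂ}
    (hp : ∀ t ∈ Icc (0 : ℝ) 1, ‖p‖ < ‖g t‖) :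
    loopInt (fun z => (z - p)⁻¹) g g' = loopInt (fun z => z⁻¹) g g' := by
  have h0 : ∀ t ∈ Icc (0 : ℝ) 1, g t ≠ 0 := fun t ht =>
    norm_pos_iff.1 ((norm_nonneg p).trans_lt (hp t ht))
  obtain ⟨r, R, hr, hU⟩ := exists_annulus h.cont h0
  set R' := max R (‖p‖ + 2) with hR'
  have hgU : ∀ t ∈ Icc (0 : ℝ) 1, g t ∈ annulus ‖p‖ R' := fun t ht =>
    ⟨hp t ht, (hU t ht).2.trans_le (le_max_left _ _)⟩
  have hd : DifferentiableOn ℂ (fun z => (z - p)⁻¹) (annulus ‖p‖ R') := fun z hz =>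
    ((differentiableAt_id.sub_const p).inv (sub_ne_zero.2 fun h => by
      rw [id] at h; exact hz.1.ne (by rw [h]))).differentiableWithinAt
  obtain ⟨κ, hκ⟩ := exists_loopInt_eq_mul (norm_nonneg p) hd
  -- The proportionality factor κ is read off from the circle of radius |p| + 1 about 0, which
  -- encloses both 0 and p.
  set w : ℂ := ((‖p‖ + 1 : ℝ) : ℂ) with hw
  have hwn : ‖w‖ = ‖p‖ + 1 := by
    rw [hw, Complex.norm_real, Real.norm_of_nonneg (by positivity)]
  have hw0 : w ≠ 0 := norm_pos_iff.1 (by rw [hwn]; positivity)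
  have h1 := hκ (circ 0 w) (circ' w) (isLoop_circ 0 w) (fun t _ => by
    have := norm_circ_sub 0 w t
    rw [sub_zero, hwn] at this
    refine ⟨by linarith, ?_⟩
    rw [this]
    exact lt_of_lt_of_le (by linarith) (le_max_right _ _))
  rw [loopInt_inv_circ_zero hw0, loopInt_circ_inv_sub (by simp [hwn]), sub_zero, hwn,
    if_pos (by linarith)] at h1
  have hκ1 : κ = 1 := by
    have := Complex.two_pi_I_ne_zero
    field_simp at h1
    exact h1.symm
  rw [hκ g g' h hgU, hκ1, one_mul]

lemma isLoop_const_mul {g g' : ℝ → ℂ} (h : IsLoop g g') (c : ℂ) :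
    IsLoop (fun t => c * g t) (fun t => c * g' t) where
  cont := continuousOn_const.mul h.cont
  deriv := by
    obtain ⟨s, hs, hd⟩ := h.deriv
    exact ⟨s, hs, fun t ht => ⟨(hd t ht).1.const_mul c, continuousAt_const.mul (hd t ht).2⟩⟩
  int := h.int.const_mul c
  closed := by rw [h.closed]

lemma loopInt_const_mul_loop (F : ℂ → ℂ) (g g' : ℝ → ℂ) (c : ℂ) :
    loopInt F (fun t => c * g t) (fun t => c * g' t) = loopInt (fun z => c * F (c * z)) g g' :=
  intervalIntegral.integral_congr fun t _ => by ring

/-- The inverse of a closed curve, with the orientation reversed. -/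
lemma IsLoop.inv_symm {g g' : ℝ → ℂ} (h : IsLoop g g') (h0 : ∀ t ∈ Icc (0 : ℝ) 1, g t ≠ 0) :
    IsLoop (fun t => (g (1 - t))⁻¹) (fun t => g' (1 - t) / g (1 - t) ^ 2) where
  cont := (h.cont.comp (by fun_prop) fun t ht => ⟨by linarith [ht.2], by linarith [ht.1]⟩).inv₀
    fun t ht => h0 _ ⟨by linarith [ht.2], by linarith [ht.1]⟩
  deriv := by
    obtain ⟨s, hs, hd⟩ := h.deriv
    refine ⟨(fun t => 1 - t) ⁻¹' s, hs.preimage (fun a b hab => by simpa using hab), fun t ht => ?_⟩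
    have ht' : 1 - t ∈ Ioo (0 : ℝ) 1 \ s :=
      ⟨⟨by linarith [ht.1.2], by linarith [ht.1.1]⟩, ht.2⟩
    have hne := h0 (1 - t) ⟨ht'.1.1.le, ht'.1.2.le⟩
    obtain ⟨h1, h2⟩ := hd _ ht'
    have h3 : HasDerivAt (fun t => g (1 - t)) (-g' (1 - t)) t := by
      simpa using! HasDerivAt.comp_const_sub 1 t h1
    refine ⟨?_, ?_⟩
    · refine (h3.inv hne).congr_deriv ?_
      ring
    · have h4 : ContinuousAt (fun t : ℝ => 1 - t) t := by fun_prop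
      exact (ContinuousAt.comp (f := fun t : ℝ => 1 - t) h2 h4).div
        ((ContinuousAt.comp (f := fun t : ℝ => 1 - t) h1.continuousAt h4).pow 2)
        (pow_ne_zero 2 hne)
  int := by
    have h1 : IntervalIntegrable (fun t => (g t ^ 2)⁻¹ * g' t) volume 0 1 :=
      h.intervalIntegrable (F := fun z => (z ^ 2)⁻¹)
        ((h.cont.pow 2).inv₀ fun t ht => pow_ne_zero 2 (h0 t ht))
    have h2 := (h1.comp_sub_left 1).symm
    simp only [sub_zero, sub_self] at h2
    exact h2.congr fun t _ => by ring
  closed := by simp [h.closed]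

lemma loopInt_inv_symm (F : ℂ → ℂ) (g g' : ℝ → ℂ) :
    loopInt F (fun t => (g (1 - t))⁻¹) (fun t => g' (1 - t) / g (1 - t) ^ 2) =
      loopInt (fun z => F z⁻¹ / z ^ 2) g g' := by
  simp only [loopInt]
  rw [intervalIntegral.integral_comp_sub_left (fun t => F (g t)⁻¹ * (g' t / g t ^ 2)) 1]
  simp only [sub_zero, sub_self]
  exact intervalIntegral.integral_congr fun t _ => by ring

/-! ### Curves that separate geometric sequences from their reciprocals. -/

/-- The closed curve `g` encircles the points `c_j q^k`, `k ≥ 0`, once in the positive direction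
and has their reciprocals outside. -/
structure Separates {ι : Type*} (q : ℂ) (c : ι → ℂ) (g g' : ℝ → ℂ) : Prop where
  isLoop : IsLoop g g'
  ne_zero : ∀ t ∈ Icc (0 : ℝ) 1, g t ≠ 0
  avoid : ∀ j (k : ℕ), ∀ t ∈ Icc (0 : ℝ) 1, g t ≠ c j * q ^ k
  inside : ∀ j (k : ℕ), loopInt (fun z => (z - c j * q ^ k)⁻¹) g g' = 2 * Real.pi * Complex.I
  avoid_inv : ∀ j (k : ℕ), ∀ t ∈ Icc (0 : ℝ) 1, g t ≠ (c j * q ^ k)⁻¹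
  outside : ∀ j (k : ℕ), loopInt (fun z => (z - (c j * q ^ k)⁻¹)⁻¹) g g' = 0

lemma exists_norm_mul_pow_lt {q : ℂ} (hq : ‖q‖ < 1) (a : ℂ) {ε : ℝ} (hε : 0 < ε) :
    ∃ K : ℕ, ∀ k ≥ K, ‖a * q ^ k‖ < ε := by
  have h : Filter.Tendsto (fun k : ℕ => ‖a * q ^ k‖) Filter.atTop (𝓝 0) := by
    have := (tendsto_pow_atTop_nhds_zero_of_norm_lt_one hq).const_mul a
    simpa using this.norm
  exact Filter.eventually_atTop.1 (h.eventually_lt_const hε)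

/-- The points c_j q^k tend to 0, and those nearer to 0 than the curve have the same winding number
as 0 itself. -/
lemma Separates.loopInt_inv {ι : Type*} [Nonempty ι] {q : ℂ} (hq : ‖q‖ < 1) {c : ι → ℂ}
    {g g' : ℝ → ℂ} (h : Separates q c g g') :
    loopInt (fun z => z⁻¹) g g' = 2 * Real.pi * Complex.I := by
  obtain ⟨r, R, hr, hU⟩ := exists_annulus h.isLoop.cont h.ne_zero
  let j : ι := Classical.arbitrary ι
  obtain ⟨K, hK⟩ := exists_norm_mul_pow_lt hq (c j) hr
  rw [← h.inside j K]
  exact (h.isLoop.loopInt_inv_sub_eq fun t ht => (hK K le_rfl).trans (hU t ht).1).symm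

/-- Multiplying parameters by nonnegative powers of q only removes points from the conditions, so
one curve serves all such shifts. -/
lemma Separates.mul_pow {ι κ : Type*} {q : ℂ} {c : ι → ℂ} {g g' : ℝ → ℂ} (h : Separates q c g g')
    {d : κ → ℂ} (hd : ∀ i, ∃ j, ∃ n : ℕ, d i = c j * q ^ n) : Separates q d g g' := by
  have e : ∀ i (k : ℕ), ∃ j, ∃ n : ℕ, d i * q ^ k = c j * q ^ n := fun i k => by
    obtain ⟨j, n, hn⟩ := hd i
    exact ⟨j, n + k, by rw [hn, pow_add, mul_assoc]⟩
  refine ⟨h.isLoop, h.ne_zero, fun i k => ?_, fun i k => ?_, fun i k => ?_, fun i k => ?_⟩ <;>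
    obtain ⟨j, n, hn⟩ := e i k <;> rw [hn]
  exacts [h.avoid j n, h.inside j n, h.avoid_inv j n, h.outside j n]

/-- If `|c_j| < 1` for all `j`, then the unit circle separates the `c_j q^k` from their
reciprocals. -/
lemma separates_circ {ι : Type*} {q : ℂ} (hq0 : q ≠ 0) (hq : ‖q‖ < 1) {c : ι → ℂ}
    (hc0 : ∀ j, c j ≠ 0) (hc : ∀ j, ‖c j‖ < 1) : Separates q c (circ 0 1) (circ' 1) := by
  have hn : ∀ t, ‖circ 0 1 t‖ = 1 := fun t => by simpa using norm_circ_sub 0 1 t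
  have hlt : ∀ j (k : ℕ), ‖c j * q ^ k‖ < 1 := fun j k => by
    rw [norm_mul, norm_pow]
    exact mul_lt_one_of_nonneg_of_lt_one_left (norm_nonneg _) (hc j)
      (pow_le_one₀ (norm_nonneg q) hq.le)
  have hgt : ∀ j (k : ℕ), 1 < ‖(c j * q ^ k)⁻¹‖ := fun j k => by
    rw [norm_inv]
    exact one_lt_inv_iff₀.2 ⟨norm_pos_iff.2 (mul_ne_zero (hc0 j) (pow_ne_zero k hq0)), hlt j k⟩
  refine ⟨isLoop_circ 0 1, fun t _ h => ?_, fun j k t _ h => ?_, fun j k => ?_,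
    fun j k t _ h => ?_, fun j k => ?_⟩
  · have := hn t; rw [h] at this; simp at this
  · have := hlt j k; rw [← h, hn t] at this; exact lt_irrefl _ this
  · rw [loopInt_circ_inv_sub (by simpa using (hlt j k).ne), if_pos (by simpa using hlt j k)]
  · have := hgt j k; rw [← h, hn t] at this; exact lt_irrefl _ this
  · rw [loopInt_circ_inv_sub (by rw [sub_zero, norm_one]; exact (hgt j k).ne'), if_neg]
    rw [sub_zero, norm_one]; exact (hgt j k).not_gt

/-! ### Construction of separating contours. -/

lemma IsPiecewiseC1.curveIntegrable {x y : ℂ} {γ : Path x y} (h : IsPiecewiseC1 γ) {F : ℂ → ℂ}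
    (hF : ContinuousOn F (range γ)) :
    CurveIntegrable (fun z => ContinuousLinearMap.toSpanSingleton ℂ (F z)) γ := by
  have hc : ContinuousOn (fun t => F (γ.extend t)) (uIcc 0 1) :=
    hF.comp γ.continuous_extend.continuousOn fun t _ => by
      rw [← γ.extend_range]; exact mem_range_self t
  refine (h.derivWithin_extend.2.continuousOn_mul hc).congr fun t _ => ?_
  simp [curveIntegralFun_def, mul_comm, unitInterval]

lemma contourIntegral_trans {x y z : ℂ} {γ : Path x y} {δ : Path y z} (hγ : IsPiecewiseC1 γ)
    (hδ : IsPiecewiseC1 δ) {F : ℂ → ℂ} (hFγ : ContinuousOn F (range γ))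
    (hFδ : ContinuousOn F (range δ)) :
    contourIntegral F (γ.trans δ) = contourIntegral F γ + contourIntegral F δ :=
  curveIntegral_trans (hγ.curveIntegrable hFγ) (hδ.curveIntegrable hFδ)

lemma isPiecewiseC1_segment (x y : ℂ) : IsPiecewiseC1 (Path.segment x y) := by
  refine .of_contDiffOn (ContDiffOn.congr (f := fun t : ℝ => AffineMap.lineMap x y t) ?_ fun t ht =>
    Path.eqOn_extend_segment x y ht)
  simp only [AffineMap.lineMap_apply_module']
  fun_prop

/-- The circle with centre `p` through `c`, as a closed path. -/
noncomputable def circPath (p c : ℂ) : Path c c where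
  toFun t := circ p (c - p) t
  continuous_toFun := (continuous_circ _ _).comp continuous_subtype_val
  source' := by simp
  target' := by simp

lemma circPath_extend (p c : ℂ) {t : ℝ} (ht : t ∈ Icc (0 : ℝ) 1) :
    (circPath p c).extend t = circ p (c - p) t := by
  rw [Path.extend_apply _ ht]; rfl

lemma isPiecewiseC1_circPath (p c : ℂ) : IsPiecewiseC1 (circPath p c) := by
  refine .of_contDiffOn (ContDiffOn.congr (f := circ p (c - p)) ?_ fun t ht =>
    circPath_extend p c ht)
  unfold circ
  have : ContDiff ℝ 1 fun t : ℝ => (t : ℂ) := Complex.ofRealCLM.contDiff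
  have h2 : ContDiff ℝ 1 fun t : ℝ => Complex.exp (2 * Real.pi * Complex.I * t) :=
    (contDiff_const.mul this).cexp
  exact (contDiff_const.add (contDiff_const.mul h2)).contDiffOn

lemma contourIntegral_circPath (F : ℂ → ℂ) (p c : ℂ) :
    contourIntegral F (circPath p c) = loopInt F (circ p (c - p)) (circ' (c - p)) := by
  rw [contourIntegral_eq_loopInt]
  refine intervalIntegral.integral_congr_Ioo_of_le zero_le_one fun t ht => ?_
  have ht' : t ∈ Icc (0 : ℝ) 1 := Ioo_subset_Icc_self ht
  have h1 : derivWithin (circPath p c).extend (Icc 0 1) t = circ' (c - p) t := by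
    rw [derivWithin_congr (fun u hu => circPath_extend p c hu) (circPath_extend p c ht')]
    exact (hasDerivAt_circ p (c - p) t).hasDerivWithinAt.derivWithin
      (uniqueDiffOn_Icc_zero_one t ht')
  simp only [h1, circPath_extend p c ht']

lemma norm_sub_of_mem_range_circPath {p c z : ℂ} (hz : z ∈ range (circPath p c)) :
    ‖z - p‖ = ‖c - p‖ := by
  obtain ⟨t, rfl⟩ := hz
  exact norm_circ_sub p (c - p) t

lemma continuousOn_inv_sub {s : ℂ} {A : Set ℂ} (h : s ∉ A) :
    ContinuousOn (fun z => (z - s)⁻¹) A :=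
  (continuousOn_id.sub continuousOn_const).inv₀ fun z hz => sub_ne_zero.2 fun e =>
    h ((show z = s from e) ▸ hz)

/-- The path that goes straight from `x` to `c`, once around the circle with centre `p`
through `c`, and back. -/
noncomputable def lollipop (x p c : ℂ) : Path x x :=
  (Path.segment x c).trans ((circPath p c).trans (Path.segment c x))

lemma isPiecewiseC1_lollipop (x p c : ℂ) : IsPiecewiseC1 (lollipop x p c) :=
  (isPiecewiseC1_segment x c).trans ((isPiecewiseC1_circPath p c).trans (isPiecewiseC1_segment c x))

lemma range_lollipop (x p c : ℂ) :
    range (lollipop x p c) = segment ℝ x c ∪ range (circPath p c) := by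
  rw [lollipop, Path.trans_range, Path.trans_range, Path.range_segment, Path.range_segment,
    segment_symm ℝ c x, Set.union_comm (range _), ← Set.union_assoc, Set.union_self]

/-- The two traversals of the segment cancel, so only the circle contributes. -/
lemma contourIntegral_lollipop {x p c s : ℂ} (h1 : s ∉ segment ℝ x c) (h2 : ‖s - p‖ ≠ ‖c - p‖) :
    contourIntegral (fun z => (z - s)⁻¹) (lollipop x p c) =
      if ‖s - p‖ < ‖c - p‖ then 2 * Real.pi * Complex.I else 0 := by
  have c1 : ContinuousOn (fun z => (z - s)⁻¹) (range (Path.segment x c)) :=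
    continuousOn_inv_sub (by rwa [Path.range_segment])
  have c2 : ContinuousOn (fun z => (z - s)⁻¹) (range (circPath p c)) :=
    continuousOn_inv_sub fun h => h2 (norm_sub_of_mem_range_circPath h)
  have c3 : ContinuousOn (fun z => (z - s)⁻¹) (range (Path.segment c x)) :=
    continuousOn_inv_sub (by rwa [Path.range_segment, segment_symm])
  rw [lollipop, contourIntegral_trans (isPiecewiseC1_segment x c)
    ((isPiecewiseC1_circPath p c).trans (isPiecewiseC1_segment c x)) c1
    (by rw [Path.trans_range]
        exact continuousOn_inv_sub (by
          rw [Path.range_segment, segment_symm]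
          rintro (h | h)
          exacts [h2 (norm_sub_of_mem_range_circPath h), h1 h])),
    contourIntegral_trans (isPiecewiseC1_circPath p c) (isPiecewiseC1_segment c x) c2 c3,
    contourIntegral_circPath, loopInt_circ_inv_sub h2]
  have : contourIntegral (fun z => (z - s)⁻¹) (Path.segment c x) =
      -contourIntegral (fun z => (z - s)⁻¹) (Path.segment x c) := by
    rw [contourIntegral, ← Path.segment_symm, curveIntegral_symm, contourIntegral]
  rw [this]
  ring

/-- Starting from a circle around the origin, closed curves with prescribed winding numbers are
obtained by appending loops. -/
lemma exists_path_of_finset {S : Set ℂ} {x : ℂ} (hx : ∀ s ∈ S, ‖s‖ ≠ ‖x‖) (T : Finset ℂ)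
    (hT : ∀ p ∈ T, p ∈ S ∧ (∀ s ∈ S, s ≠ p → s ∉ segment ℝ x p) ∧
      ∃ δ > 0, ∀ s ∈ S, s ≠ p → δ ≤ ‖s - p‖) :
    ∃ γ : Path x x, IsPiecewiseC1 γ ∧ ∀ s ∈ S, (s ∉ range γ) ∧
      contourIntegral (fun z => (z - s)⁻¹) γ =
        (if ‖s‖ < ‖x‖ then 2 * Real.pi * Complex.I else 0) +
          if s ∈ T then 2 * Real.pi * Complex.I else 0 := by
  classical
  induction T using Finset.induction_on with
  | empty =>
    refine ⟨circPath 0 x, isPiecewiseC1_circPath 0 x, fun s hs => ⟨fun h => hx s hs ?_, ?_⟩⟩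
    · simpa using norm_sub_of_mem_range_circPath h
    · rw [contourIntegral_circPath, loopInt_circ_inv_sub (by simpa using hx s hs)]
      simp
  | insert p T hp ih =>
    obtain ⟨γ, hγ, hγS⟩ := ih fun s hs => hT s (Finset.mem_insert_of_mem hs)
    obtain ⟨hpS, hseg, δ, hδ, hiso⟩ := hT p (Finset.mem_insert_self p T)
    have hxp : x - p ≠ 0 := sub_ne_zero.2 fun h => hx p hpS (by rw [h])
    have hxp' : 0 < ‖x - p‖ := norm_pos_iff.2 hxp
    -- With this ε the circle about p of radius ε |x - p| encloses no other point of S, and its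
    -- starting point c, chosen on the segment from x to p, is reached without meeting S.
    obtain ⟨ε, hε0, hε1, hεδ⟩ : ∃ ε : ℝ, 0 < ε ∧ ε < 1 ∧ ε * ‖x - p‖ < δ := by
      refine ⟨min (1 / 2) (δ / (2 * ‖x - p‖)), by positivity,
        (min_le_left _ _).trans_lt (by norm_num), ?_⟩
      calc _ ≤ δ / (2 * ‖x - p‖) * ‖x - p‖ := by gcongr; exact min_le_right _ _
        _ = δ / 2 := by field_simp
        _ < δ := by linarith
    set c : ℂ := p + ε * (x - p) with hc
    have hcp : ‖c - p‖ = ε * ‖x - p‖ := by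
      rw [hc, add_sub_cancel_left, norm_mul, Complex.norm_real, Real.norm_of_nonneg hε0.le]
    have hcseg : c ∈ segment ℝ x p :=
      ⟨ε, 1 - ε, hε0.le, by linarith, by ring, by
        simp only [Complex.real_smul, hc]; push_cast; ring⟩
    have hsub : segment ℝ x c ⊆ segment ℝ x p :=
      (convex_segment x p).segment_subset (left_mem_segment ℝ x p) hcseg
    have hpc : p ∉ segment ℝ x c := by
      rintro ⟨a, b, ha, hb, hab, h⟩
      simp only [Complex.real_smul, hc] at h
      have h' : ((a + b * ε : ℝ) : ℂ) * (x - p) = 0 := by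
        have : (a : ℂ) + b = 1 := by exact_mod_cast hab
        push_cast
        linear_combination h - p * this
      rcases mul_eq_zero.1 h' with h' | h'
      · rw [Complex.ofReal_eq_zero] at h'
        rcases hb.eq_or_lt with rfl | hb
        · rw [add_zero] at hab; rw [hab] at h'; norm_num at h'
        · have := mul_pos hb hε0; linarith
      · exact hxp h'
    have hdist : ∀ s ∈ S, s ≠ p → ‖c - p‖ < ‖s - p‖ := fun s hs hsp => by
      rw [hcp]; exact hεδ.trans_le (hiso s hs hsp)
    have hnseg : ∀ s ∈ S, s ∉ segment ℝ x c := fun s hs => by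
      rcases eq_or_ne s p with rfl | hsp
      · exact hpc
      · exact fun h => hseg s hs hsp (hsub h)
    have hne : ∀ s ∈ S, ‖s - p‖ ≠ ‖c - p‖ := fun s hs => by
      rcases eq_or_ne s p with rfl | hsp
      · rw [sub_self, norm_zero, hcp]; positivity
      · exact (hdist s hs hsp).ne'
    have hr : ∀ s ∈ S, s ∉ range (lollipop x p c) := fun s hs h => by
      rw [range_lollipop] at h
      rcases h with h | h
      · exact hnseg s hs h
      · exact hne s hs (norm_sub_of_mem_range_circPath h)
    refine ⟨γ.trans (lollipop x p c), hγ.trans (isPiecewiseC1_lollipop x p c), fun s hs => ⟨?_, ?_⟩⟩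
    · rw [Path.trans_range]
      rintro (h | h)
      exacts [(hγS s hs).1 h, hr s hs h]
    · rw [contourIntegral_trans hγ (isPiecewiseC1_lollipop x p c)
        (continuousOn_inv_sub (hγS s hs).1) (continuousOn_inv_sub (hr s hs)), (hγS s hs).2,
        contourIntegral_lollipop (hnseg s hs) (hne s hs), add_assoc]
      congr 1
      rcases eq_or_ne s p with rfl | hsp
      · rw [if_neg hp, if_pos, if_pos (Finset.mem_insert_self _ _), zero_add]
        rw [sub_self, norm_zero, hcp]; positivity
      · rw [if_neg (hdist s hs hsp).not_gt, add_zero]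
        simp [hsp]

lemma affineSpan_pair_ne_top (a b : ℂ) : affineSpan ℝ ({a, b} : Set ℂ) ≠ ⊤ := by
  intro h
  have h1 := (collinear_pair ℝ a b)
  rw [collinear_iff_finrank_le_one, ← direction_affineSpan, h, AffineSubspace.direction_top,
    finrank_top, Complex.finrank_real_complex] at h1
  norm_num at h1

/-- There are arbitrarily small points in general position with respect to a countable set. -/
lemma exists_general_position {S : Set ℂ} (hS : S.Countable) {r : ℝ} (hr : 0 < r) :
    ∃ x : ℂ, ‖x‖ < r ∧ (∀ s ∈ S, ‖s‖ ≠ ‖x‖) ∧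
      ∀ p ∈ S, ∀ s ∈ S, s ≠ p → s ∉ segment ℝ x p := by
  -- The bad points lie on circles about 0 through points of S or on real lines through two of them:
  -- countably many null sets.
  set B : Set ℂ := (⋃ s ∈ S, Metric.sphere 0 ‖s‖) ∪
    ⋃ p ∈ S, ⋃ s ∈ S, (affineSpan ℝ ({s, p} : Set ℂ) : Set ℂ) with hB
  have h0 : volume B = 0 := by
    refine measure_union_null ((measure_biUnion_null_iff hS).2 fun s _ => ?_)
      ((measure_biUnion_null_iff hS).2 fun p _ => (measure_biUnion_null_iff hS).2 fun s _ => ?_)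
    · exact Measure.addHaar_sphere _ _ _
    · exact Measure.addHaar_affineSubspace _ _ (affineSpan_pair_ne_top s p)
  have hpos : 0 < volume (Metric.ball (0 : ℂ) r \ B) := by
    rw [measure_sdiff_null h0]
    exact Metric.measure_ball_pos _ _ hr
  obtain ⟨x, hxr, hxB⟩ := nonempty_of_measure_ne_zero hpos.ne'
  refine ⟨x, by simpa using hxr, fun s hs h => hxB (Or.inl ?_), fun p hp s hs hsp hseg =>
    hxB (Or.inr ?_)⟩
  · exact mem_biUnion hs (by simp [h])
  · refine mem_biUnion hp (mem_biUnion hs ?_)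
    obtain ⟨a, b, ha, hb, hab, h⟩ := hseg
    have ha0 : a ≠ 0 := by
      rintro rfl
      rw [zero_add] at hab
      apply hsp
      rw [← h, hab]; simp
    -- Solves s = a x + b p, a + b = 1, for x: if s is on the segment from x to p, then x is on the
    -- line through s and p.
    have hx : x = AffineMap.lineMap s p (-b / a) := by
      rw [AffineMap.lineMap_apply_module', ← h]
      have e : b = 1 - a := by linarith
      simp only [Complex.real_smul, e]
      have : (a : ℂ) ≠ 0 := by exact_mod_cast ha0
      push_cast
      field_simp
      ring
    rw [hx]
    exact AffineMap.lineMap_mem_affineSpan_pair _ _ _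

/-- Contours exist. -/
theorem exists_separating_path {ι : Type*} [Fintype ι] {q : ℂ} (hq0 : q ≠ 0) (hq : ‖q‖ < 1)
    {c : ι → ℂ} (hc0 : ∀ j, c j ≠ 0) (hc : ∀ i j, ∀ n : ℕ, c i * c j * q ^ n ≠ 1) :
    ∃ (x : ℂ) (γ : Path x x), IsPiecewiseC1 γ ∧
      Separates q c γ.extend (derivWithin γ.extend (Icc 0 1)) := by
  classical
  set A : Set ℂ := range fun i : ι × ℕ => c i.1 * q ^ i.2 with hA
  set A' : Set ℂ := range fun i : ι × ℕ => (c i.1 * q ^ i.2)⁻¹ with hA'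
  set S : Set ℂ := insert 0 (A ∪ A') with hS
  have hScount : S.Countable := ((countable_range _).union (countable_range _)).insert 0
  have hne : ∀ j (k : ℕ), c j * q ^ k ≠ 0 := fun j k => mul_ne_zero (hc0 j) (pow_ne_zero k hq0)
  -- All |c_j q^k| are below M, so all reciprocals have modulus above 1/M. A base point with |x| <
  -- 1/M leaves every reciprocal outside the initial circle through x.
  set M : ℝ := 1 + ∑ j, ‖c j‖ with hM
  have hMpos : 0 < M := by positivity
  have hAM : ∀ j (k : ℕ), ‖c j * q ^ k‖ < M := fun j k => by
    have h1 : ‖c j * q ^ k‖ ≤ ‖c j‖ := by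
      rw [norm_mul, norm_pow]
      exact mul_le_of_le_one_right (norm_nonneg _) (pow_le_one₀ (norm_nonneg q) hq.le)
    have h2 : ‖c j‖ ≤ ∑ j, ‖c j‖ :=
      Finset.single_le_sum (f := fun j => ‖c j‖) (fun _ _ => norm_nonneg _) (Finset.mem_univ j)
    linarith
  obtain ⟨x, hxr, hxn, hxseg⟩ := exists_general_position hScount (inv_pos.2 hMpos)
  have hfin : ∀ a : ℝ, 0 < a → {z ∈ A | a ≤ ‖z‖}.Finite := by
    intro a ha
    choose K hK using fun j => exists_norm_mul_pow_lt hq (c j) ha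
    refine ((Finset.univ.sigma fun j => Finset.range (K j)).image
      fun i : (_ : ι) × ℕ => c i.1 * q ^ i.2).finite_toSet.subset ?_
    rintro _ ⟨⟨⟨j, k⟩, rfl⟩, hk⟩
    rw [Finset.mem_coe, Finset.mem_image]
    refine ⟨⟨j, k⟩, ?_, rfl⟩
    rw [Finset.mem_sigma, Finset.mem_range]
    refine ⟨Finset.mem_univ _, ?_⟩
    by_contra! h
    exact absurd (hK j k h) hk.not_gt
  have hfin' : ∀ b : ℝ, 0 < b → {z ∈ A' | ‖z‖ ≤ b}.Finite := by
    intro b hb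
    refine ((hfin b⁻¹ (inv_pos.2 hb)).image fun z => z⁻¹).subset ?_
    rintro _ ⟨⟨⟨j, k⟩, rfl⟩, hk⟩
    refine ⟨c j * q ^ k, ⟨⟨⟨j, k⟩, rfl⟩, ?_⟩, rfl⟩
    simp only [norm_inv] at hk
    exact inv_le_of_inv_le₀ (norm_pos_iff.2 (hne j k)) hk
  have hx0 : 0 < ‖x‖ := by
    have := hxn 0 (mem_insert 0 _)
    rw [norm_zero] at this
    exact lt_of_le_of_ne (norm_nonneg x) this
  -- The initial circle already encloses all but these finitely many c_j q^k; each of the exceptions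
  -- receives a loop of its own.
  set T := (hfin ‖x‖ hx0).toFinset with hT
  -- The set A accumulates only at 0 and A' only at infinity, so a nonzero point of A is isolated in
  -- S.
  have hiso : ∀ p ∈ A, ∃ δ > 0, ∀ s ∈ S, s ≠ p → δ ≤ ‖s - p‖ := by
    rintro _ ⟨⟨j, k⟩, rfl⟩
    set p := c j * q ^ k
    have hp : 0 < ‖p‖ := norm_pos_iff.2 (hne j k)
    have hF : {s ∈ S | s ≠ p ∧ ‖s - p‖ < ‖p‖ / 2}.Finite := by
      refine ((hfin (‖p‖ / 2) (by positivity)).union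
        (hfin' (2 * ‖p‖) (by positivity))).subset ?_
      rintro s ⟨hs, hsp, hlt⟩
      have h1 := norm_sub_norm_le s p
      have h2 := norm_sub_norm_le p s
      rw [norm_sub_rev] at h2
      rcases hs with rfl | hs | hs
      · rw [zero_sub, norm_neg] at hlt; linarith
      · exact Or.inl ⟨hs, by linarith⟩
      · exact Or.inr ⟨hs, by linarith⟩
    have hnh : {s ∈ S | s ≠ p ∧ ‖s - p‖ < ‖p‖ / 2}ᶜ ∈ 𝓝 p :=
      hF.isClosed.isOpen_compl.mem_nhds fun h => h.2.1 rfl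
    obtain ⟨δ, hδ, hball⟩ := Metric.mem_nhds_iff.1 hnh
    refine ⟨min δ (‖p‖ / 2), by positivity, fun s hs hsp => ?_⟩
    by_contra! h
    refine hball (?_ : s ∈ Metric.ball p δ) ⟨hs, hsp, h.trans_le (min_le_right _ _)⟩
    rw [mem_ball_iff_norm]
    exact h.trans_le (min_le_left _ _)
  have hAS : A ⊆ S := fun z hz => Or.inr (Or.inl hz)
  have hAS' : A' ⊆ S := fun z hz => Or.inr (Or.inr hz)
  obtain ⟨γ, hγ, hγS⟩ := exists_path_of_finset hxn T fun p hp => by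
    have hpA : p ∈ A := ((Set.Finite.mem_toFinset _).1 hp).1
    exact ⟨hAS hpA, fun s hs hsp => hxseg p (hAS hpA) s hs hsp, hiso p hpA⟩
  have havoid : ∀ s ∈ S, ∀ t ∈ Icc (0 : ℝ) 1, γ.extend t ≠ s := fun s hs t _ h =>
    (hγS s hs).1 (by rw [← γ.extend_range]; exact ⟨t, h⟩)
  refine ⟨x, γ, hγ, hγ.isLoop, havoid 0 (mem_insert 0 _), fun j k => ?_, fun j k => ?_,
    fun j k => ?_, fun j k => ?_⟩
  · exact havoid _ (hAS ⟨(j, k), rfl⟩)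
  · have hmem : c j * q ^ k ∈ A := ⟨(j, k), rfl⟩
    rw [← contourIntegral_eq_loopInt, (hγS _ (hAS hmem)).2]
    rcases lt_or_ge ‖c j * q ^ k‖ ‖x‖ with h | h
    · rw [if_pos h, if_neg, add_zero]
      exact fun h' => h.not_ge ((Set.Finite.mem_toFinset _).1 h').2
    · rw [if_neg h.not_gt, if_pos, zero_add]
      exact (Set.Finite.mem_toFinset _).2 ⟨hmem, h⟩
  · exact havoid _ (hAS' ⟨(j, k), rfl⟩)
  · have hmem : (c j * q ^ k)⁻¹ ∈ A' := ⟨(j, k), rfl⟩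
    rw [← contourIntegral_eq_loopInt, (hγS _ (hAS' hmem)).2, if_neg, if_neg, zero_add]
    -- A reciprocal that received a loop would coincide with some c_i q^m, making c_i c_j q^{m+k}
    -- equal to 1.
    · intro h
      obtain ⟨⟨i, m⟩, h1⟩ := ((Set.Finite.mem_toFinset _).1 h).1
      refine hc i j (m + k) ?_
      have h2 := hne j k
      rw [pow_add, show c i * c j * (q ^ m * q ^ k) = (c i * q ^ m) * (c j * q ^ k) by ring]
      simp only at h1
      rw [h1, inv_mul_cancel₀ h2]
    · rw [norm_inv, not_lt]
      exact hxr.le.trans (inv_anti₀ (norm_pos_iff.2 (hne j k)) (hAM j k).le)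

/-! ### Poles of products of reciprocal q-products. -/

/-- The points `a q^k`, `k ≥ 0`. -/
def inSet (q a : ℂ) : Set ℂ := {p | ∃ k : ℕ, p = a * q ^ k}

/-- The points `(a q^k)⁻¹`, `k ≥ 0`. -/
def outSet (q a : ℂ) : Set ℂ := {p | ∃ k : ℕ, p = (a * q ^ k)⁻¹}

lemma pow_injective {q : ℂ} (hq0 : q ≠ 0) (hq : ‖q‖ < 1) :
    Function.Injective fun n : ℕ => q ^ n := by
  intro m n h
  have h' : ‖q‖ ^ m = ‖q‖ ^ n := by simpa using congrArg norm h
  exact (pow_right_strictAnti₀ (norm_pos_iff.2 hq0) hq).injective h'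

/-- For |z| > r only the first K factors of (a/z)_∞ can vanish. They form a polynomial over z^K with
distinct roots, and the remaining product has no zeros. -/
lemma simplePoles_inv_qInf_div {q : ℂ} (hq0 : q ≠ 0) (hq : ‖q‖ < 1) {a : ℂ} (ha : a ≠ 0) :
    SimplePoles (fun z => (qInf q (a / z))⁻¹) (inSet q a) := by
  classical
  intro r R hr
  obtain ⟨K, hK⟩ := exists_norm_mul_pow_lt hq a hr
  have hinj : Set.InjOn (fun i : ℕ => a * q ^ i) (Finset.range K) := fun i _ j _ h =>
    pow_injective hq0 hq (mul_left_cancel₀ ha h)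
  have hne : ∀ z ∈ annulus r R, qInf q (a / z * q ^ K) ≠ 0 := fun z hz => by
    refine qInf_ne_zero_of_norm_lt hq ?_
    rw [div_mul_eq_mul_div, norm_div, div_lt_one (hr.trans hz.1)]
    exact (hK K le_rfl).trans hz.1
  refine ⟨(Finset.range K).image fun i => a * q ^ i,
    fun z => z ^ K * (qInf q (a / z * q ^ K))⁻¹, ?_, ?_, fun z hz hzZ => ?_⟩
  · intro p hp
    obtain ⟨i, _, rfl⟩ := Finset.mem_image.1 hp
    exact ⟨i, rfl⟩
  · intro z hz
    have hz0 := ne_zero_of_mem_annulus hr.le hz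
    refine DifferentiableAt.differentiableWithinAt ?_
    refine (differentiableAt_pow K).mul (DifferentiableAt.inv ?_ (hne z hz))
    exact ((differentiable_qInf hq) _).comp z (by fun_prop (disch := assumption))
  · have hz0 := ne_zero_of_mem_annulus hr.le hz
    beta_reduce
    rw [Finset.prod_image hinj, qInf_eq_prod hq (a / z) K, mul_inv]
    have h1 : ∏ i ∈ Finset.range K, (z - a * q ^ i) =
        z ^ K * ∏ i ∈ Finset.range K, (1 - a / z * q ^ i) := by
      calc _ = ∏ i ∈ Finset.range K, z * (1 - a / z * q ^ i) :=
            Finset.prod_congr rfl fun i _ => by field_simp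
        _ = _ := by rw [Finset.prod_mul_distrib, Finset.prod_const, Finset.card_range]
    have h2 : ∏ i ∈ Finset.range K, (1 - a / z * q ^ i) ≠ 0 :=
      Finset.prod_ne_zero_iff.2 fun i _ h => hzZ ⟨i, by
        rw [sub_eq_zero] at h
        field_simp at h
        exact h⟩
    rw [h1]
    generalize ∏ i ∈ Finset.range K, (1 - a / z * q ^ i) = T at h2 ⊢
    field_simp

lemma simplePoles_inv_qInf_mul {q : ℂ} (hq0 : q ≠ 0) (hq : ‖q‖ < 1) {a : ℂ} (ha : a ≠ 0) :
    SimplePoles (fun z => (qInf q (a * z))⁻¹) (outSet q a) := by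
  classical
  intro r R hr
  -- The bound |R| + 1 exceeds |z| on the annulus and is positive whatever the sign of R.
  obtain ⟨K, hK⟩ := exists_norm_mul_pow_lt hq a (ε := (|R| + 1)⁻¹) (by positivity)
  have haq : ∀ i, a * q ^ i ≠ 0 := fun i => mul_ne_zero ha (pow_ne_zero i hq0)
  have hinj : Set.InjOn (fun i : ℕ => (a * q ^ i)⁻¹) (Finset.range K) := fun i _ j _ h =>
    pow_injective hq0 hq (mul_left_cancel₀ ha (inv_injective h))
  have hne : ∀ z ∈ annulus r R, qInf q (a * z * q ^ K) ≠ 0 := fun z hz => by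
    refine qInf_ne_zero_of_norm_lt hq ?_
    rw [mul_right_comm, norm_mul]
    have h1 : ‖z‖ < |R| + 1 := by linarith [hz.2, le_abs_self R]
    calc _ ≤ (|R| + 1)⁻¹ * ‖z‖ := by gcongr; exact (hK K le_rfl).le
      _ < (|R| + 1)⁻¹ * (|R| + 1) := by gcongr
      _ = 1 := inv_mul_cancel₀ (by positivity)
  refine ⟨(Finset.range K).image fun i => (a * q ^ i)⁻¹,
    fun z => (∏ i ∈ Finset.range K, -(a * q ^ i)⁻¹) * (qInf q (a * z * q ^ K))⁻¹, ?_, ?_,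
    fun z hz hzZ => ?_⟩
  · intro p hp
    obtain ⟨i, _, rfl⟩ := Finset.mem_image.1 hp
    exact ⟨i, rfl⟩
  · intro z hz
    refine DifferentiableAt.differentiableWithinAt ?_
    refine (differentiableAt_const _).mul (DifferentiableAt.inv ?_ (hne z hz))
    exact ((differentiable_qInf hq) _).comp z (by fun_prop)
  · beta_reduce
    rw [Finset.prod_image hinj, qInf_eq_prod hq (a * z) K, mul_inv]
    have h1 : ∏ i ∈ Finset.range K, (z - (a * q ^ i)⁻¹) =
        (∏ i ∈ Finset.range K, -(a * q ^ i)⁻¹) * ∏ i ∈ Finset.range K, (1 - a * z * q ^ i) := by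
      rw [← Finset.prod_mul_distrib]
      refine Finset.prod_congr rfl fun i _ => ?_
      have := pow_ne_zero i hq0
      field_simp
      ring
    have h2 : ∏ i ∈ Finset.range K, (1 - a * z * q ^ i) ≠ 0 :=
      Finset.prod_ne_zero_iff.2 fun i _ h => hzZ ⟨i, by
        rw [sub_eq_zero] at h
        exact eq_inv_of_mul_eq_one_left (by rw [h]; ring)⟩
    rw [h1]
    field_simp

/-- The parameters satisfy `c_i / c_j ∉ q^ℤ` for `i ≠ j` and `c_i c_j ∉ q^ℤ` for all `i`, `j`. -/
structure Admissible {ι : Type*} (q : ℂ) (c : ι → ℂ) : Prop where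
  ne_zero : ∀ j, c j ≠ 0
  div_ne : ∀ i j, i ≠ j → ∀ n : ℤ, c i / c j ≠ q ^ n
  mul_ne : ∀ i j, ∀ n : ℤ, c i * c j ≠ q ^ n

lemma Admissible.zpow_mul {ι : Type*} {q : ℂ} (hq0 : q ≠ 0) {c : ι → ℂ} (h : Admissible q c)
    (m : ι → ℤ) : Admissible q fun j => c j * q ^ m j := by
  refine ⟨fun j => mul_ne_zero (h.ne_zero j) (zpow_ne_zero _ hq0), fun i j hij n e => ?_,
    fun i j n e => ?_⟩
  · refine h.div_ne i j hij (n - m i + m j) ?_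
    have h1 := zpow_ne_zero (m i) hq0
    have h2 := zpow_ne_zero (m j) hq0
    have h3 := h.ne_zero j
    rw [zpow_add₀ hq0, zpow_sub₀ hq0, ← e]
    field_simp
  · refine h.mul_ne i j (n - m i - m j) ?_
    have h1 := zpow_ne_zero (m i) hq0
    have h2 := zpow_ne_zero (m j) hq0
    rw [zpow_sub₀ hq0, zpow_sub₀ hq0, ← e]
    field_simp

lemma Admissible.comp {ι κ : Type*} {q : ℂ} {c : ι → ℂ} (h : Admissible q c) {f : κ → ι}
    (hf : Function.Injective f) : Admissible q fun j => c (f j) :=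
  ⟨fun _ => h.ne_zero _, fun _ _ hij => h.div_ne _ _ (hf.ne hij), fun _ _ => h.mul_ne _ _⟩

lemma Admissible.exists_contour {ι : Type*} [Fintype ι] {q : ℂ} (hq0 : q ≠ 0) (hq : ‖q‖ < 1)
    {c : ι → ℂ} (h : Admissible q c) : ∃ (x : ℂ) (γ : Path x x), IsPiecewiseC1 γ ∧
      Separates q c γ.extend (derivWithin γ.extend (Icc 0 1)) :=
  exists_separating_path hq0 hq h.ne_zero fun i j n e => h.mul_ne i j (-n) (by
    rw [zpow_neg, zpow_natCast]; exact eq_inv_of_mul_eq_one_left e)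

/-- The function `∏_j 1 / ((c_j z)_∞ (d_j / z)_∞)`. -/
noncomputable def kernel {ι : Type*} [Fintype ι] (q : ℂ) (c d : ι → ℂ) (z : ℂ) : ℂ :=
  ∏ j, (qInf q (c j * z) * qInf q (d j / z))⁻¹

/-- Admissibility makes all the zeros of the denominators distinct, so every pole is simple. The
shift m is 0 for the weights and 1 for the auxiliary function `nrPrim`. -/
lemma Admissible.simplePoles_kernel {ι : Type*} [Fintype ι] {q : ℂ} (hq0 : q ≠ 0) (hq : ‖q‖ < 1)
    {c : ι → ℂ} (h : Admissible q c) (m : ι → ℤ) :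
    SimplePoles (kernel q c fun j => c j * q ^ m j)
      ((⋃ j, outSet q (c j)) ∪ ⋃ j, inSet q (c j * q ^ m j)) := by
  have hd := h.zpow_mul hq0 m
  have h1 := SimplePoles.prod Finset.univ (F := fun j z => (qInf q (c j * z))⁻¹)
    (fun j _ => simplePoles_inv_qInf_mul hq0 hq (h.ne_zero j)) fun i _ j _ hij => by
      rw [Set.disjoint_left]
      rintro _ ⟨k, rfl⟩ ⟨l, hl⟩
      refine h.div_ne i j hij (l - k) ?_
      have e1 := pow_ne_zero k hq0
      have e2 := pow_ne_zero l hq0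
      have e3 := h.ne_zero j
      rw [zpow_sub₀ hq0, zpow_natCast, zpow_natCast, div_eq_div_iff e3 e1, inv_injective hl,
        mul_comm]
  have h2 := SimplePoles.prod Finset.univ (F := fun j z => (qInf q (c j * q ^ m j / z))⁻¹)
    (fun j _ => simplePoles_inv_qInf_div hq0 hq (hd.ne_zero j)) fun i _ j _ hij => by
      rw [Set.disjoint_left]
      rintro _ ⟨k, rfl⟩ ⟨l, hl⟩
      refine hd.div_ne i j hij (l - k) ?_
      have e1 := pow_ne_zero k hq0
      have e2 := pow_ne_zero l hq0
      have e3 := hd.ne_zero j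
      rw [zpow_sub₀ hq0, zpow_natCast, zpow_natCast, div_eq_div_iff e3 e1, hl, mul_comm]
  have h3 := h1.mul h2 (by
    simp only [Finset.mem_univ, iUnion_true, Set.disjoint_iUnion_left, Set.disjoint_iUnion_right]
    intro i j
    rw [Set.disjoint_left]
    rintro _ ⟨k, rfl⟩ ⟨l, hl⟩
    refine h.mul_ne j i (-(k + l + m i)) ?_
    have e1 := pow_ne_zero k hq0
    have e2 := pow_ne_zero l hq0
    have e3 := zpow_ne_zero (m i) hq0
    have e4 := h.ne_zero j
    rw [zpow_neg, zpow_add₀ hq0, zpow_add₀ hq0, zpow_natCast, zpow_natCast]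
    refine eq_inv_of_mul_eq_one_left ?_
    have : c j * q ^ k ≠ 0 := mul_ne_zero e4 e1
    field_simp at hl
    linear_combination -hl)
  simp only [Finset.mem_univ, iUnion_true] at h3
  exact h3.congr fun z _ _ => by
    rw [kernel, ← Finset.prod_mul_distrib]
    exact Finset.prod_congr rfl fun j _ => mul_inv _ _

/-! ### The constant term of `θ` -/

section ConstantTerm

variable {q : ℂ}

/-- The polynomial `∏_{k < n} (1 - q^k X)(X - q^(k+1))`. -/
noncomputable def thetaPoly (q : ℂ) (n : ℕ) : Polynomial ℂ :=
  ∏ k ∈ Finset.range n, ((1 - Polynomial.C (q ^ k) * Polynomial.X) *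
    (Polynomial.X - Polynomial.C (q ^ (k + 1))))

lemma eval_thetaPoly (n : ℕ) (x : ℂ) : (thetaPoly q n).eval x =
    (∏ k ∈ Finset.range n, (1 - q ^ k * x)) * ∏ k ∈ Finset.range n, (x - q ^ (k + 1)) := by
  simp [thetaPoly, Polynomial.eval_prod, Finset.prod_mul_distrib]

/-- The finite counterpart of θ(qx) = -x⁻¹ θ(x), with correcting end factors. Comparing coefficients
gives a two-term recursion. -/
lemma thetaPoly_scale (n : ℕ) :
    (thetaPoly q n).comp (Polynomial.C q * Polynomial.X) *
      (Polynomial.X - Polynomial.C (q ^ n)) =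
    Polynomial.C (-q ^ n) * thetaPoly q n * (1 - Polynomial.C (q ^ n) * Polynomial.X) := by
  refine Polynomial.funext fun x => ?_
  simp only [Polynomial.eval_mul, Polynomial.eval_comp, Polynomial.eval_sub, Polynomial.eval_X,
    Polynomial.eval_C, Polynomial.eval_one, eval_thetaPoly]
  have h1 : (∏ k ∈ Finset.range n, (1 - q ^ k * (q * x))) * (1 - x) =
      (∏ k ∈ Finset.range n, (1 - q ^ k * x)) * (1 - q ^ n * x) := by
    rw [← Finset.prod_range_succ (fun k => 1 - q ^ k * x), Finset.prod_range_succ']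
    simp [pow_succ, mul_assoc]
  have h2 : (∏ k ∈ Finset.range n, (q * x - q ^ (k + 1))) * (x - q ^ n) =
      q ^ n * (∏ k ∈ Finset.range n, (x - q ^ (k + 1))) * (x - 1) := by
    have e : ∏ k ∈ Finset.range n, (q * x - q ^ (k + 1)) =
        q ^ n * ∏ k ∈ Finset.range n, (x - q ^ k) := by
      calc _ = ∏ k ∈ Finset.range n, q * (x - q ^ k) :=
            Finset.prod_congr rfl fun k _ => by ring
        _ = _ := by rw [Finset.prod_mul_distrib, Finset.prod_const, Finset.card_range]
    rw [e, mul_assoc, ← Finset.prod_range_succ (fun k => x - q ^ k), Finset.prod_range_succ']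
    ring
  linear_combination (∏ k ∈ Finset.range n, (1 - q ^ k * (q * x))) * h2 -
    q ^ n * (∏ k ∈ Finset.range n, (x - q ^ (k + 1))) * h1

lemma coeff_thetaPoly_succ (hq0 : q ≠ 0) (n m : ℕ) :
    (thetaPoly q n).coeff (n + (m + 1)) * (1 - q ^ (n + m + 1)) =
      (thetaPoly q n).coeff (n + m) * (q ^ n - q ^ m) := by
  have h := congrArg (fun p => Polynomial.coeff p (n + m + 1)) (thetaPoly_scale (q := q) n)
  simp only [Polynomial.coeff_mul_X_sub_C, Polynomial.comp_C_mul_X_coeff] at h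
  rw [show Polynomial.C (-q ^ n) * thetaPoly q n * (1 - Polynomial.C (q ^ n) * Polynomial.X) =
    Polynomial.C (-q ^ n) * (thetaPoly q n - Polynomial.C (q ^ n) * (thetaPoly q n * Polynomial.X))
    by ring, Polynomial.coeff_C_mul, Polynomial.coeff_sub, Polynomial.coeff_C_mul,
    Polynomial.coeff_mul_X] at h
  have hn := pow_ne_zero n hq0
  rw [show n + (m + 1) = n + m + 1 by ring]
  refine mul_left_cancel₀ hn ?_
  rw [pow_succ, pow_add] at h
  rw [pow_succ, pow_add]
  linear_combination h

lemma coeff_thetaPoly_top (n : ℕ) :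
    (thetaPoly q n).coeff (n + n) = ∏ k ∈ Finset.range n, -q ^ k := by
  have h := Polynomial.coeff_prod_of_natDegree_le (Finset.range n)
    (fun k => (1 - Polynomial.C (q ^ k) * Polynomial.X) *
      (Polynomial.X - Polynomial.C (q ^ (k + 1)))) 2 fun k _ => by compute_degree
  rw [Finset.card_range, mul_two] at h
  rw [thetaPoly, h]
  refine Finset.prod_congr rfl fun k _ => ?_
  generalize q ^ k = a, q ^ (k + 1) = b
  rw [show (1 - Polynomial.C a * Polynomial.X) * (Polynomial.X - Polynomial.C b) =
    Polynomial.C (-a) * Polynomial.X ^ 2 + Polynomial.C (1 + a * b) * Polynomial.X +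
      Polynomial.C (-b) by
    simp only [Polynomial.C_add, Polynomial.C_mul, Polynomial.C_neg, Polynomial.C_1]; ring]
  simp only [Polynomial.coeff_add, Polynomial.coeff_C_mul, Polynomial.coeff_X_pow,
    Polynomial.coeff_X, Polynomial.coeff_C]
  norm_num

lemma natDegree_thetaPoly_le (n : ℕ) : (thetaPoly q n).natDegree ≤ 2 * n := by
  refine (Polynomial.natDegree_prod_le _ _).trans ?_
  refine (Finset.sum_le_card_nsmul _ _ 2 fun k _ => ?_).trans (by simp [mul_comm])
  compute_degree

lemma one_sub_pow_ne_zero (hq : ‖q‖ < 1) {n : ℕ} (hn : n ≠ 0) : 1 - q ^ n ≠ 0 := by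
  intro h
  rw [sub_eq_zero] at h
  have := pow_lt_one₀ (norm_nonneg q) hq hn
  rw [← norm_pow, ← h, norm_one] at this
  exact lt_irrefl _ this

/-- The recursion leads from the middle coefficient to the leading one, which is explicit. The value
is (q)_{2n} / (q)_n². -/
lemma coeff_thetaPoly_mid (hq0 : q ≠ 0) (hq : ‖q‖ < 1) (n : ℕ) :
    (thetaPoly q n).coeff n = (∏ i ∈ Finset.range (n + n), (1 - q * q ^ i)) /
      (∏ i ∈ Finset.range n, (1 - q * q ^ i)) ^ 2 := by
  have key : ∀ i ≤ n, (thetaPoly q n).coeff (n + i) * ∏ m ∈ Finset.range i, (1 - q ^ (n + m + 1)) =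
      (thetaPoly q n).coeff n * ∏ m ∈ Finset.range i, (q ^ n - q ^ m) := by
    intro i hi
    induction i with
    | zero => simp
    | succ i ih =>
      rw [Finset.prod_range_succ, Finset.prod_range_succ]
      have h1 := ih (by omega)
      have h2 := coeff_thetaPoly_succ hq0 n i
      linear_combination (∏ m ∈ Finset.range i, (1 - q ^ (n + m + 1))) * h2 +
        (q ^ n - q ^ i) * h1
  have h := key n le_rfl
  rw [coeff_thetaPoly_top] at h
  have hp : ∏ m ∈ Finset.range n, (q ^ n - q ^ m) =
      (∏ m ∈ Finset.range n, -q ^ m) * ∏ i ∈ Finset.range n, (1 - q * q ^ i) := by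
    rw [← Finset.prod_range_reflect (fun i => 1 - q * q ^ i), ← Finset.prod_mul_distrib]
    refine Finset.prod_congr rfl fun m hm => ?_
    have hm' : m < n := Finset.mem_range.1 hm
    rw [← pow_succ', show n - 1 - m + 1 = n - m by omega]
    have : q ^ n = q ^ m * q ^ (n - m) := by rw [← pow_add]; congr 1; omega
    rw [this]; ring
  have h0 : ∏ m ∈ Finset.range n, -q ^ m ≠ 0 :=
    Finset.prod_ne_zero_iff.2 fun m _ => neg_ne_zero.2 (pow_ne_zero m hq0)
  have h1 : ∏ i ∈ Finset.range n, (1 - q * q ^ i) ≠ 0 :=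
    Finset.prod_ne_zero_iff.2 fun m _ => by
      rw [← pow_succ']; exact one_sub_pow_ne_zero hq (Nat.succ_ne_zero m)
  rw [hp, mul_left_comm] at h
  have h2 := mul_left_cancel₀ h0 h
  have h3 : ∏ i ∈ Finset.range (n + n), (1 - q * q ^ i) =
      (∏ i ∈ Finset.range n, (1 - q * q ^ i)) * ∏ m ∈ Finset.range n, (1 - q ^ (n + m + 1)) := by
    rw [Finset.prod_range_add]
    congr 1
    exact Finset.prod_congr rfl fun m _ => by rw [← pow_succ']
  rw [h3, h2]
  field_simp

lemma tendsto_prod_one_sub (hq : ‖q‖ < 1) :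
    Filter.Tendsto (fun n => ∏ i ∈ Finset.range n, (1 - q * q ^ i)) Filter.atTop
      (𝓝 (qInf q q)) :=
  (multipliable_qInf hq q).hasProd.tendsto_prod_nat

/-- The middle coefficient tends to 1/(q)_∞, and the ratio of its successor to it tends to -1. -/
lemma tendsto_coeff_thetaPoly (hq0 : q ≠ 0) (hq : ‖q‖ < 1) :
    Filter.Tendsto (fun n => (thetaPoly q n).coeff n - (thetaPoly q n).coeff (n + 1)) Filter.atTop
      (𝓝 (2 / qInf q q)) := by
  have h0 := qInf_self_ne_zero hq
  have h1 := tendsto_prod_one_sub hq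
  have h2 : Filter.Tendsto (fun n : ℕ => n + n) Filter.atTop Filter.atTop :=
    Filter.tendsto_atTop_mono (fun n => Nat.le_add_left n n) Filter.tendsto_id
  have h3 : Filter.Tendsto (fun n => (thetaPoly q n).coeff n) Filter.atTop
      (𝓝 (qInf q q / qInf q q ^ 2)) := by
    simp only [coeff_thetaPoly_mid hq0 hq]
    exact (h1.comp h2).div (h1.pow 2) (pow_ne_zero 2 h0)
  have hq' := tendsto_pow_atTop_nhds_zero_of_norm_lt_one hq
  have h4 : Filter.Tendsto (fun n : ℕ => (q ^ n - 1) / (1 - q ^ (n + 1))) Filter.atTop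
      (𝓝 ((0 - 1) / (1 - 0))) :=
    (hq'.sub_const 1).div (((Filter.tendsto_add_atTop_iff_nat 1).2 hq').const_sub 1) (by norm_num)
  have h5 := h3.sub (h3.mul h4)
  rw [show 2 / qInf q q = qInf q q / qInf q q ^ 2 -
    qInf q q / qInf q q ^ 2 * ((0 - 1) / (1 - 0)) by field_simp; ring]
  refine h5.congr fun n => ?_
  have h6 := coeff_thetaPoly_succ hq0 n 0
  have h7 := one_sub_pow_ne_zero hq (Nat.succ_ne_zero n)
  simp only [add_zero, zero_add, pow_zero] at h6
  rw [Nat.succ_eq_add_one] at h7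
  rw [← mul_div_assoc, ← h6, mul_div_cancel_right₀ _ h7]

lemma circleIntegral_zpow (m : ℤ) :
    (∮ z in C((0 : ℂ), 1), z ^ m) = if m = -1 then 2 * Real.pi * Complex.I else 0 := by
  split_ifs with h
  · have := circleIntegral.integral_sub_inv_of_mem_ball (c := 0) (w := 0) (R := 1) (by simp)
    simpa [h] using this
  · simpa using circleIntegral.integral_sub_zpow_of_ne h 0 0 1

/-- The factor 1 - z⁻² picks out two adjacent coefficients, since z⁻¹ is the only power with a
nonzero integral. -/
lemma circleIntegral_thetaPoly (n : ℕ) :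
    (∮ z in C((0 : ℂ), 1), (1 - (z ^ 2)⁻¹) * ((thetaPoly q n).eval (z ^ 2) * (z ^ (2 * n))⁻¹) * z⁻¹)
      = 2 * Real.pi * Complex.I * ((thetaPoly q n).coeff n - (thetaPoly q n).coeff (n + 1)) := by
  have hne : ∀ z ∈ Metric.sphere (0 : ℂ) 1, z ≠ 0 := fun z hz => by
    rintro rfl; simp at hz
  have h1 : ∀ z ∈ Metric.sphere (0 : ℂ) 1,
      (1 - (z ^ 2)⁻¹) * ((thetaPoly q n).eval (z ^ 2) * (z ^ (2 * n))⁻¹) * z⁻¹ =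
      ∑ j ∈ Finset.range (2 * n + 2), (thetaPoly q n).coeff j *
        (z ^ (2 * (j : ℤ) - 2 * n - 1) - z ^ (2 * (j : ℤ) - 2 * n - 3)) := by
    intro z hz
    have hz0 := hne z hz
    rw [Polynomial.eval_eq_sum_range' (n := 2 * n + 2)
      (by have := natDegree_thetaPoly_le (q := q) n; omega), Finset.sum_mul, Finset.mul_sum,
      Finset.sum_mul]
    refine Finset.sum_congr rfl fun j _ => ?_
    have e : ∀ k : ℤ, z ^ (2 * (j : ℤ) - 2 * n - k) = z ^ (2 * j) * (z ^ (2 * n))⁻¹ * (z ^ k)⁻¹ := by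
      intro k
      rw [zpow_sub₀ hz0, zpow_sub₀ hz0, ← zpow_natCast z (2 * j), ← zpow_natCast z (2 * n)]
      push_cast
      ring
    rw [e, e, ← pow_mul]
    have e1 : z ^ (1 : ℤ) = z := zpow_one z
    have e3 : z ^ (3 : ℤ) = z ^ 3 := by norm_cast
    rw [e1, e3]
    field_simp
  have hci : ∀ m : ℤ, CircleIntegrable (fun z : ℂ => z ^ m) 0 1 := fun m =>
    ContinuousOn.circleIntegrable zero_le_one fun z hz =>
      (continuousAt_zpow₀ z m (Or.inl (hne z hz))).continuousWithinAt
  rw [circleIntegral.integral_congr zero_le_one h1, circleIntegral.integral_fun_sum]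
  · have h2 : ∀ j : ℕ, (∮ z in C((0 : ℂ), 1), (thetaPoly q n).coeff j *
        (z ^ (2 * (j : ℤ) - 2 * n - 1) - z ^ (2 * (j : ℤ) - 2 * n - 3))) =
        (if j = n then 2 * Real.pi * Complex.I * (thetaPoly q n).coeff n else 0) -
          if j = n + 1 then 2 * Real.pi * Complex.I * (thetaPoly q n).coeff (n + 1) else 0 := by
      intro j
      rw [circleIntegral.integral_const_mul, circleIntegral.integral_sub (hci _) (hci _),
        circleIntegral_zpow, circleIntegral_zpow]
      have c1 : (2 * (j : ℤ) - 2 * n - 1 = -1) ↔ j = n := by omega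
      have c2 : (2 * (j : ℤ) - 2 * n - 3 = -1) ↔ j = n + 1 := by omega
      simp only [c1, c2]
      rcases eq_or_ne j n with rfl | h3
      · simp; ring
      · rcases eq_or_ne j (n + 1) with rfl | h4
        · simp; ring
        · simp [h3, h4]
    simp only [h2, Finset.sum_sub_distrib, Finset.sum_ite_eq', Finset.mem_range]
    rw [if_pos (by omega), if_pos (by omega)]
    ring
  · intro j _
    exact ((hci _).sub (hci _)).const_fun_smul

lemma theta_eq_thetaPoly (hq : ‖q‖ < 1) (n : ℕ) {x : ℂ} (hx : x ≠ 0) :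
    theta q x = (thetaPoly q n).eval x * (x ^ n)⁻¹ *
      (qInf q (x * q ^ n) * qInf q (q / x * q ^ n)) := by
  rw [theta, qInf_eq_prod hq x n, qInf_eq_prod hq (q / x) n, eval_thetaPoly]
  have h1 : ∏ k ∈ Finset.range n, (x - q ^ (k + 1)) =
      x ^ n * ∏ i ∈ Finset.range n, (1 - q / x * q ^ i) := by
    calc _ = ∏ i ∈ Finset.range n, x * (1 - q / x * q ^ i) :=
          Finset.prod_congr rfl fun i _ => by field_simp; ring
      _ = _ := by rw [Finset.prod_mul_distrib, Finset.prod_const, Finset.card_range]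
  have h2 : ∏ i ∈ Finset.range n, (1 - x * q ^ i) = ∏ i ∈ Finset.range n, (1 - q ^ i * x) :=
    Finset.prod_congr rfl fun i _ => by ring
  rw [h1, ← h2]
  have := pow_ne_zero n hx
  generalize ∏ i ∈ Finset.range n, (1 - x * q ^ i) = S
  generalize ∏ i ∈ Finset.range n, (1 - q / x * q ^ i) = T
  field_simp

end ConstantTerm

/-! ### The Nassrallah–Rahman integral: limiting case and algebraic identities. -/

section NassrallahRahman

variable {q : ℂ}

lemma circleMap_zero_one_mem_sphere (θ : ℝ) : circleMap 0 1 θ ∈ Metric.sphere (0 : ℂ) 1 :=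
  circleMap_mem_sphere 0 zero_le_one θ

lemma tendsto_circleIntegral {f : ℂ → ℂ → ℂ} {ρ : ℝ} (hρ : 0 ≤ ρ)
    (hf : ContinuousOn (Function.uncurry f) (Metric.closedBall 0 ρ ×ˢ Metric.sphere 0 1))
    {s : ℕ → ℂ} (hs : Filter.Tendsto s Filter.atTop (𝓝 0)) (hsρ : ∀ n, ‖s n‖ ≤ ρ) :
    Filter.Tendsto (fun n => ∮ z in C((0 : ℂ), 1), f (s n) z) Filter.atTop
      (𝓝 (∮ z in C((0 : ℂ), 1), f 0 z)) := by
  have hcont : Continuous fun x : Metric.closedBall (0 : ℂ) ρ =>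
      ∮ z in C((0 : ℂ), 1), f (x : ℂ) z := by
    unfold circleIntegral
    refine intervalIntegral.continuous_parametric_intervalIntegral_of_continuous'
      (f := fun (x : Metric.closedBall (0 : ℂ) ρ) θ =>
        deriv (circleMap 0 1) θ • f (x : ℂ) (circleMap 0 1 θ)) ?_ _ _
    have h1 : Continuous fun p : Metric.closedBall (0 : ℂ) ρ × ℝ => ((p.1 : ℂ), circleMap 0 1 p.2) :=
      (continuous_subtype_val.comp continuous_fst).prodMk
        ((continuous_circleMap 0 1).comp continuous_snd)
    have h2 : Continuous fun p : Metric.closedBall (0 : ℂ) ρ × ℝ =>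
        f (p.1 : ℂ) (circleMap 0 1 p.2) :=
      hf.comp_continuous h1 fun p => ⟨p.1.2, circleMap_zero_one_mem_sphere p.2⟩
    have h3 : Continuous fun p : Metric.closedBall (0 : ℂ) ρ × ℝ => deriv (circleMap 0 1) p.2 := by
      simp only [deriv_circleMap]; fun_prop
    exact h3.smul h2
  let t : ℕ → Metric.closedBall (0 : ℂ) ρ := fun n => ⟨s n, by simpa using hsρ n⟩
  have ht : Filter.Tendsto t Filter.atTop (𝓝 ⟨0, by simpa using hρ⟩) :=
    tendsto_subtype_rng.2 hs
  exact (hcont.tendsto _).comp ht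

lemma continuousOn_theta_sq (hq : ‖q‖ < 1) {S : Set ℂ} :
    ContinuousOn (fun p : ℂ × ℂ => theta q (p.2 ^ 2)) (S ×ˢ Metric.sphere 0 1) := by
  intro p hp
  have h0 : p.2 ≠ 0 := fun h => by
    have := hp.2; rw [h] at this; simp at this
  have h1 : ContinuousAt (fun p : ℂ × ℂ => p.2 ^ 2) p := by fun_prop
  exact (ContinuousAt.comp (f := fun p : ℂ × ℂ => p.2 ^ 2)
    (differentiableAt_theta hq (pow_ne_zero 2 h0)).continuousAt h1).continuousWithinAt

lemma circleIntegral_theta_sq (hq0 : q ≠ 0) (hq : ‖q‖ < 1) :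
    (∮ z in C((0 : ℂ), 1), (1 - (z ^ 2)⁻¹) * theta q (z ^ 2) * z⁻¹) =
      2 * Real.pi * Complex.I * (2 / qInf q q) := by
  -- At s = q^{n+1} the denominator removes the tail of θ(z²) and leaves a Laurent polynomial; at s
  -- = 0 it is 1. The exponent n + 1 instead of n keeps |s| ≤ |q|, where the denominator has no zero
  -- on the unit circle.
  set f : ℂ → ℂ → ℂ := fun s z => (1 - (z ^ 2)⁻¹) *
    (theta q (z ^ 2) / (qInf q (z ^ 2 * s) * qInf q (q / z ^ 2 * s))) * z⁻¹ with hf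
  have hz : ∀ p ∈ Metric.closedBall (0 : ℂ) ‖q‖ ×ˢ Metric.sphere (0 : ℂ) 1, p.2 ≠ 0 := by
    rintro p hp h
    have := hp.2; rw [h] at this; simp at this
  have hA : ∀ p ∈ Metric.closedBall (0 : ℂ) ‖q‖ ×ˢ Metric.sphere (0 : ℂ) 1,
      qInf q (p.2 ^ 2 * p.1) * qInf q (q / p.2 ^ 2 * p.1) ≠ 0 := by
    rintro p ⟨h1, h2⟩
    rw [mem_closedBall_zero_iff] at h1
    rw [mem_sphere_zero_iff_norm] at h2
    refine mul_ne_zero (qInf_ne_zero_of_norm_lt hq ?_) (qInf_ne_zero_of_norm_lt hq ?_)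
    · rw [norm_mul, norm_pow, h2, one_pow, one_mul]; linarith
    · rw [norm_mul, norm_div, norm_pow, h2, one_pow, div_one]
      calc ‖q‖ * ‖p.1‖ ≤ ‖q‖ * 1 := by gcongr; linarith
        _ < 1 := by linarith
  have hcont : ContinuousOn (Function.uncurry f)
      (Metric.closedBall 0 ‖q‖ ×ˢ Metric.sphere 0 1) := by
    have c1 : ContinuousOn (fun p : ℂ × ℂ => (p.2 ^ 2)⁻¹)
        (Metric.closedBall 0 ‖q‖ ×ˢ Metric.sphere 0 1) :=
      ContinuousOn.inv₀ (by fun_prop) fun p hp => pow_ne_zero 2 (hz p hp)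
    have c2 : ContinuousOn (fun p : ℂ × ℂ => qInf q (p.2 ^ 2 * p.1))
        (Metric.closedBall 0 ‖q‖ ×ˢ Metric.sphere 0 1) :=
      (continuous_qInf hq).comp_continuousOn (by fun_prop)
    have c3 : ContinuousOn (fun p : ℂ × ℂ => qInf q (q / p.2 ^ 2 * p.1))
        (Metric.closedBall 0 ‖q‖ ×ˢ Metric.sphere 0 1) := by
      refine (continuous_qInf hq).comp_continuousOn ?_
      simp only [div_eq_mul_inv]
      exact (continuousOn_const.mul c1).mul continuousOn_fst
    exact ((continuousOn_const.sub c1).mul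
      ((continuousOn_theta_sq hq).div (c2.mul c3) hA)).mul (continuousOn_snd.inv₀ hz)
  have hlim := tendsto_circleIntegral (norm_nonneg q) hcont
    (s := fun n => q ^ (n + 1))
    ((Filter.tendsto_add_atTop_iff_nat 1).2 (tendsto_pow_atTop_nhds_zero_of_norm_lt_one hq))
    (fun n => by
      rw [norm_pow]
      exact pow_le_of_le_one (norm_nonneg q) hq.le (Nat.succ_ne_zero n))
  have hlim2 : Filter.Tendsto (fun n => ∮ z in C((0 : ℂ), 1), f (q ^ (n + 1)) z) Filter.atTop
      (𝓝 (2 * Real.pi * Complex.I * (2 / qInf q q))) := by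
    refine (((Filter.tendsto_add_atTop_iff_nat 1).2
      (tendsto_coeff_thetaPoly hq0 hq)).const_mul _).congr fun n => ?_
    rw [← circleIntegral_thetaPoly]
    refine circleIntegral.integral_congr zero_le_one fun z hz' => ?_
    have h0 := hz (q ^ (n + 1), z) ⟨by
      rw [mem_closedBall_zero_iff, norm_pow]
      exact pow_le_of_le_one (norm_nonneg q) hq.le (Nat.succ_ne_zero n), hz'⟩
    have h1 := hA (q ^ (n + 1), z) ⟨by
      rw [mem_closedBall_zero_iff, norm_pow]
      exact pow_le_of_le_one (norm_nonneg q) hq.le (Nat.succ_ne_zero n), hz'⟩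
    simp only [hf]
    rw [theta_eq_thetaPoly hq (n + 1) (pow_ne_zero 2 h0), mul_div_assoc, div_self h1, mul_one,
      pow_mul]
  have := tendsto_nhds_unique hlim hlim2
  rw [← this]
  refine circleIntegral.integral_congr zero_le_one fun z _ => ?_
  simp [hf]

/-- The integrand of the Nassrallah–Rahman integral, with the factor `1/z` of `dz/z`. -/
noncomputable def nrWeight (q : ℂ) (c : Fin 5 → ℂ) (z : ℂ) : ℂ :=
  (1 - (z ^ 2)⁻¹) * theta q (z ^ 2) * (qInf q ((∏ j, c j) * z) * qInf q ((∏ j, c j) / z)) *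
    kernel q c c z * z⁻¹

/-- The product of `(c_i c_j)_∞` over `i < j`. -/
noncomputable def pairs (q : ℂ) (c : Fin 5 → ℂ) : ℂ := ∏ i, ∏ j ∈ Finset.Ioi i, qInf q (c i * c j)

/-- Multiplication of the parameter `c_i` by `q`. -/
noncomputable def shift (q : ℂ) (c : Fin 5 → ℂ) (i : Fin 5) : Fin 5 → ℂ :=
  Function.update c i (q * c i)

lemma prod_shift (c : Fin 5 → ℂ) (i : Fin 5) : ∏ j, shift q c i j = q * ∏ j, c j := by
  rw [← Finset.mul_prod_erase _ _ (Finset.mem_univ i),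
    ← Finset.mul_prod_erase _ c (Finset.mem_univ i), shift, Function.update_self, mul_assoc]
  congr 2
  exact Finset.prod_congr rfl fun j hj => by rw [Function.update_of_ne (Finset.ne_of_mem_erase hj)]

/-- Only the four pairs containing c_i change. The facts `h` and `h'` in the proof treat c_i as
first and as second member of a pair. -/
lemma pairs_eq_shift (hq : ‖q‖ < 1) (c : Fin 5 → ℂ) (i : Fin 5) :
    pairs q c = (∏ j ∈ Finset.univ.erase i, (1 - c i * c j)) * pairs q (shift q c i) := by
  have h : ∀ j, qInf q (c i * c j) = (1 - c i * c j) * qInf q (q * c i * c j) := fun j => by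
    rw [qInf_eq hq]; congr 2; ring
  have h' : ∀ j, qInf q (c j * c i) = (1 - c i * c j) * qInf q (c j * (q * c i)) := fun j => by
    rw [qInf_eq hq]; congr 2 <;> ring
  have e0 : Finset.Ioi (0 : Fin 5) = {1, 2, 3, 4} := rfl
  have e1 : Finset.Ioi (1 : Fin 5) = {2, 3, 4} := rfl
  have e2 : Finset.Ioi (2 : Fin 5) = {3, 4} := rfl
  have e3 : Finset.Ioi (3 : Fin 5) = {4} := rfl
  have e4 : Finset.Ioi (4 : Fin 5) = ∅ := rfl
  have u : (Finset.univ : Finset (Fin 5)) = {0, 1, 2, 3, 4} := rfl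
  fin_cases i
  · rw [show (Finset.univ : Finset (Fin 5)).erase _ = {1, 2, 3, 4} from rfl]
    simp [pairs, shift, Fin.prod_univ_five, e0, e1, e2, e3, e4] at h h' ⊢
    simp only [h]
    ring
  · rw [show (Finset.univ : Finset (Fin 5)).erase _ = {0, 2, 3, 4} from rfl]
    simp [pairs, shift, Fin.prod_univ_five, e0, e1, e2, e3, e4] at h h' ⊢
    simp only [h, h' 0]
    ring
  · rw [show (Finset.univ : Finset (Fin 5)).erase _ = {0, 1, 3, 4} from rfl]
    simp [pairs, shift, Fin.prod_univ_five, e0, e1, e2, e3, e4] at h h' ⊢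
    simp only [h, h' 0, h' 1]
    ring
  · rw [show (Finset.univ : Finset (Fin 5)).erase _ = {0, 1, 2, 4} from rfl]
    simp [pairs, shift, Fin.prod_univ_five, e0, e1, e2, e3, e4] at h h' ⊢
    simp only [h, h' 0, h' 1, h' 2]
    ring
  · rw [show (Finset.univ : Finset (Fin 5)).erase _ = {0, 1, 2, 3} from rfl]
    simp [pairs, shift, Fin.prod_univ_five, e0, e1, e2, e3, e4] at h h' ⊢
    simp only [h']
    ring

lemma prod_qInf_div_eq_shift (hq0 : q ≠ 0) (hq : ‖q‖ < 1) (c : Fin 5 → ℂ) (i : Fin 5) :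
    ∏ j, qInf q ((∏ j, c j) / c j) = (∏ j ∈ Finset.univ.erase i, (1 - (∏ j, c j) / c j)) *
      ∏ j, qInf q ((∏ j, shift q c i j) / shift q c i j) := by
  rw [prod_shift]
  set A := ∏ j, c j
  rw [← Finset.mul_prod_erase _ _ (Finset.mem_univ i),
    ← Finset.mul_prod_erase _ (fun j => qInf q (q * A / shift q c i j)) (Finset.mem_univ i),
    mul_left_comm, ← Finset.prod_mul_distrib]
  congr 1
  · rw [shift, Function.update_self, mul_div_mul_left _ _ hq0]
  · refine Finset.prod_congr rfl fun j hj => ?_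
    rw [shift, Function.update_of_ne (Finset.ne_of_mem_erase hj), qInf_eq hq (A / c j)]
    congr 2
    ring

/-- The elementary symmetric functions of four of the five parameters. -/
lemma exists_prod_erase (c : Fin 5 → ℂ) (i : Fin 5) : ∃ e₁ e₂ e₃ : ℂ, ∀ x y : ℂ,
    ∏ j ∈ Finset.univ.erase i, (x - c j * y) = x ^ 4 - e₁ * x ^ 3 * y + e₂ * x ^ 2 * y ^ 2 -
      e₃ * x * y ^ 3 + (∏ j ∈ Finset.univ.erase i, c j) * y ^ 4 := by
  have key : ∀ a b d e : Fin 5, a ≠ b → a ≠ d → a ≠ e → b ≠ d → b ≠ e → d ≠ e →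
      Finset.univ.erase i = {a, b, d, e} → ∃ e₁ e₂ e₃ : ℂ, ∀ x y : ℂ,
      ∏ j ∈ Finset.univ.erase i, (x - c j * y) = x ^ 4 - e₁ * x ^ 3 * y + e₂ * x ^ 2 * y ^ 2 -
        e₃ * x * y ^ 3 + (∏ j ∈ Finset.univ.erase i, c j) * y ^ 4 := by
    intro a b d e h1 h2 h3 h4 h5 h6 h
    refine ⟨c a + c b + c d + c e,
      c a * c b + c a * c d + c a * c e + c b * c d + c b * c e + c d * c e,
      c a * c b * c d + c a * c b * c e + c a * c d * c e + c b * c d * c e, fun x y => ?_⟩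
    rw [h]
    simp [h1, h2, h3, h4, h5, h6]
    ring
  fin_cases i
  · exact key 1 2 3 4 (by decide) (by decide) (by decide) (by decide) (by decide) (by decide) rfl
  · exact key 0 2 3 4 (by decide) (by decide) (by decide) (by decide) (by decide) (by decide) rfl
  · exact key 0 1 3 4 (by decide) (by decide) (by decide) (by decide) (by decide) (by decide) rfl
  · exact key 0 1 2 4 (by decide) (by decide) (by decide) (by decide) (by decide) (by decide) rfl
  · exact key 0 1 2 3 (by decide) (by decide) (by decide) (by decide) (by decide) (by decide) rfl

/-- The rational function identity behind the `q`-difference equation. -/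
lemma contiguous_identity {c : Fin 5 → ℂ} (hc : ∀ j, c j ≠ 0) (i : Fin 5) {z : ℂ} (hz : z ≠ 0) :
    (1 - (∏ j, c j) * c i) * ((z ^ 2)⁻¹ * (1 - (∏ j, c j) / z) * ∏ j, (1 - c j * z) -
      z ^ 2 * (1 - (∏ j, c j) * z) * ∏ j, (1 - c j / z)) =
    (z - z⁻¹) * ((c i)⁻¹ * (∏ j ∈ Finset.univ.erase i, (1 - (∏ j, c j) / c j)) *
        ((1 - c i * z) * (1 - c i / z)) -
      (c i)⁻¹ * (∏ j ∈ Finset.univ.erase i, (1 - c i * c j)) *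
        ((1 - (∏ j, c j) * z) * (1 - (∏ j, c j) / z))) := by
  -- With a = c_i and P the product of the other four parameters, all products are values of one
  -- binary quartic, at (1, z), (1, z⁻¹), (-aP, -1) and (1, a). What remains is an identity in a, P,
  -- z and the e's.
  obtain ⟨e₁, e₂, e₃, he⟩ := exists_prod_erase c i
  have hA : ∏ j, c j = c i * ∏ j ∈ Finset.univ.erase i, c j :=
    (Finset.mul_prod_erase _ _ (Finset.mem_univ i)).symm
  set P := ∏ j ∈ Finset.univ.erase i, c j with hP
  have hP0 : P ≠ 0 := Finset.prod_ne_zero_iff.2 fun j _ => hc j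
  set a := c i with ha
  have ha0 : a ≠ 0 := hc i
  rw [hA]
  have h1 : ∏ j, (1 - c j * z) = (1 - a * z) * ∏ j ∈ Finset.univ.erase i, (1 - c j * z) :=
    (Finset.mul_prod_erase _ _ (Finset.mem_univ i)).symm
  have h2 : ∏ j, (1 - c j / z) = (1 - a / z) * ∏ j ∈ Finset.univ.erase i, (1 - c j * z⁻¹) := by
    simp only [← div_eq_mul_inv]
    exact (Finset.mul_prod_erase _ _ (Finset.mem_univ i)).symm
  have h3 : ∏ j ∈ Finset.univ.erase i, (1 - a * P / c j) =
      P⁻¹ * ∏ j ∈ Finset.univ.erase i, (-(a * P) - c j * (-1)) := by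
    rw [hP, ← Finset.prod_inv_distrib, ← Finset.prod_mul_distrib, ← hP]
    refine Finset.prod_congr rfl fun j _ => ?_
    have := hc j
    field_simp
    ring
  have h4 : ∏ j ∈ Finset.univ.erase i, (1 - a * c j) = ∏ j ∈ Finset.univ.erase i, (1 - c j * a) :=
    Finset.prod_congr rfl fun j _ => by ring
  rw [h1, h2, h3, h4, he, he, he, he]
  field_simp
  ring

end NassrallahRahman

/-- Deformation of contours: `Separates` prescribes the winding number about each possible pole, and
the one about 0 follows. -/
lemma SimplePoles.loopInt_eq_of_separates {ι : Type*} [Nonempty ι] {q : ℂ} (hq : ‖q‖ < 1)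
    {c : ι → ℂ} {F : ℂ → ℂ}
    (hF : SimplePoles F ((⋃ j, outSet q (c j)) ∪ ⋃ j, inSet q (c j)))
    {g₁ g₁' g₂ g₂' : ℝ → ℂ} (h₁ : Separates q c g₁ g₁') (h₂ : Separates q c g₂ g₂') :
    loopInt F g₁ g₁' = loopInt F g₂ g₂' := by
  refine hF.loopInt_eq h₁.isLoop h₂.isLoop h₁.ne_zero h₂.ne_zero
    ((h₁.loopInt_inv hq).trans (h₂.loopInt_inv hq).symm) ?_
  rintro p (hp | hp) <;> obtain ⟨j, k, rfl⟩ := mem_iUnion.1 hp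
  · exact ⟨h₁.avoid_inv j k, h₂.avoid_inv j k, (h₁.outside j k).trans (h₂.outside j k).symm⟩
  · exact ⟨h₁.avoid j k, h₂.avoid j k, (h₁.inside j k).trans (h₂.inside j k).symm⟩

/-! ### The q-difference equation and the evaluation of the Nassrallah–Rahman integral. -/

section NassrallahRahman

variable {q : ℂ}

lemma Separates.notMem {ι : Type*} {c : ι → ℂ} {g g' : ℝ → ℂ} (h : Separates q c g g') {t : ℝ}
    (ht : t ∈ Icc (0 : ℝ) 1) : g t ∉ (⋃ j, outSet q (c j)) ∪ ⋃ j, inSet q (c j) := by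
  rintro (hp | hp) <;> obtain ⟨j, k, hk⟩ := mem_iUnion.1 hp
  · exact h.avoid_inv j k t ht hk
  · exact h.avoid j k t ht hk

lemma differentiableAt_theta_sq (hq : ‖q‖ < 1) {z : ℂ} (hz : z ≠ 0) :
    DifferentiableAt ℂ (fun z => theta q (z ^ 2)) z :=
  DifferentiableAt.comp (f := fun z : ℂ => z ^ 2) z
    (differentiableAt_theta hq (pow_ne_zero 2 hz)) (by fun_prop)

lemma differentiableAt_qInf_mul (hq : ‖q‖ < 1) (a z : ℂ) :
    DifferentiableAt ℂ (fun z => qInf q (a * z)) z :=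
  ((differentiable_qInf hq).comp (differentiable_id.const_mul a)) z

lemma differentiableAt_qInf_div (hq : ‖q‖ < 1) (a : ℂ) {z : ℂ} (hz : z ≠ 0) :
    DifferentiableAt ℂ (fun z => qInf q (a / z)) z :=
  DifferentiableAt.comp (f := fun z : ℂ => a / z) z (differentiable_qInf hq _)
    ((differentiableAt_const a).div differentiableAt_id hz)

lemma simplePoles_nrWeight (hq0 : q ≠ 0) (hq : ‖q‖ < 1) {c : Fin 5 → ℂ} (hc : Admissible q c) :
    SimplePoles (nrWeight q c) ((⋃ j, outSet q (c j)) ∪ ⋃ j, inSet q (c j)) := by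
  have h := hc.simplePoles_kernel hq0 hq 0
  simp only [Pi.zero_apply, zpow_zero, mul_one] at h
  refine (h.mul_differentiable (G := fun z => (1 - (z ^ 2)⁻¹) * theta q (z ^ 2) *
    (qInf q ((∏ j, c j) * z) * qInf q ((∏ j, c j) / z)) * z⁻¹) fun z hz => ?_).congr
    fun z _ _ => ?_
  · have h1 : DifferentiableAt ℂ (fun z : ℂ => (z ^ 2)⁻¹) z :=
      (differentiableAt_id.pow 2).inv (pow_ne_zero 2 hz)
    exact (((h1.const_sub 1).mul (differentiableAt_theta_sq hq hz)).mul
      ((differentiableAt_qInf_mul hq _ z).mul (differentiableAt_qInf_div hq _ hz))).mul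
      (differentiableAt_inv hz)
  · simp only [nrWeight]
    ring

lemma kernel_shift (hq : ‖q‖ < 1) (c : Fin 5 → ℂ) (i : Fin 5) {z : ℂ} (h1 : 1 - c i * z ≠ 0)
    (h2 : 1 - c i / z ≠ 0) :
    kernel q (shift q c i) (shift q c i) z = (1 - c i * z) * (1 - c i / z) * kernel q c c z := by
  rw [kernel, kernel, ← Finset.mul_prod_erase _ _ (Finset.mem_univ i),
    ← Finset.mul_prod_erase _ (fun j => (qInf q (c j * z) * qInf q (c j / z))⁻¹)
      (Finset.mem_univ i), ← mul_assoc]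
  congr 1
  · rw [shift, Function.update_self, qInf_eq hq (c i * z), qInf_eq hq (c i / z),
      show c i * z * q = q * c i * z by ring, show c i / z * q = q * c i / z by ring]
    rw [mul_inv, mul_inv, mul_inv, mul_inv]
    field_simp
  · exact Finset.prod_congr rfl fun j hj => by
      rw [shift, Function.update_of_ne (Finset.ne_of_mem_erase hj)]

lemma kernel_mul_right (hq : ‖q‖ < 1) (c : Fin 5 → ℂ) {z : ℂ} (h : ∀ j, 1 - c j / z ≠ 0) :
    kernel q c (fun j => c j * q) z = (∏ j, (1 - c j / z)) * kernel q c c z := by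
  rw [kernel, kernel, ← Finset.prod_mul_distrib]
  refine Finset.prod_congr rfl fun j _ => ?_
  rw [qInf_eq hq (c j / z), show c j / z * q = c j * q / z by ring, mul_inv, mul_inv, mul_inv]
  have := h j
  field_simp

lemma kernel_mul_left (hq0 : q ≠ 0) (hq : ‖q‖ < 1) (c : Fin 5 → ℂ) {z : ℂ} (h : ∀ j, 1 - c j * z ≠ 0) :
    kernel q c (fun j => c j * q) (q * z) = (∏ j, (1 - c j * z)) * kernel q c c z := by
  rw [kernel, kernel, ← Finset.prod_mul_distrib]
  refine Finset.prod_congr rfl fun j _ => ?_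
  rw [qInf_eq hq (c j * z), show c j * (q * z) = c j * z * q by ring,
    show c j * q / (q * z) = c j / z by field_simp, mul_inv, mul_inv, mul_inv]
  have := h j
  field_simp

lemma Separates.one_sub_mul_ne {ι : Type*} {c : ι → ℂ} {g g' : ℝ → ℂ} (h : Separates q c g g')
    {t : ℝ} (ht : t ∈ Icc (0 : ℝ) 1) (j : ι) : 1 - c j * g t ≠ 0 := fun e => by
  refine h.avoid_inv j 0 t ht ?_
  rw [pow_zero, mul_one]
  exact eq_inv_of_mul_eq_one_right (sub_eq_zero.1 e).symm

lemma Separates.one_sub_div_ne {ι : Type*} {c : ι → ℂ} {g g' : ℝ → ℂ} (h : Separates q c g g')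
    {t : ℝ} (ht : t ∈ Icc (0 : ℝ) 1) (j : ι) : 1 - c j / g t ≠ 0 := fun e => by
  refine h.avoid j 0 t ht ?_
  rw [pow_zero, mul_one]
  exact ((div_eq_one_iff_eq (h.ne_zero t ht)).1 (sub_eq_zero.1 e).symm).symm

lemma Separates.shift {c : Fin 5 → ℂ} {g g' : ℝ → ℂ} (h : Separates q c g g') (i : Fin 5) :
    Separates q (shift q c i) g g' :=
  h.mul_pow fun j => ⟨j, if j = i then 1 else 0, by
    by_cases hj : j = i
    · subst hj; simp [Rahman.shift, mul_comm]
    · simp [Rahman.shift, hj]⟩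

lemma Admissible.shift (hq0 : q ≠ 0) {c : Fin 5 → ℂ} (h : Admissible q c) (i : Fin 5) :
    Admissible q (shift q c i) := by
  convert h.zpow_mul hq0 (fun j => if j = i then 1 else 0) using 1
  funext j
  by_cases hj : j = i
  · subst hj; simp [Rahman.shift, mul_comm]
  · simp [Rahman.shift, hj]

/-- The function whose `q`-difference gives the contiguous relation. -/
noncomputable def nrPrim (q : ℂ) (c : Fin 5 → ℂ) (z : ℂ) : ℂ :=
  kernel q c (fun j => c j * q) z *
    (theta q (z ^ 2) * (qInf q ((∏ j, c j) * z) * qInf q (q * (∏ j, c j) / z)))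

lemma simplePoles_nrPrim (hq0 : q ≠ 0) (hq : ‖q‖ < 1) {c : Fin 5 → ℂ} (hc : Admissible q c) :
    SimplePoles (nrPrim q c) ((⋃ j, outSet q (c j)) ∪ ⋃ j, inSet q (c j * q)) := by
  have h := hc.simplePoles_kernel hq0 hq 1
  simp only [Pi.one_apply, zpow_one] at h
  exact h.mul_differentiable fun z hz => (differentiableAt_theta_sq hq hz).mul
    ((differentiableAt_qInf_mul hq _ z).mul (differentiableAt_qInf_div hq _ hz))

/-- All four infinite-product expressions share one transcendental factor; what is left after
removing it is `contiguous_identity`. -/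
lemma nrPrim_identity (hq0 : q ≠ 0) (hq : ‖q‖ < 1) {c : Fin 5 → ℂ} (hc : ∀ j, c j ≠ 0) (i : Fin 5)
    {z : ℂ} (hz : z ≠ 0) (h1 : ∀ j, 1 - c j * z ≠ 0) (h2 : ∀ j, 1 - c j / z ≠ 0) :
    (1 - (∏ j, c j) * c i) * (q * nrPrim q c (q * z) - nrPrim q c z) =
      (c i)⁻¹ * (∏ j ∈ Finset.univ.erase i, (1 - (∏ j, c j) / c j)) *
        nrWeight q (shift q c i) z -
      (c i)⁻¹ * (∏ j ∈ Finset.univ.erase i, (1 - c i * c j)) * nrWeight q c z := by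
  have key := contiguous_identity hc i hz
  simp only [nrPrim, nrWeight, kernel_mul_right hq c h2, kernel_mul_left hq0 hq c h1,
    kernel_shift hq c i (h1 i) (h2 i), prod_shift]
  set A := ∏ j, c j
  rw [qInf_eq hq (A * z), qInf_eq hq (A / z), show A * (q * z) = q * A * z by ring,
    show q * A / (q * z) = A / z by field_simp, qInf_eq hq (A / z),
    show A * z * q = q * A * z by ring, show A / z * q = q * A / z by ring,
    show (q * z) ^ 2 = q * (q * z ^ 2) by ring, theta_q_mul hq0 hq (by simp [hq0, hz]),
    theta_q_mul hq0 hq (by simp [hz])]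
  generalize ∏ j, (1 - c j * z) = X1 at *
  generalize ∏ j, (1 - c j / z) = X2 at *
  generalize ∏ j ∈ Finset.univ.erase i, (1 - A / c j) = X3 at *
  generalize ∏ j ∈ Finset.univ.erase i, (1 - c i * c j) = X4 at *
  generalize qInf q (q * A * z) = U
  generalize qInf q (q * A / z) = W
  generalize theta q (z ^ 2) = T
  generalize kernel q c c z = K
  have hci := hc i
  calc _ = z⁻¹ * (z⁻¹ * T * U * W * K) * ((1 - A * c i) * ((z ^ 2)⁻¹ * (1 - A / z) * X1 -
        z ^ 2 * (1 - A * z) * X2)) := by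
        field_simp
    _ = _ := by
        rw [key]
        field_simp

/-- The contiguous relation for the Nassrallah–Rahman integral. -/
lemma loopInt_nrWeight_shift (hq0 : q ≠ 0) (hq : ‖q‖ < 1) {c : Fin 5 → ℂ} (hc : Admissible q c)
    {g g' : ℝ → ℂ} (hg : Separates q c g g') (i : Fin 5) :
    (∏ j ∈ Finset.univ.erase i, (1 - c i * c j)) * loopInt (nrWeight q c) g g' =
      (∏ j ∈ Finset.univ.erase i, (1 - (∏ j, c j) / c j)) *
        loopInt (nrWeight q (shift q c i)) g g' := by
  have hF := simplePoles_nrPrim hq0 hq hc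
  have hq' : ∀ z : ℂ, q * (q * z)⁻¹ = z⁻¹ := fun z => by rw [mul_inv, mul_inv_cancel_left₀ hq0]
  -- Scaling the curve by q preserves the winding number about every pole of `nrPrim`: relative to
  -- the original curve, outer poles (c_j q^k)⁻¹ become (c_j q^{k+1})⁻¹ and inner poles c_j q^{k+1}
  -- become c_j q^k. It is essential that the inner poles start at c_j q.
  have hcF : loopInt (nrPrim q c) (fun t => q * g t) (fun t => q * g' t) =
      loopInt (nrPrim q c) g g' := by
    refine hF.loopInt_eq (isLoop_const_mul hg.isLoop q) hg.isLoop
      (fun t ht => mul_ne_zero hq0 (hg.ne_zero t ht)) hg.ne_zero ?_ ?_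
    · rw [loopInt_const_mul_loop]
      simp only [hq']
    · have hs : ∀ p p' : ℂ, p = q * p' → loopInt (fun z => (z - p)⁻¹) (fun t => q * g t)
          (fun t => q * g' t) = loopInt (fun z => (z - p')⁻¹) g g' := by
        rintro _ p' rfl
        rw [loopInt_const_mul_loop]
        simp only [← mul_sub, hq']
      rintro p (hp | hp) <;> obtain ⟨j, k, rfl⟩ := mem_iUnion.1 hp
      · have e : (c j * q ^ k)⁻¹ = q * (c j * q ^ (k + 1))⁻¹ := by
          rw [pow_succ, ← mul_assoc, mul_comm (c j * q ^ k) q, hq']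
        refine ⟨fun t ht h => ?_, hg.avoid_inv j k, ?_⟩
        · rw [e] at h
          exact hg.avoid_inv j _ t ht (mul_left_cancel₀ hq0 h)
        · rw [hs _ _ e, hg.outside, hg.outside]
      · have e : c j * q * q ^ k = q * (c j * q ^ k) := by ring
        have e' : c j * q * q ^ k = c j * q ^ (k + 1) := by ring
        refine ⟨fun t ht h => ?_, fun t ht => e' ▸ hg.avoid j (k + 1) t ht, ?_⟩
        · rw [e] at h
          exact hg.avoid j _ t ht (mul_left_cancel₀ hq0 h)
        · rw [hs _ _ e, e', hg.inside, hg.inside]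
  rw [loopInt_const_mul_loop] at hcF
  have hsub : ⋃ j, inSet q (c j * q) ⊆ ⋃ j, inSet q (c j) :=
    iUnion_mono fun j => by
      rintro _ ⟨k, rfl⟩
      exact ⟨k + 1, by ring⟩
  have hcont1 : ContinuousOn (fun t => nrPrim q c (g t)) (Icc 0 1) :=
    hF.continuousOn_comp hg.isLoop.cont hg.ne_zero fun t ht h =>
      hg.notMem ht (union_subset_union_right _ hsub h)
  have hcont2 : ContinuousOn (fun t => nrWeight q c (g t)) (Icc 0 1) :=
    (simplePoles_nrWeight hq0 hq hc).continuousOn_comp hg.isLoop.cont hg.ne_zero fun t ht =>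
      hg.notMem ht
  have hcont3 : ContinuousOn (fun t => nrWeight q (shift q c i) (g t)) (Icc 0 1) :=
    (simplePoles_nrWeight hq0 hq (hc.shift hq0 i)).continuousOn_comp hg.isLoop.cont hg.ne_zero
      fun t ht => (hg.shift i).notMem ht
  have hid := fun t ht => nrPrim_identity hq0 hq hc.ne_zero i (hg.ne_zero t ht)
    (hg.one_sub_mul_ne ht) (hg.one_sub_div_ne ht)
  have hci := hc.ne_zero i
  set P₁ := ∏ j ∈ Finset.univ.erase i, (1 - (∏ j, c j) / c j)
  set P₂ := ∏ j ∈ Finset.univ.erase i, (1 - c i * c j)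
  have hint : loopInt (fun z => (1 - (∏ j, c j) * c i) * (q * nrPrim q c (q * z))) g g' =
      loopInt (fun z => (1 - (∏ j, c j) * c i) * nrPrim q c z + ((c i)⁻¹ * P₁ *
        nrWeight q (shift q c i) z + -((c i)⁻¹ * P₂) * nrWeight q c z)) g g' :=
    loopInt_congr fun t ht => by linear_combination hid t ht
  rw [loopInt_const_mul, hcF, hg.isLoop.loopInt_add (F := fun z => _ * nrPrim q c z)
    (G := fun z => _ * nrWeight q (shift q c i) z + _ * nrWeight q c z)
    (continuousOn_const.mul hcont1)
    ((continuousOn_const.mul hcont3).add (continuousOn_const.mul hcont2)),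
    hg.isLoop.loopInt_add (F := fun z => _ * nrWeight q (shift q c i) z)
    (G := fun z => _ * nrWeight q c z)
    (continuousOn_const.mul hcont3) (continuousOn_const.mul hcont2),
    loopInt_const_mul, loopInt_const_mul, loopInt_const_mul] at hint
  have h2 : (c i)⁻¹ * (P₂ * loopInt (nrWeight q c) g g') =
      (c i)⁻¹ * (P₁ * loopInt (nrWeight q (shift q c i)) g g') := by
    linear_combination hint
  exact mul_left_cancel₀ (inv_ne_zero hci) h2

/-- The two sides of the evaluation change by a common factor. An anonymous P can be iterated
without bookkeeping, and nothing is divided by it, since it might vanish. -/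
lemma exists_factor_shift (hq0 : q ≠ 0) (hq : ‖q‖ < 1) {c : Fin 5 → ℂ} (hc : Admissible q c)
    {g g' : ℝ → ℂ} (hg : Separates q c g g') (i : Fin 5) : ∃ P : ℂ,
    loopInt (nrWeight q c) g g' * pairs q c =
      P * (loopInt (nrWeight q (shift q c i)) g g' * pairs q (shift q c i)) ∧
    ∏ j, qInf q ((∏ j, c j) / c j) =
      P * ∏ j, qInf q ((∏ j, shift q c i j) / shift q c i j) := by
  refine ⟨_, ?_, prod_qInf_div_eq_shift hq0 hq c i⟩
  rw [pairs_eq_shift hq c i]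
  linear_combination pairs q (shift q c i) * loopInt_nrWeight_shift hq0 hq hc hg i

lemma exists_factor_const_mul (hq0 : q ≠ 0) (hq : ‖q‖ < 1) {c : Fin 5 → ℂ} (hc : Admissible q c)
    {g g' : ℝ → ℂ} (hg : Separates q c g g') : ∃ P : ℂ,
    loopInt (nrWeight q c) g g' * pairs q c =
      P * (loopInt (nrWeight q fun j => q * c j) g g' * pairs q fun j => q * c j) ∧
    ∏ j, qInf q ((∏ j, c j) / c j) =
      P * ∏ j, qInf q ((∏ j, q * c j) / (q * c j)) := by
  have e : shift q (shift q (shift q (shift q (shift q c 0) 1) 2) 3) 4 = fun j => q * c j := by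
    funext j
    fin_cases j <;> simp [shift]
  obtain ⟨P0, h0, k0⟩ := exists_factor_shift hq0 hq hc hg 0
  obtain ⟨P1, h1, k1⟩ := exists_factor_shift hq0 hq (hc.shift hq0 0) (hg.shift 0) 1
  obtain ⟨P2, h2, k2⟩ := exists_factor_shift hq0 hq ((hc.shift hq0 0).shift hq0 1)
    ((hg.shift 0).shift 1) 2
  obtain ⟨P3, h3, k3⟩ := exists_factor_shift hq0 hq (((hc.shift hq0 0).shift hq0 1).shift hq0 2)
    (((hg.shift 0).shift 1).shift 2) 3
  obtain ⟨P4, h4, k4⟩ := exists_factor_shift hq0 hq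
    ((((hc.shift hq0 0).shift hq0 1).shift hq0 2).shift hq0 3)
    ((((hg.shift 0).shift 1).shift 2).shift 3) 4
  rw [e] at h4 k4
  refine ⟨P0 * P1 * P2 * P3 * P4, ?_, ?_⟩
  · rw [h0, h1, h2, h3, h4]; ring
  · rw [k0, k1, k2, k3, k4]; ring

lemma exists_factor_pow_mul (hq0 : q ≠ 0) (hq : ‖q‖ < 1) {c : Fin 5 → ℂ} (hc : Admissible q c)
    {g g' : ℝ → ℂ} (hg : Separates q c g g') (n : ℕ) : ∃ P : ℂ,
    loopInt (nrWeight q c) g g' * pairs q c =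
      P * (loopInt (nrWeight q fun j => q ^ n * c j) g g' * pairs q fun j => q ^ n * c j) ∧
    ∏ j, qInf q ((∏ j, c j) / c j) =
      P * ∏ j, qInf q ((∏ j, q ^ n * c j) / (q ^ n * c j)) := by
  induction n with
  | zero => exact ⟨1, by simp⟩
  | succ n ih =>
    obtain ⟨P, h1, h2⟩ := ih
    have hc' : Admissible q fun j => q ^ n * c j := by
      simpa [mul_comm] using hc.zpow_mul hq0 fun _ => n
    have hg' : Separates q (fun j => q ^ n * c j) g g' :=
      hg.mul_pow fun j => ⟨j, n, mul_comm _ _⟩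
    obtain ⟨Q, k1, k2⟩ := exists_factor_const_mul hq0 hq hc' hg'
    simp only [← mul_assoc, ← pow_succ'] at k1 k2
    exact ⟨P * Q, by rw [h1, k1]; ring, by rw [h2, k2]; ring⟩

/-- Joint continuity including s = 0 justifies the limit in which all parameters tend to 0. -/
lemma continuousOn_nrWeight (hq : ‖q‖ < 1) (c : Fin 5 → ℂ) {ρ : ℝ}
    (hρ : ∀ j, ρ * ‖c j‖ < 1) :
    ContinuousOn (Function.uncurry fun s z => nrWeight q (fun j => s * c j) z)
      (Metric.closedBall 0 ρ ×ˢ Metric.sphere 0 1) := by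
  have hz : ∀ p ∈ Metric.closedBall (0 : ℂ) ρ ×ˢ Metric.sphere (0 : ℂ) 1, p.2 ≠ 0 := by
    rintro p hp h
    have := hp.2; rw [h] at this; simp at this
  have hlt : ∀ p ∈ Metric.closedBall (0 : ℂ) ρ ×ˢ Metric.sphere (0 : ℂ) 1, ∀ j,
      ‖p.1 * c j‖ < 1 := fun p hp j => by
    have h1 := hp.1
    rw [mem_closedBall_zero_iff] at h1
    rw [norm_mul]
    exact (mul_le_mul_of_nonneg_right h1 (norm_nonneg _)).trans_lt (hρ j)
  have hinv : ContinuousOn (fun p : ℂ × ℂ => p.2⁻¹)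
      (Metric.closedBall 0 ρ ×ˢ Metric.sphere 0 1) := continuousOn_snd.inv₀ hz
  have hinv2 : ContinuousOn (fun p : ℂ × ℂ => (p.2 ^ 2)⁻¹)
      (Metric.closedBall 0 ρ ×ˢ Metric.sphere 0 1) :=
    ContinuousOn.inv₀ (by fun_prop) fun p hp => pow_ne_zero 2 (hz p hp)
  have hm : ∀ {f : ℂ → ℂ}, Continuous f → ContinuousOn (fun p : ℂ × ℂ => qInf q (f p.1 * p.2))
      (Metric.closedBall 0 ρ ×ˢ Metric.sphere 0 1) := fun {f} hf =>
    (continuous_qInf hq).comp_continuousOn (by fun_prop)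
  have hd : ∀ {f : ℂ → ℂ}, Continuous f → ContinuousOn (fun p : ℂ × ℂ => qInf q (f p.1 / p.2))
      (Metric.closedBall 0 ρ ×ˢ Metric.sphere 0 1) := fun {f} hf => by
    simp only [div_eq_mul_inv]
    exact (continuous_qInf hq).comp_continuousOn
      ((hf.comp_continuousOn continuousOn_fst).mul hinv)
  have hker : ContinuousOn (fun p : ℂ × ℂ =>
      kernel q (fun j => p.1 * c j) (fun j => p.1 * c j) p.2)
      (Metric.closedBall 0 ρ ×ˢ Metric.sphere 0 1) := by
    unfold kernel
    refine continuousOn_finsetProd _ fun j _ => ((hm (f := fun s => s * c j) (by fun_prop)).mul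
      (hd (f := fun s => s * c j) (by fun_prop))).inv₀ fun p hp => ?_
    have h1 := hlt p hp j
    have h2 := hp.2
    rw [mem_sphere_zero_iff_norm] at h2
    refine mul_ne_zero (qInf_ne_zero_of_norm_lt hq ?_) (qInf_ne_zero_of_norm_lt hq ?_)
    · rwa [norm_mul, h2, mul_one]
    · rwa [norm_div, h2, div_one]
  exact (((continuousOn_const.sub hinv2).mul (continuousOn_theta_sq hq)).mul
    ((hm (f := fun s => ∏ j, s * c j) (by fun_prop)).mul
      (hd (f := fun s => ∏ j, s * c j) (by fun_prop)))).mul hker |>.mul hinv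

/-- The Nassrallah–Rahman integral. -/
theorem loopInt_nrWeight (hq0 : q ≠ 0) (hq : ‖q‖ < 1) {c : Fin 5 → ℂ} (hc : Admissible q c)
    {g g' : ℝ → ℂ} (hg : Separates q c g g') :
    loopInt (nrWeight q c) g g' * pairs q c =
      2 * Real.pi * Complex.I * (2 / qInf q q) * ∏ j, qInf q ((∏ j, c j) / c j) := by
  have hS : 0 ≤ ∑ j, ‖c j‖ := Finset.sum_nonneg fun _ _ => norm_nonneg _
  -- For |s| ≤ ρ all s c_j lie in the open unit disc, so the unit circle is an admissible contour.
  set ρ : ℝ := (1 + ∑ j, ‖c j‖)⁻¹ with hρ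
  have hρ0 : 0 < ρ := by positivity
  have hρ1 : ∀ j, ρ * ‖c j‖ < 1 := fun j => by
    rw [hρ, inv_mul_lt_one₀ (by positivity)]
    have := Finset.single_le_sum (f := fun j => ‖c j‖) (fun _ _ => norm_nonneg _)
      (Finset.mem_univ j)
    linarith
  obtain ⟨N, hN⟩ := exists_norm_mul_pow_lt hq 1 hρ0
  simp only [one_mul] at hN
  have hs : Filter.Tendsto (fun n => q ^ (n + N)) Filter.atTop (𝓝 0) :=
    (Filter.tendsto_add_atTop_iff_nat N).2 (tendsto_pow_atTop_nhds_zero_of_norm_lt_one hq)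
  have hlim := tendsto_circleIntegral hρ0.le (continuousOn_nrWeight hq c hρ1) hs
    fun n => (hN _ (Nat.le_add_left N n)).le
  have h0 : (∮ z in C((0 : ℂ), 1), nrWeight q (fun j => 0 * c j) z) =
      2 * Real.pi * Complex.I * (2 / qInf q q) := by
    rw [← circleIntegral_theta_sq hq0 hq]
    refine circleIntegral.integral_congr zero_le_one fun z _ => ?_
    simp [nrWeight, kernel]
  rw [h0] at hlim
  -- The fixed curve separates the shifted parameters as well, and for them it may be exchanged for
  -- the unit circle, where the limit is under control.
  have hX : Filter.Tendsto (fun n => loopInt (nrWeight q fun j => q ^ (n + N) * c j) g g')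
      Filter.atTop (𝓝 (2 * Real.pi * Complex.I * (2 / qInf q q))) := by
    refine hlim.congr fun n => ?_
    have hc' : Admissible q fun j => q ^ (n + N) * c j := by
      have := hc.zpow_mul hq0 fun _ => ((n + N : ℕ) : ℤ)
      simp only [zpow_natCast] at this
      simpa only [mul_comm] using this
    have hg' : Separates q (fun j => q ^ (n + N) * c j) g g' :=
      hg.mul_pow fun j => ⟨j, _, mul_comm _ _⟩
    have hlt : ∀ j, ‖q ^ (n + N) * c j‖ < 1 := fun j => by
      rw [norm_mul]
      exact (mul_le_mul_of_nonneg_right (hN _ (Nat.le_add_left N n)).le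
        (norm_nonneg _)).trans_lt (hρ1 j)
    rw [(simplePoles_nrWeight hq0 hq hc').loopInt_eq_of_separates hq hg'
      (separates_circ hq0 hq hc'.ne_zero hlt), loopInt_circ]
    simp
  have hcont : Continuous fun s : ℂ => pairs q fun j => s * c j := by
    unfold pairs
    exact continuous_finsetProd _ fun i _ => continuous_finsetProd _ fun j _ =>
      (continuous_qInf hq).comp (by fun_prop)
  have hP : Filter.Tendsto (fun n => pairs q fun j => q ^ (n + N) * c j) Filter.atTop (𝓝 1) := by
    have := (hcont.tendsto 0).comp hs
    simpa [pairs, Function.comp_def] using this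
  have hY : Filter.Tendsto (fun n => ∏ j, qInf q ((∏ j, q ^ (n + N) * c j) / (q ^ (n + N) * c j)))
      Filter.atTop (𝓝 1) := by
    have h1 : ∀ (n : ℕ) (j : Fin 5), (∏ j, q ^ (n + N) * c j) / (q ^ (n + N) * c j) =
        (q ^ (n + N)) ^ 4 * ((∏ j, c j) / c j) := fun n j => by
      rw [Finset.prod_mul_distrib, Finset.prod_const, Finset.card_univ, Fintype.card_fin]
      have := pow_ne_zero (n + N) hq0
      have := hc.ne_zero j
      field_simp
    simp only [h1]
    have hcont2 : Continuous fun s : ℂ => ∏ j, qInf q (s ^ 4 * ((∏ j, c j) / c j)) :=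
      continuous_finsetProd _ fun i _ => (continuous_qInf hq).comp (by fun_prop)
    have := (hcont2.tendsto 0).comp hs
    simpa [Function.comp_def] using this
  -- The limit is taken in cross-multiplied form, so that the common factor P is never inverted.
  have hL := hY.const_mul (loopInt (nrWeight q c) g g' * pairs q c)
  have hR := (hX.mul hP).const_mul (∏ j, qInf q ((∏ j, c j) / c j))
  rw [mul_one] at hL hR
  have := tendsto_nhds_unique hL (hR.congr fun n => ?_)
  · rw [this, mul_comm]
  · obtain ⟨P, h1, h2⟩ := exists_factor_pow_mul hq0 hq hc hg (n + N)
    rw [h1, h2]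
    ring

end NassrallahRahman

/-- Inversion preserves the separation property. -/
lemma Separates.inv_symm {ι : Type*} [Nonempty ι] {q : ℂ} (hq0 : q ≠ 0) (hq : ‖q‖ < 1) {c : ι → ℂ}
    (hc : ∀ j, c j ≠ 0) {g g' : ℝ → ℂ} (h : Separates q c g g') :
    Separates q c (fun t => (g (1 - t))⁻¹) (fun t => g' (1 - t) / g (1 - t) ^ 2) := by
  have hI : ∀ {t : ℝ}, t ∈ Icc (0 : ℝ) 1 → 1 - t ∈ Icc (0 : ℝ) 1 := fun ht =>
    ⟨by linarith [ht.2], by linarith [ht.1]⟩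
  have key : ∀ p : ℂ, p ≠ 0 → (∀ t ∈ Icc (0 : ℝ) 1, g t ≠ p⁻¹) →
      loopInt (fun z => (z - p)⁻¹) (fun t => (g (1 - t))⁻¹) (fun t => g' (1 - t) / g (1 - t) ^ 2) =
        2 * Real.pi * Complex.I - loopInt (fun z => (z - p⁻¹)⁻¹) g g' := fun p hp hgp => by
    have e : loopInt (fun z => (z⁻¹ - p)⁻¹ / z ^ 2) g g' =
        loopInt (fun z => z⁻¹ + (-1) * (z - p⁻¹)⁻¹) g g' := loopInt_congr fun t ht => by
      have h1 := h.ne_zero t ht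
      have h2 : 1 - p * g t ≠ 0 := fun e =>
        hgp t ht (eq_inv_of_mul_eq_one_right (sub_eq_zero.1 e).symm)
      have h3 : (g t)⁻¹ - p = (1 - p * g t) / g t := by field_simp
      have h4 : g t - p⁻¹ = -(1 - p * g t) / p := by field_simp; ring
      rw [h3, h4]
      field_simp
      ring
    rw [loopInt_inv_symm, e, h.isLoop.loopInt_add (F := fun z => z⁻¹)
      (G := fun z => (-1) * (z - p⁻¹)⁻¹) (h.isLoop.cont.inv₀ h.ne_zero)
      (continuousOn_const.mul ((h.isLoop.cont.sub continuousOn_const).inv₀ fun t ht =>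
        sub_ne_zero.2 (hgp t ht))), loopInt_const_mul, h.loopInt_inv hq]
    ring
  have hp : ∀ j (k : ℕ), c j * q ^ k ≠ 0 := fun j k => mul_ne_zero (hc j) (pow_ne_zero k hq0)
  refine ⟨h.isLoop.inv_symm h.ne_zero, fun t ht => inv_ne_zero (h.ne_zero _ (hI ht)),
    fun j k t ht e => ?_, fun j k => ?_, fun j k t ht e => ?_, fun j k => ?_⟩
  · exact h.avoid_inv j k _ (hI ht) (by rw [← e, inv_inv])
  · rw [key _ (hp j k) (h.avoid_inv j k), h.outside, sub_zero]
  · exact h.avoid j k _ (hI ht) (inv_injective e)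
  · have := h.avoid j k
    rw [key _ (inv_ne_zero (hp j k)) (by simpa using this), inv_inv, h.inside, sub_self]

/-! ### Antisymmetric theta functions of degree six. -/

section ThetaForms

variable {q : ℂ}

/-- The antisymmetric theta functions of degree `6`. -/
structure ThetaForm (q : ℂ) (g : ℂ → ℂ) : Prop where
  differentiableAt : ∀ z ≠ 0, DifferentiableAt ℂ g z
  q_mul : ∀ z ≠ 0, g (q * z) = (q ^ 3)⁻¹ * (z ^ 6)⁻¹ * g z
  inv : ∀ z ≠ 0, g z⁻¹ = -g z

/-- The Laurent coefficients of a function on the punctured plane, up to the factor `2πi`. -/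
noncomputable def laurent (g : ℂ → ℂ) (n : ℤ) : ℂ :=
  loopInt (fun z => z ^ (-n - 1) * g z) (circ 0 1) (circ' 1)

lemma differentiableAt_zpow_mul {g : ℂ → ℂ} {z : ℂ} (hz : z ≠ 0) (n : ℤ)
    (hg : DifferentiableAt ℂ g z) : DifferentiableAt ℂ (fun z => z ^ n * g z) z :=
  (differentiableAt_zpow.2 (Or.inl hz)).mul hg

lemma loopInt_circ_eq {F : ℂ → ℂ} (hF : ∀ z ≠ 0, DifferentiableAt ℂ F z) {w : ℂ} (hw : w ≠ 0) :
    loopInt F (circ 0 w) (circ' w) = loopInt F (circ 0 1) (circ' 1) := by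
  have h : ∀ {w : ℂ}, w ≠ 0 → ∀ t ∈ Icc (0 : ℝ) 1, circ 0 w t ≠ 0 := fun hw t _ e => by
    have := norm_circ_sub 0 _ t ▸ congrArg norm (sub_eq_zero.2 e)
    exact hw (by simpa using this)
  exact (SimplePoles.of_differentiable hF).loopInt_eq (isLoop_circ 0 w) (isLoop_circ 0 1) (h hw)
    (h one_ne_zero) ((loopInt_inv_circ_zero hw).trans (loopInt_inv_circ_zero one_ne_zero).symm)
    (by simp)

/-- The coefficient integral may be taken over the circle through any w ≠ 0, as there are no poles
besides 0. -/
lemma laurent_scale {g : ℂ → ℂ} (hg : ∀ z ≠ 0, DifferentiableAt ℂ g z) {w : ℂ} (hw : w ≠ 0)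
    (n : ℤ) : laurent g n = w ^ (-n) * laurent (fun z => g (w * z)) n := by
  rw [laurent, ← loopInt_circ_eq (fun z hz => differentiableAt_zpow_mul hz _ (hg z hz)) hw, laurent,
    ← loopInt_const_mul, loopInt_circ, loopInt_circ]
  refine circleIntegral.integral_congr zero_le_one fun z _ => ?_
  simp only [zero_add, one_mul]
  rw [mul_zpow, zpow_sub₀ hw, zpow_one]
  field_simp

lemma circ_ne_zero (t : ℝ) : circ 0 1 t ≠ 0 := fun e => by
  have := norm_circ_sub 0 1 t
  rw [e] at this
  simp at this

/-- A function on the punctured plane all of whose Laurent coefficients vanish is zero. -/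
lemma eq_zero_of_laurent {g : ℂ → ℂ} (hg : ∀ z ≠ 0, DifferentiableAt ℂ g z)
    (h : ∀ n, laurent g n = 0) {w : ℂ} (hw : w ≠ 0) : g w = 0 := by
  have hc : Continuous fun x : AddCircle (1 : ℝ) => g (w * AddCircle.toCircle x) := by
    refine continuous_iff_continuousAt.2 fun x => ?_
    have h1 : ContinuousAt (fun x : AddCircle (1 : ℝ) => w * (AddCircle.toCircle x : ℂ)) x :=
      (continuous_const.mul
        ((continuous_induced_dom : Continuous ((↑) : Circle → ℂ)).comp
          AddCircle.continuous_toCircle)).continuousAt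
    exact ContinuousAt.comp (f := fun x : AddCircle (1 : ℝ) => w * (AddCircle.toCircle x : ℂ))
      (hg _ (mul_ne_zero hw (Circle.coe_ne_zero _))).continuousAt h1
  let f : C(AddCircle (1 : ℝ), ℂ) := ⟨_, hc⟩
  have hcirc : ∀ t : ℝ, (AddCircle.toCircle (t : AddCircle (1 : ℝ)) : ℂ) = circ 0 1 t := fun t => by
    rw [AddCircle.toCircle_apply_mk, Circle.coe_exp, circ]
    push_cast
    rw [zero_add, one_mul]
    congr 1
    ring
  -- The Fourier coefficients of t ↦ g(w exp(2πit)) are multiples of the Laurent coefficients of g.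
  -- The zero series is summable, so it represents the function, whose value at t = 0 is g(w).
  have hf : fourierCoeff f = 0 := by
    funext n
    have h1 := h n
    rw [laurent_scale hg hw] at h1
    replace h1 := (mul_eq_zero.1 h1).resolve_left (zpow_ne_zero _ hw)
    rw [fourierCoeff_eq_intervalIntegral f n 0, zero_add]
    have h2 : (∫ x in (0 : ℝ)..1, fourier (-n) (x : AddCircle (1 : ℝ)) • f x) =
        (2 * Real.pi * Complex.I)⁻¹ * laurent (fun z => g (w * z)) n := by
      rw [laurent, loopInt, ← intervalIntegral.integral_const_mul]
      refine intervalIntegral.integral_congr fun t _ => ?_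
      have h3 : f (t : AddCircle (1 : ℝ)) = g (w * circ 0 1 t) := by rw [← hcirc]; rfl
      have h4 : (fourier (-n) (t : AddCircle (1 : ℝ)) : ℂ) = circ 0 1 t ^ (-n) := by
        rw [← hcirc, fourier_apply, AddCircle.toCircle_zsmul]
        simp
      have h5 : circ' 1 t = 2 * Real.pi * Complex.I * circ 0 1 t := by
        simp [circ', circ]
        try ring
      have := Complex.two_pi_I_ne_zero
      have h6 := circ_ne_zero t
      simp only [smul_eq_mul]
      rw [h3, h4, h5, zpow_sub₀ h6, zpow_one]
      field_simp
    rw [h2, h1]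
    simp
  have hs := hasSum_fourier_series_of_summable (f := f) (by rw [hf]; exact summable_zero)
  rw [hf] at hs
  have h0 : f = 0 := by
    refine hs.unique ?_
    rw [show (fun i : ℤ => (0 : ℤ → ℂ) i • (fourier i : C(AddCircle (1 : ℝ), ℂ))) = fun _ => 0 from
      funext fun i => ContinuousMap.ext fun x => zero_mul (fourier i x)]
    exact hasSum_zero
  have : f 0 = 0 := by rw [h0]; rfl
  simpa [f] using this

lemma ThetaForm.laurent_add_six (hq0 : q ≠ 0) {g : ℂ → ℂ} (h : ThetaForm q g) (n : ℤ) :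
    laurent g n = q ^ (-n - 3) * laurent g (n + 6) := by
  rw [laurent_scale h.differentiableAt hq0, zpow_sub₀ hq0, div_eq_mul_inv, mul_assoc]
  congr 1
  rw [laurent, laurent, ← loopInt_const_mul]
  refine loopInt_congr fun t _ => ?_
  have h6 := circ_ne_zero t
  rw [h.q_mul _ h6, show -(n + 6) - 1 = (-n - 1) + (-6 : ℤ) by ring, zpow_add₀ h6,
    show circ 0 1 t ^ (-6 : ℤ) = (circ 0 1 t ^ 6)⁻¹ by
      rw [zpow_neg]; congr 1, show q ^ (3 : ℤ) = q ^ 3 by norm_cast]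
  ring

lemma ThetaForm.laurent_neg (hq0 : q ≠ 0) (hq : ‖q‖ < 1) {g : ℂ → ℂ} (h : ThetaForm q g) (n : ℤ) :
    laurent g (-n) = -laurent g n := by
  -- The integrand has no poles outside 0. The single parameter q is only a device for making the
  -- exchange of the unit circle and its inverse available.
  have hs := separates_circ hq0 hq (c := fun _ : Unit => q) (fun _ => hq0) fun _ => hq
  have hF : SimplePoles (fun z => z ^ (-n - 1) * g z) ∅ :=
    SimplePoles.of_differentiable fun z hz =>
      differentiableAt_zpow_mul hz _ (h.differentiableAt z hz)
  have h1 := (hF.mono (empty_subset _)).loopInt_eq_of_separates hq hs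
    (hs.inv_symm hq0 hq fun _ => hq0)
  rw [loopInt_inv_symm] at h1
  rw [laurent, laurent, h1, ← neg_one_mul (loopInt _ _ _), ← loopInt_const_mul]
  refine loopInt_congr fun t _ => ?_
  have h6 := circ_ne_zero t
  rw [h.inv _ h6, inv_zpow', show -(-n - 1) = - -n - 1 + 2 by ring, zpow_add₀ h6,
    show circ 0 1 t ^ (2 : ℤ) = circ 0 1 t ^ 2 by norm_cast]
  field_simp

/-- Quasi-periodicity ties together the coefficients in each class mod 6. Antisymmetry kills the
classes 0 and 3 and identifies ±1 and ±2 up to sign, so two coefficients decide everything. -/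
lemma ThetaForm.eq_zero (hq0 : q ≠ 0) (hq : ‖q‖ < 1) {g : ℂ → ℂ} (h : ThetaForm q g)
    (h1 : laurent g 1 = 0) (h2 : laurent g 2 = 0) {z : ℂ} (hz : z ≠ 0) : g z = 0 := by
  have hneg := h.laurent_neg hq0 hq
  have hsix := h.laurent_add_six hq0
  have hself : ∀ {x : ℂ}, x = -x → x = 0 := fun hx => by
    linear_combination (1 / 2 : ℂ) * hx
  have h0 : laurent g 0 = 0 := hself (by simpa using hneg 0)
  -- For n = -3 the recursion factor is q^0 = 1, so coefficients -3 and 3 are equal as well as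
  -- opposite.
  have h3 : laurent g 3 = 0 := hself (by
    have h4 := hsix (-3)
    norm_num at h4
    rw [← hneg 3, h4])
  have h1' : laurent g (-1) = 0 := by rw [hneg, h1, neg_zero]
  have h2' : laurent g (-2) = 0 := by rw [hneg, h2, neg_zero]
  have hiff : ∀ n, laurent g n = 0 ↔ laurent g (n + 6) = 0 := fun n => by
    rw [hsix n, mul_eq_zero, or_iff_right (zpow_ne_zero _ hq0)]
  have hall : ∀ m, laurent g m = 0 → ∀ k : ℤ, laurent g (m + 6 * k) = 0 := fun m hm k => by
    induction k using Int.induction_on with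
    | zero => simpa using hm
    | succ k ih =>
      have := (hiff _).1 ih
      rwa [show m + 6 * (k : ℤ) + 6 = m + 6 * (k + 1) by ring] at this
    | pred k ih =>
      rw [hiff]
      rwa [show m + 6 * (-(k : ℤ) - 1) + 6 = m + 6 * (-k) by ring]
  refine eq_zero_of_laurent h.differentiableAt (fun n => ?_) hz
  have hn : n % 6 = 0 ∨ n % 6 = 1 ∨ n % 6 = 2 ∨ n % 6 = 3 ∨ n % 6 = 4 ∨ n % 6 = 5 := by omega
  rcases hn with hn | hn | hn | hn | hn | hn
  · simpa [show 0 + 6 * (n / 6) = n by omega] using hall 0 h0 (n / 6)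
  · simpa [show 1 + 6 * (n / 6) = n by omega] using hall 1 h1 (n / 6)
  · simpa [show 2 + 6 * (n / 6) = n by omega] using hall 2 h2 (n / 6)
  · simpa [show 3 + 6 * (n / 6) = n by omega] using hall 3 h3 (n / 6)
  · simpa [show -2 + 6 * (n / 6 + 1) = n by omega] using hall (-2) h2' (n / 6 + 1)
  · simpa [show -1 + 6 * (n / 6 + 1) = n by omega] using hall (-1) h1' (n / 6 + 1)

lemma continuousOn_zpow_mul_circ {g : ℂ → ℂ} (hg : ∀ z ≠ 0, DifferentiableAt ℂ g z) (n : ℤ) :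
    ContinuousOn (fun t => circ 0 1 t ^ n * g (circ 0 1 t)) (Icc 0 1) :=
  fun t _ => (ContinuousAt.comp (f := circ 0 1)
    (differentiableAt_zpow_mul (circ_ne_zero t) n (hg _ (circ_ne_zero t))).continuousAt
    (continuous_circ 0 1).continuousAt).continuousWithinAt

lemma laurent_linearComb {g₁ g₂ g₃ : ℂ → ℂ} (h₁ : ∀ z ≠ 0, DifferentiableAt ℂ g₁ z)
    (h₂ : ∀ z ≠ 0, DifferentiableAt ℂ g₂ z) (h₃ : ∀ z ≠ 0, DifferentiableAt ℂ g₃ z)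
    (a₁ a₂ a₃ : ℂ) (n : ℤ) :
    laurent (fun z => a₁ * g₁ z + a₂ * g₂ z + a₃ * g₃ z) n =
      a₁ * laurent g₁ n + a₂ * laurent g₂ n + a₃ * laurent g₃ n := by
  have hl := isLoop_circ 0 1
  have c : ∀ {g : ℂ → ℂ}, (∀ z ≠ 0, DifferentiableAt ℂ g z) → ∀ a : ℂ,
      ContinuousOn (fun t => a * (circ 0 1 t ^ (-n - 1) * g (circ 0 1 t))) (Icc 0 1) :=
    fun hg a => continuousOn_const.mul (continuousOn_zpow_mul_circ hg _)
  simp only [laurent, ← loopInt_const_mul]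
  rw [← hl.loopInt_add (c h₁ a₁) (c h₂ a₂), ← hl.loopInt_add ((c h₁ a₁).add (c h₂ a₂)) (c h₃ a₃)]
  exact loopInt_congr fun t _ => by ring

lemma ThetaForm.linearComb {g₁ g₂ g₃ : ℂ → ℂ} (h₁ : ThetaForm q g₁) (h₂ : ThetaForm q g₂)
    (h₃ : ThetaForm q g₃) (a₁ a₂ a₃ : ℂ) :
    ThetaForm q fun z => a₁ * g₁ z + a₂ * g₂ z + a₃ * g₃ z where
  differentiableAt z hz := (((h₁.differentiableAt z hz).const_mul a₁).add
    ((h₂.differentiableAt z hz).const_mul a₂)).add ((h₃.differentiableAt z hz).const_mul a₃)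
  q_mul z hz := by rw [h₁.q_mul z hz, h₂.q_mul z hz, h₃.q_mul z hz]; ring
  inv z hz := by rw [h₁.inv z hz, h₂.inv z hz, h₃.inv z hz]; ring

/-- The space of theta forms has dimension at most two. -/
lemma ThetaForm.exists_relation (hq0 : q ≠ 0) (hq : ‖q‖ < 1) {g₁ g₂ g₃ : ℂ → ℂ}
    (h₁ : ThetaForm q g₁) (h₂ : ThetaForm q g₂) (h₃ : ThetaForm q g₃) :
    ∃ a₁ a₂ a₃ : ℂ, (a₁ ≠ 0 ∨ a₂ ≠ 0 ∨ a₃ ≠ 0) ∧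
      ∀ z ≠ 0, a₁ * g₁ z + a₂ * g₂ z + a₃ * g₃ z = 0 := by
  let v : Fin 3 → Fin 2 → ℂ :=
    ![![laurent g₁ 1, laurent g₁ 2], ![laurent g₂ 1, laurent g₂ 2], ![laurent g₃ 1, laurent g₃ 2]]
  have hv : ¬LinearIndependent ℂ v := fun h => by
    have := h.fintype_card_le_finrank
    simp at this
  obtain ⟨a, ha, i, hi⟩ := Fintype.not_linearIndependent_iff.1 hv
  refine ⟨a 0, a 1, a 2, ?_, fun z hz => ?_⟩
  · fin_cases i
    exacts [Or.inl hi, Or.inr (Or.inl hi), Or.inr (Or.inr hi)]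
  · have e1 := congrFun ha 0
    have e2 := congrFun ha 1
    simp [v, Fin.sum_univ_three] at e1 e2
    refine (h₁.linearComb h₂ h₃ (a 0) (a 1) (a 2)).eq_zero hq0 hq ?_ ?_ hz <;>
    rw [laurent_linearComb h₁.differentiableAt h₂.differentiableAt h₃.differentiableAt]
    exacts [e1, e2]

/-- The theta form `z⁻¹ θ(z²) θ(az) θ(a/z)`. -/
noncomputable def thetaBasis (q a z : ℂ) : ℂ :=
  z⁻¹ * theta q (z ^ 2) * (theta q (a * z) * theta q (a / z))

lemma differentiableAt_theta_mul (hq : ‖q‖ < 1) {a z : ℂ} (ha : a ≠ 0) (hz : z ≠ 0) :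
    DifferentiableAt ℂ (fun z => theta q (a * z)) z :=
  DifferentiableAt.comp (f := fun z : ℂ => a * z) z
    (differentiableAt_theta hq (mul_ne_zero ha hz)) (by fun_prop)

lemma differentiableAt_theta_div (hq : ‖q‖ < 1) {a z : ℂ} (ha : a ≠ 0) (hz : z ≠ 0) :
    DifferentiableAt ℂ (fun z => theta q (a / z)) z :=
  DifferentiableAt.comp (f := fun z : ℂ => a / z) z
    (differentiableAt_theta hq (div_ne_zero ha hz))
    ((differentiableAt_const a).div differentiableAt_id hz)

lemma theta_div_q_mul (hq0 : q ≠ 0) (hq : ‖q‖ < 1) {a z : ℂ} (ha : a ≠ 0) (hz : z ≠ 0) :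
    theta q (a / (q * z)) = -(a / (q * z)) * theta q (a / z) := by
  have h := theta_q_mul hq0 hq (x := a / (q * z)) (div_ne_zero ha (mul_ne_zero hq0 hz))
  rw [show q * (a / (q * z)) = a / z by field_simp] at h
  rw [h]
  field_simp

lemma thetaForm_thetaBasis (hq0 : q ≠ 0) (hq : ‖q‖ < 1) {a : ℂ} (ha : a ≠ 0) :
    ThetaForm q (thetaBasis q a) where
  differentiableAt z hz := ((differentiableAt_inv hz).mul (differentiableAt_theta_sq hq hz)).mul
    ((differentiableAt_theta_mul hq ha hz).mul (differentiableAt_theta_div hq ha hz))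
  q_mul z hz := by
    rw [thetaBasis, thetaBasis, show (q * z) ^ 2 = q * (q * z ^ 2) by ring,
      theta_q_mul hq0 hq (by simp [hq0, hz]), theta_q_mul hq0 hq (by simp [hz]),
      show a * (q * z) = q * (a * z) by ring, theta_q_mul hq0 hq (by simp [ha, hz]),
      theta_div_q_mul hq0 hq ha hz]
    field_simp
  inv z hz := by
    rw [thetaBasis, thetaBasis, inv_pow, theta_inv hq0 hq (pow_ne_zero 2 hz), ← div_eq_mul_inv,
      div_inv_eq_mul]
    field_simp

/-- There is a linear relation between g and the two basis forms. Each basis form vanishes at its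
own node, so evaluation at u and v determines the coefficients. -/
lemma ThetaForm.eq_interpolation (hq0 : q ≠ 0) (hq : ‖q‖ < 1) {g : ℂ → ℂ} (hg : ThetaForm q g)
    {u v : ℂ} (hu : u ≠ 0) (hv : v ≠ 0) (huv : thetaBasis q u v ≠ 0) (hvu : thetaBasis q v u ≠ 0)
    {z : ℂ} (hz : z ≠ 0) :
    g z = g v / thetaBasis q u v * thetaBasis q u z + g u / thetaBasis q v u * thetaBasis q v z := by
  obtain ⟨x, y, w, h0, h⟩ := hg.exists_relation hq0 hq (thetaForm_thetaBasis hq0 hq hu)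
    (thetaForm_thetaBasis hq0 hq hv)
  have hself : ∀ u : ℂ, u ≠ 0 → thetaBasis q u u = 0 := fun u hu => by
    simp [thetaBasis, div_self hu, theta_one hq]
  have e1 := h v hv
  have e2 := h u hu
  have e3 := h z hz
  rw [hself v hv, mul_zero, add_zero] at e1
  rw [hself u hu, mul_zero, add_zero] at e2
  -- Without g, the values at v and u would kill the two other coefficients.
  have hx : x ≠ 0 := by
    rintro rfl
    simp only [zero_mul, zero_add, mul_eq_zero, huv, hvu, or_false] at e1 e2
    simp [e1, e2] at h0
  have e1' : y = -(x * g v / thetaBasis q u v) := by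
    field_simp
    linear_combination e1
  have e2' : w = -(x * g u / thetaBasis q v u) := by
    field_simp
    linear_combination e2
  refine mul_left_cancel₀ hx ?_
  rw [e1', e2'] at e3
  linear_combination e3

end ThetaForms

/-! ### Expansion of antisymmetrized theta products. -/

section Expansion

variable {q : ℂ}

/-- The antisymmetrization of `z⁻² ∏_j θ(l_j z)`. -/
noncomputable def antisymTheta (q : ℂ) (l : Fin 6 → ℂ) (z : ℂ) : ℂ :=
  (z ^ 2)⁻¹ * ∏ j, theta q (l j * z) - z ^ 2 * ∏ j, theta q (l j / z)

lemma ne_zero_of_prod_eq (hq0 : q ≠ 0) {l : Fin 6 → ℂ} (hl : ∏ j, l j = q) (j : Fin 6) :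
    l j ≠ 0 :=
  Finset.prod_ne_zero_iff.1 (hl ▸ hq0) j (Finset.mem_univ j)

lemma prod_six (f : Fin 6 → ℂ) :
    ∏ j, f j = f 0 * f 1 * ∏ j ∈ ({2, 3, 4, 5} : Finset (Fin 6)), f j := by
  simp [Fin.prod_univ_six]
  ring

lemma differentiableAt_prod_theta_mul (hq : ‖q‖ < 1) {l : Fin 6 → ℂ} (hl : ∀ j, l j ≠ 0) {z : ℂ}
    (hz : z ≠ 0) : DifferentiableAt ℂ (fun z => ∏ j, theta q (l j * z)) z :=
  DifferentiableAt.fun_finsetProd fun j _ => differentiableAt_theta_mul hq (hl j) hz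

lemma differentiableAt_prod_theta_div (hq : ‖q‖ < 1) {l : Fin 6 → ℂ} (hl : ∀ j, l j ≠ 0) {z : ℂ}
    (hz : z ≠ 0) : DifferentiableAt ℂ (fun z => ∏ j, theta q (l j / z)) z :=
  DifferentiableAt.fun_finsetProd fun j _ => differentiableAt_theta_div hq (hl j) hz

/-- The condition ∏ l_j = q gives both halves of the antisymmetrization the same quasi-period
factor. -/
lemma thetaForm_antisymTheta (hq0 : q ≠ 0) (hq : ‖q‖ < 1) {l : Fin 6 → ℂ} (hl : ∏ j, l j = q) :
    ThetaForm q (antisymTheta q l) where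
  differentiableAt z hz := by
    have h0 := ne_zero_of_prod_eq hq0 hl
    exact (((differentiableAt_id.pow 2).inv (pow_ne_zero 2 hz)).mul
      (differentiableAt_prod_theta_mul hq h0 hz)).sub
      ((differentiableAt_id.pow 2).mul (differentiableAt_prod_theta_div hq h0 hz))
  q_mul z hz := by
    have h0 := ne_zero_of_prod_eq hq0 hl
    have e1 : ∏ j, theta q (l j * (q * z)) = (q * z ^ 6)⁻¹ * ∏ j, theta q (l j * z) := by
      have : ∏ j, (-(l j * z)) = q * z ^ 6 := by
        simp only [Fin.prod_univ_six] at hl ⊢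
        linear_combination z ^ 6 * hl
      rw [← this, ← Finset.prod_inv_distrib, ← Finset.prod_mul_distrib]
      refine Finset.prod_congr rfl fun j _ => ?_
      rw [show l j * (q * z) = q * (l j * z) by ring, theta_q_mul hq0 hq (mul_ne_zero (h0 j) hz),
        inv_neg]
    have e2 : ∏ j, theta q (l j / (q * z)) = (q ^ 5 * z ^ 6)⁻¹ * ∏ j, theta q (l j / z) := by
      have : ∏ j, (-(l j / (q * z))) = (q ^ 5 * z ^ 6)⁻¹ := by
        have h1 : ∏ j, (-(l j / (q * z))) = (∏ j, l j) / (q * z) ^ 6 := by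
          simp only [Fin.prod_univ_six]
          ring
        rw [h1, hl]
        field_simp
      rw [← this, ← Finset.prod_mul_distrib]
      exact Finset.prod_congr rfl fun j _ => theta_div_q_mul hq0 hq (h0 j) hz
    rw [antisymTheta, antisymTheta, e1, e2]
    field_simp
  inv z hz := by
    rw [antisymTheta, antisymTheta]
    simp only [← div_eq_mul_inv, div_inv_eq_mul, inv_pow, inv_inv]
    ring

/-- The expansion of an antisymmetrized theta product, when the nodes are in general position. -/
lemma antisymTheta_eq_of_ne (hq0 : q ≠ 0) (hq : ‖q‖ < 1) {l : Fin 6 → ℂ} (hl : ∏ j, l j = q)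
    (h0 : theta q (l 0 ^ 2) ≠ 0) (h1 : theta q (l 1 ^ 2) ≠ 0) (h01 : theta q (l 0 / l 1) ≠ 0)
    (h10 : theta q (l 1 / l 0) ≠ 0) (hm : theta q (l 0 * l 1) ≠ 0) {z : ℂ} (hz : z ≠ 0) :
    antisymTheta q l z =
      (l 1)⁻¹ * (∏ j ∈ ({2, 3, 4, 5} : Finset (Fin 6)), theta q (l j * l 1)) / theta q (l 0 / l 1) *
        thetaBasis q (l 0) z +
      (l 0)⁻¹ * (∏ j ∈ ({2, 3, 4, 5} : Finset (Fin 6)), theta q (l j * l 0)) / theta q (l 1 / l 0) *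
        thetaBasis q (l 1) z := by
  have hn := ne_zero_of_prod_eq hq0 hl
  have n0 := hn 0
  have n1 := hn 1
  -- At a node the second product contains θ(1) = 0, so only the first survives.
  have hv : ∀ i, antisymTheta q l (l i) = (l i ^ 2)⁻¹ * ∏ j, theta q (l j * l i) := fun i => by
    have h : ∏ j, theta q (l j / l i) = 0 := Finset.prod_eq_zero (Finset.mem_univ i)
      (by rw [div_self (hn i), theta_one hq])
    rw [antisymTheta, h, mul_zero, sub_zero]
  have b1 : thetaBasis q (l 0) (l 1) ≠ 0 := by
    simp [thetaBasis, n1, h1, hm, h01]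
  have b0 : thetaBasis q (l 1) (l 0) ≠ 0 := by
    simp [thetaBasis, n0, h0, h10, mul_comm (l 1), hm]
  rw [(thetaForm_antisymTheta hq0 hq hl).eq_interpolation hq0 hq n0 n1 b1 b0 hz, hv, hv, prod_six,
    prod_six]
  congr 2
  · rw [thetaBasis, ← sq]
    generalize theta q (l 0 * l 1) = X at *
    field_simp
  · rw [mul_comm] at hm
    rw [thetaBasis, ← sq]
    generalize theta q (l 1 * l 0) = X at *
    field_simp

lemma eventually_theta_ne_zero (hq : ‖q‖ < 1) : ∀ᶠ t in 𝓝[≠] (1 : ℂ), theta q t ≠ 0 := by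
  have h1 : ContinuousAt (fun t : ℂ => qInf q (t * q) * qInf q (q / t)) 1 :=
    (((continuous_qInf hq).comp (by fun_prop : Continuous fun t : ℂ => t * q)).continuousAt).mul
      (differentiableAt_qInf_div hq q one_ne_zero).continuousAt
  have h2 : ∀ᶠ t in 𝓝 (1 : ℂ), qInf q (t * q) * qInf q (q / t) ≠ 0 :=
    h1.eventually_ne (by simpa using qInf_self_ne_zero hq)
  filter_upwards [h2.filter_mono nhdsWithin_le_nhds, self_mem_nhdsWithin] with t ht ht1
  rw [theta, qInf_eq hq, mul_assoc]
  exact mul_ne_zero (sub_ne_zero.2 (Ne.symm ht1)) ht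

lemma continuousAt_theta_comp {X : Type*} [TopologicalSpace X] (hq : ‖q‖ < 1) {φ : X → ℂ} {x : X}
    (hφ : ContinuousAt φ x) (h0 : φ x ≠ 0) : ContinuousAt (fun y => theta q (φ y)) x :=
  ContinuousAt.comp (f := φ) (differentiableAt_theta hq h0).continuousAt hφ

/-- Genericity of λ allows λ_1 λ_2 to be a power of q, where the interpolation nodes degenerate.
Neither side is singular there, so this case follows by continuity. -/
lemma antisymTheta_eq (hq0 : q ≠ 0) (hq : ‖q‖ < 1) {l : Fin 6 → ℂ} (hl : ∏ j, l j = q)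
    (h0 : theta q (l 0 ^ 2) ≠ 0) (h1 : theta q (l 1 ^ 2) ≠ 0) (h01 : theta q (l 0 / l 1) ≠ 0)
    (h10 : theta q (l 1 / l 0) ≠ 0) {z : ℂ} (hz : z ≠ 0) :
    antisymTheta q l z =
      (l 1)⁻¹ * (∏ j ∈ ({2, 3, 4, 5} : Finset (Fin 6)), theta q (l j * l 1)) / theta q (l 0 / l 1) *
        thetaBasis q (l 0) z +
      (l 0)⁻¹ * (∏ j ∈ ({2, 3, 4, 5} : Finset (Fin 6)), theta q (l j * l 0)) / theta q (l 1 / l 0) *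
        thetaBasis q (l 1) z := by
  by_cases hm : theta q (l 0 * l 1) ≠ 0
  · exact antisymTheta_eq_of_ne hq0 hq hl h0 h1 h01 h10 hm hz
  have hn := ne_zero_of_prod_eq hq0 hl
  rw [not_not, theta_eq_zero_iff hq0 hq (mul_ne_zero (hn 0) (hn 1))] at hm
  obtain ⟨n, hm⟩ := hm
  -- The perturbation preserves the product q and turns l_0 l_1 = q^n into q^n t. Its theta value is
  -- a nonzero multiple of θ(t), hence nonzero for t near 1, t ≠ 1.
  let L : ℂ → Fin 6 → ℂ := fun t => ![l 0 * t, l 1, l 2 / t, l 3, l 4, l 5]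
  have hL1 : L 1 = l := by
    funext j
    fin_cases j <;> simp [L]
  have hLc : ∀ j, ContinuousAt (fun t => L t j) 1 := fun j => by
    have : ContinuousAt (fun t : ℂ => l 2 / t) 1 := continuousAt_const.div continuousAt_id one_ne_zero
    fin_cases j <;> simp [L] <;> first | exact this | fun_prop
  have hL0 : ∀ j, L 1 j ≠ 0 := hL1 ▸ hn
  have c0 : ContinuousAt (fun t => theta q (L t 0 ^ 2)) 1 :=
    continuousAt_theta_comp hq ((hLc 0).pow 2) (pow_ne_zero 2 (hL0 0))
  have c1 : ContinuousAt (fun t => theta q (L t 1 ^ 2)) 1 :=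
    continuousAt_theta_comp hq ((hLc 1).pow 2) (pow_ne_zero 2 (hL0 1))
  have c01 : ContinuousAt (fun t => theta q (L t 0 / L t 1)) 1 :=
    continuousAt_theta_comp hq ((hLc 0).div (hLc 1) (hL0 1)) (div_ne_zero (hL0 0) (hL0 1))
  have c10 : ContinuousAt (fun t => theta q (L t 1 / L t 0)) 1 :=
    continuousAt_theta_comp hq ((hLc 1).div (hLc 0) (hL0 0)) (div_ne_zero (hL0 1) (hL0 0))
  have cm : ∀ {w : ℂ}, w ≠ 0 → ∀ j, ContinuousAt (fun t => theta q (L t j * w)) 1 := fun hw j =>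
    continuousAt_theta_comp hq ((hLc j).mul continuousAt_const) (mul_ne_zero (hL0 j) hw)
  have cd : ∀ {w : ℂ}, w ≠ 0 → ∀ j, ContinuousAt (fun t => theta q (L t j / w)) 1 := fun hw j =>
    continuousAt_theta_comp hq ((hLc j).div continuousAt_const hw) (div_ne_zero (hL0 j) hw)
  have cp : ∀ i j, ContinuousAt (fun t => theta q (L t j * L t i)) 1 := fun i j =>
    continuousAt_theta_comp hq ((hLc j).mul (hLc i)) (mul_ne_zero (hL0 j) (hL0 i))
  have cB : ∀ i, ContinuousAt (fun t => thetaBasis q (L t i) z) 1 := fun i =>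
    continuousAt_const.mul ((cm hz i).mul (cd hz i))
  have hlhs : ContinuousAt (fun t => antisymTheta q (L t) z) 1 :=
    (continuousAt_const.mul (tendsto_finsetProd _ fun j _ => cm hz j)).sub
      (continuousAt_const.mul (tendsto_finsetProd _ fun j _ => cd hz j))
  have hrhs : ContinuousAt (fun t =>
      (L t 1)⁻¹ * (∏ j ∈ ({2, 3, 4, 5} : Finset (Fin 6)), theta q (L t j * L t 1)) /
        theta q (L t 0 / L t 1) * thetaBasis q (L t 0) z +
      (L t 0)⁻¹ * (∏ j ∈ ({2, 3, 4, 5} : Finset (Fin 6)), theta q (L t j * L t 0)) /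
        theta q (L t 1 / L t 0) * thetaBasis q (L t 1) z) 1 :=
    (((((hLc 1).inv₀ (hL0 1)).mul (tendsto_finsetProd _ fun j _ => cp 1 j)).div c01
      (by rwa [hL1])).mul (cB 0)).add
    (((((hLc 0).inv₀ (hL0 0)).mul (tendsto_finsetProd _ fun j _ => cp 0 j)).div c10
      (by rwa [hL1])).mul (cB 1))
  have hev : ∀ᶠ t in 𝓝[≠] (1 : ℂ), antisymTheta q (L t) z =
      (L t 1)⁻¹ * (∏ j ∈ ({2, 3, 4, 5} : Finset (Fin 6)), theta q (L t j * L t 1)) /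
        theta q (L t 0 / L t 1) * thetaBasis q (L t 0) z +
      (L t 0)⁻¹ * (∏ j ∈ ({2, 3, 4, 5} : Finset (Fin 6)), theta q (L t j * L t 0)) /
        theta q (L t 1 / L t 0) * thetaBasis q (L t 1) z := by
    filter_upwards [eventually_theta_ne_zero hq,
      (c0.eventually_ne (by rwa [hL1])).filter_mono nhdsWithin_le_nhds,
      (c1.eventually_ne (by rwa [hL1])).filter_mono nhdsWithin_le_nhds,
      (c01.eventually_ne (by rwa [hL1])).filter_mono nhdsWithin_le_nhds,
      (c10.eventually_ne (by rwa [hL1])).filter_mono nhdsWithin_le_nhds,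
      (eventually_ne_nhds (one_ne_zero : (1 : ℂ) ≠ 0)).filter_mono nhdsWithin_le_nhds]
      with t ht k0 k1 k01 k10 ht0
    refine antisymTheta_eq_of_ne hq0 hq ?_ k0 k1 k01 k10 ?_ hz
    · simp only [Fin.prod_univ_six, L] at hl ⊢
      simp
      rw [← hl]
      field_simp
    · have e : L t 0 * L t 1 = q ^ n * t := by
        rw [← hm]
        simp [L]
        ring
      rw [e, theta_zpow_mul hq0 hq ht0]
      refine mul_ne_zero (mul_ne_zero (mul_ne_zero ?_ (inv_ne_zero (zpow_ne_zero _ hq0)))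
        (zpow_ne_zero _ ht0)) ht
      exact zpow_ne_zero _ (by norm_num)
  have := tendsto_nhds_unique_of_eventuallyEq (hlhs.tendsto.mono_left nhdsWithin_le_nhds)
    (hrhs.tendsto.mono_left nhdsWithin_le_nhds) hev
  simpa only [hL1] using this

end Expansion

/-! ### Pairing with the symmetric weight. -/

section Pairing

variable {q : ℂ}

/-- The integral of a function against the symmetric weight. -/
noncomputable def pairing (q : ℂ) (b : Fin 6 → ℂ) (h : ℂ → ℂ) (g g' : ℝ → ℂ) : ℂ :=
  loopInt (fun z => (z - z⁻¹) * h z * kernel q b b z * z⁻¹) g g'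

lemma Admissible.simplePoles_kernel_mul (hq0 : q ≠ 0) (hq : ‖q‖ < 1) {b : Fin 6 → ℂ}
    (hb : Admissible q b) {h : ℂ → ℂ} (hh : ∀ z ≠ 0, DifferentiableAt ℂ h z) :
    SimplePoles (fun z => (z - z⁻¹) * h z * kernel q b b z * z⁻¹)
      ((⋃ j, outSet q (b j)) ∪ ⋃ j, inSet q (b j)) := by
  have hk := hb.simplePoles_kernel hq0 hq 0
  simp only [Pi.zero_apply, zpow_zero, mul_one] at hk
  refine (hk.mul_differentiable (G := fun z => (z - z⁻¹) * h z * z⁻¹) fun z hz => ?_).congr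
    fun z _ _ => by ring
  exact ((differentiableAt_id.sub (differentiableAt_inv hz)).mul (hh z hz)).mul
    (differentiableAt_inv hz)

lemma pairing_linearComb (hq0 : q ≠ 0) (hq : ‖q‖ < 1) {b : Fin 6 → ℂ} (hb : Admissible q b)
    {g g' : ℝ → ℂ} (hg : Separates q b g g') {h h₁ h₂ : ℂ → ℂ} {a₁ a₂ : ℂ}
    (hh₁ : ∀ z ≠ 0, DifferentiableAt ℂ h₁ z) (hh₂ : ∀ z ≠ 0, DifferentiableAt ℂ h₂ z)
    (hh : ∀ z ≠ 0, h z = a₁ * h₁ z + a₂ * h₂ z) :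
    pairing q b h g g' = a₁ * pairing q b h₁ g g' + a₂ * pairing q b h₂ g g' := by
  have c : ∀ {h : ℂ → ℂ}, (∀ z ≠ 0, DifferentiableAt ℂ h z) → ∀ a : ℂ, ContinuousOn
      (fun t => a * ((g t - (g t)⁻¹) * h (g t) * kernel q b b (g t) * (g t)⁻¹)) (Icc 0 1) :=
    fun hh a => continuousOn_const.mul ((hb.simplePoles_kernel_mul hq0 hq hh).continuousOn_comp
      hg.isLoop.cont hg.ne_zero fun t ht => hg.notMem ht)
  simp only [pairing, ← loopInt_const_mul]
  rw [← hg.isLoop.loopInt_add (c hh₁ a₁) (c hh₂ a₂)]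
  exact loopInt_congr fun t ht => by rw [hh _ (hg.ne_zero t ht)]; ring

lemma kernel_inv {ι : Type*} [Fintype ι] (b : ι → ℂ) (z : ℂ) :
    kernel q b b z⁻¹ = kernel q b b z :=
  Finset.prod_congr rfl fun j _ => by rw [div_inv_eq_mul, ← div_eq_mul_inv, mul_comm (qInf q _)]

/-- Under z ↦ 1/z the kernel is invariant and z - z⁻¹ changes sign, while the inverted, reversed
curve is again separating. Thus only the antisymmetric part of h contributes. -/
lemma pairing_eq_neg_inv (hq0 : q ≠ 0) (hq : ‖q‖ < 1) {b : Fin 6 → ℂ} (hb : Admissible q b)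
    {g g' : ℝ → ℂ} (hg : Separates q b g g') {h : ℂ → ℂ}
    (hh : ∀ z ≠ 0, DifferentiableAt ℂ h z) :
    pairing q b h g g' = pairing q b (fun z => -h z⁻¹) g g' := by
  rw [pairing, (hb.simplePoles_kernel_mul hq0 hq hh).loopInt_eq_of_separates hq hg
    (hg.inv_symm hq0 hq hb.ne_zero), loopInt_inv_symm]
  refine loopInt_congr fun t ht => ?_
  have := hg.ne_zero t ht
  simp only [kernel_inv, inv_inv]
  field_simp
  ring

lemma kernel_succAbove {b : Fin 6 → ℂ} (m : Fin 6) (z : ℂ) :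
    kernel q b b z = (qInf q (b m * z) * qInf q (b m / z))⁻¹ *
      kernel q (fun j => b (m.succAbove j)) (fun j => b (m.succAbove j)) z := by
  rw [kernel, Fin.prod_univ_succAbove _ m]
  rfl

/-- The pairing with `thetaBasis q (b m)` is a Nassrallah–Rahman integral. -/
lemma pairing_thetaBasis_param (hq0 : q ≠ 0) (hq : ‖q‖ < 1) {b : Fin 6 → ℂ} (hb : Admissible q b)
    (hbq : ∏ j, b j = q) {g g' : ℝ → ℂ} (hg : Separates q b g g') (m : Fin 6) :
    pairing q b (thetaBasis q (b m)) g g' * (pairs q (fun j => b (m.succAbove j)) *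
      ∏ j, qInf q (b m * b (m.succAbove j))) =
    2 * Real.pi * Complex.I * (2 / qInf q q) * ∏ j, theta q (b m * b (m.succAbove j)) := by
  set c : Fin 5 → ℂ := fun j => b (m.succAbove j) with hc
  -- This value makes the factors (q/(b_m z))_∞ (q z/b_m)_∞ of the theta functions the numerator of
  -- the five-parameter integrand, while their factors (b_m z^±)_∞ cancel against the kernel.
  have hA : ∏ j, c j = q / b m := by
    rw [Fin.prod_univ_succAbove _ m] at hbq
    exact eq_div_of_mul_eq (hb.ne_zero m) (by rw [mul_comm]; exact hbq)
  have e : pairing q b (thetaBasis q (b m)) g g' = loopInt (nrWeight q c) g g' := by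
    refine loopInt_congr fun t ht => ?_
    have hz := hg.ne_zero t ht
    have hbm := hb.ne_zero m
    have h1 : qInf q (b m * g t) ≠ 0 := qInf_ne_zero hq fun k hk =>
      hg.avoid_inv m k t ht (eq_inv_of_mul_eq_one_right (by rw [← hk]; ring))
    have h2 : qInf q (b m / g t) ≠ 0 := qInf_ne_zero hq fun k hk =>
      hg.avoid m k t ht (by field_simp at hk; exact hk.symm)
    rw [kernel_succAbove m, nrWeight, hA, thetaBasis, ← hc,
      show theta q (b m * g t) = qInf q (b m * g t) * qInf q (q / (b m * g t)) from rfl,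
      show theta q (b m / g t) = qInf q (b m / g t) * qInf q (q / (b m / g t)) from rfl,
      show q / b m * g t = q / (b m / g t) by field_simp,
      show q / b m / g t = q / (b m * g t) by field_simp]
    generalize qInf q (b m * g t) = X at *
    generalize qInf q (b m / g t) = Y at *
    field_simp
  have hN := loopInt_nrWeight hq0 hq (hb.comp (Fin.succAbove_right_injective (p := m)))
    (hg.mul_pow (d := c) fun j => ⟨m.succAbove j, 0, by simp [hc]⟩)
  have e2 : ∏ j, theta q (b m * c j) =
      (∏ j, qInf q (b m * c j)) * ∏ j, qInf q ((∏ j, c j) / c j) := by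
    rw [← Finset.prod_mul_distrib]
    exact Finset.prod_congr rfl fun j _ => by rw [theta, hA, div_div]
  rw [e, e2, ← mul_assoc]
  linear_combination (∏ j, qInf q (b m * c j)) * hN

lemma pairs_vec (a₀ a₁ a₂ a₃ a₄ : ℂ) : pairs q ![a₀, a₁, a₂, a₃, a₄] =
    qInf q (a₀ * a₁) * qInf q (a₀ * a₂) * qInf q (a₀ * a₃) * qInf q (a₀ * a₄) *
    (qInf q (a₁ * a₂) * qInf q (a₁ * a₃) * qInf q (a₁ * a₄)) *
    (qInf q (a₂ * a₃) * qInf q (a₂ * a₄)) * qInf q (a₃ * a₄) := by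
  have f0 : Finset.Ioi (0 : Fin 5) = {1, 2, 3, 4} := rfl
  have f1 : Finset.Ioi (1 : Fin 5) = {2, 3, 4} := rfl
  have f2 : Finset.Ioi (2 : Fin 5) = {3, 4} := rfl
  have f3 : Finset.Ioi (3 : Fin 5) = {4} := rfl
  have f4 : Finset.Ioi (4 : Fin 5) = ∅ := rfl
  simp [-mul_eq_mul_left_iff, -mul_eq_mul_right_iff, pairs, Fin.prod_univ_five, f0, f1, f2, f3, f4]
  ring

lemma pairProd_eq (F : Fin 6 → Fin 6 → ℂ) : pairProd F =
    F 0 1 * F 0 2 * F 0 3 * F 0 4 * F 0 5 * (F 1 2 * F 1 3 * F 1 4 * F 1 5) *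
    (F 2 3 * F 2 4 * F 2 5) * (F 3 4 * F 3 5) * F 4 5 := by
  have e0 : Finset.Ioi (0 : Fin 6) = {1, 2, 3, 4, 5} := rfl
  have e1 : Finset.Ioi (1 : Fin 6) = {2, 3, 4, 5} := rfl
  have e2 : Finset.Ioi (2 : Fin 6) = {3, 4, 5} := rfl
  have e3 : Finset.Ioi (3 : Fin 6) = {4, 5} := rfl
  have e4 : Finset.Ioi (4 : Fin 6) = {5} := rfl
  have e5 : Finset.Ioi (5 : Fin 6) = ∅ := rfl
  simp [-mul_eq_mul_left_iff, -mul_eq_mul_right_iff, pairProd, Fin.prod_univ_six, e0, e1, e2, e3, e4, e5]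
  ring

lemma succAbove_zero_vec (b : Fin 6 → ℂ) :
    (fun j => b (Fin.succAbove 0 j)) = ![b 1, b 2, b 3, b 4, b 5] := by
  funext j
  fin_cases j <;> rfl

lemma succAbove_one_vec (b : Fin 6 → ℂ) :
    (fun j => b (Fin.succAbove 1 j)) = ![b 0, b 2, b 3, b 4, b 5] := by
  funext j
  fin_cases j <;> rfl

lemma prod_succAbove_zero (b : Fin 6 → ℂ) (f : ℂ → ℂ) :
    ∏ j, f (b (Fin.succAbove 0 j)) = f (b 1) * f (b 2) * f (b 3) * f (b 4) * f (b 5) := by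
  refine (congrArg (fun c : Fin 5 → ℂ => ∏ j, f (c j)) (succAbove_zero_vec b)).trans ?_
  simp [Fin.prod_univ_five]

lemma prod_succAbove_one (b : Fin 6 → ℂ) (f : ℂ → ℂ) :
    ∏ j, f (b (Fin.succAbove 1 j)) = f (b 0) * f (b 2) * f (b 3) * f (b 4) * f (b 5) := by
  refine (congrArg (fun c : Fin 5 → ℂ => ∏ j, f (c j)) (succAbove_one_vec b)).trans ?_
  simp [Fin.prod_univ_five]

lemma pairProd_eq_zero_index (b : Fin 6 → ℂ) : pairProd (fun i j => qInf q (b i * b j)) =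
    pairs q (fun j => b (Fin.succAbove 0 j)) * ∏ j, qInf q (b 0 * b (Fin.succAbove 0 j)) := by
  rw [pairProd_eq, prod_succAbove_zero b fun x => qInf q (b 0 * x), succAbove_zero_vec, pairs_vec]
  ring

lemma pairProd_eq_one_index (b : Fin 6 → ℂ) : pairProd (fun i j => qInf q (b i * b j)) =
    pairs q (fun j => b (Fin.succAbove 1 j)) * ∏ j, qInf q (b 1 * b (Fin.succAbove 1 j)) := by
  rw [pairProd_eq, prod_succAbove_one b fun x => qInf q (b 1 * x), succAbove_one_vec, pairs_vec,
    mul_comm (b 1) (b 0)]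
  ring

end Pairing

/-! ### Evaluation of the integral of the weight. -/

section Evaluation

variable {q : ℂ}

lemma theta_div_comm (hq0 : q ≠ 0) (hq : ‖q‖ < 1) {x y : ℂ} (hx : x ≠ 0) (hy : y ≠ 0) :
    theta q (x / y) = -(x / y) * theta q (y / x) := by
  rw [← inv_div y x, theta_inv hq0 hq (div_ne_zero hy hx)]

/-- Puts the result into the form of the braces in C; the inversion factors -(b_j/a) multiply to
q/a⁶. -/
lemma sq_mul_antisymTheta (hq0 : q ≠ 0) (hq : ‖q‖ < 1) {b : Fin 6 → ℂ} (hb : ∏ j, b j = q) {a : ℂ}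
    (ha : a ≠ 0) : a ^ 2 * antisymTheta q b a =
      ∏ j, theta q (a * b j) - q / a ^ 2 * ∏ j, theta q (a / b j) := by
  have h0 := ne_zero_of_prod_eq hq0 hb
  have e : ∏ j, theta q (b j / a) = q / a ^ 6 * ∏ j, theta q (a / b j) := by
    have h1 : ∏ j, (-(b j / a)) = q / a ^ 6 := by
      rw [← hb]
      simp only [Fin.prod_univ_six]
      ring
    rw [← h1, ← Finset.prod_mul_distrib]
    exact Finset.prod_congr rfl fun j _ => theta_div_comm hq0 hq (h0 j) ha
  rw [antisymTheta, e]
  simp only [mul_comm a]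
  field_simp

/-- Interpolation at the nodes b_0 and b_1 reduces to the two Nassrallah–Rahman values. The
resulting sum is the expansion of `antisymTheta q b` at a. -/
lemma pairing_thetaBasis (hq0 : q ≠ 0) (hq : ‖q‖ < 1) {b : Fin 6 → ℂ} (hb : Admissible q b)
    (hbq : ∏ j, b j = q) {g g' : ℝ → ℂ} (hg : Separates q b g g') {a : ℂ} (ha : a ≠ 0) :
    theta q (a ^ 2) * pairing q b (thetaBasis q a) g g' *
      (qInf q q * pairProd fun i j => qInf q (b i * b j)) =
    2 * Real.pi * Complex.I * (2 * (a ^ 2 * antisymTheta q b a)) := by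
  have n0 := hb.ne_zero 0
  have n1 := hb.ne_zero 1
  have t0 : theta q (b 0 ^ 2) ≠ 0 := theta_ne_zero hq0 hq (pow_ne_zero 2 n0) fun n => by
    rw [sq]; exact hb.mul_ne 0 0 n
  have t1 : theta q (b 1 ^ 2) ≠ 0 := theta_ne_zero hq0 hq (pow_ne_zero 2 n1) fun n => by
    rw [sq]; exact hb.mul_ne 1 1 n
  have t01 : theta q (b 0 / b 1) ≠ 0 :=
    theta_ne_zero hq0 hq (div_ne_zero n0 n1) (hb.div_ne 0 1 (by decide))
  have t10 : theta q (b 1 / b 0) ≠ 0 :=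
    theta_ne_zero hq0 hq (div_ne_zero n1 n0) (hb.div_ne 1 0 (by decide))
  have tm : theta q (b 0 * b 1) ≠ 0 :=
    theta_ne_zero hq0 hq (mul_ne_zero n0 n1) (hb.mul_ne 0 1)
  have q0 := qInf_self_ne_zero hq
  have b1 : thetaBasis q (b 0) (b 1) ≠ 0 := by simp [thetaBasis, n1, t1, tm, t01]
  have b0 : thetaBasis q (b 1) (b 0) ≠ 0 := by
    simp [thetaBasis, n0, t0, t10, mul_comm (b 1) (b 0), tm]
  have hT := pairing_linearComb hq0 hq hb hg
    (thetaForm_thetaBasis hq0 hq n0).differentiableAt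
    (thetaForm_thetaBasis hq0 hq n1).differentiableAt
    fun z hz => (thetaForm_thetaBasis hq0 hq ha).eq_interpolation hq0 hq n0 n1 b1 b0 hz
  have hA := antisymTheta_eq hq0 hq hbq t0 t1 t01 t10 ha
  have hN0 := pairing_thetaBasis_param hq0 hq hb hbq hg 0
  have hN1 := pairing_thetaBasis_param hq0 hq hb hbq hg 1
  rw [← pairProd_eq_zero_index, prod_succAbove_zero b fun x => theta q (b 0 * x)] at hN0
  rw [← pairProd_eq_one_index, prod_succAbove_one b fun x => theta q (b 1 * x)] at hN1
  -- Up to theta values of squares and powers, the basis form is antisymmetric in node and variable.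
  -- This converts values at b_0, b_1 of the form with node a into values at a of the forms with
  -- nodes b_0, b_1.
  have hswap : ∀ v, v ≠ 0 → theta q (a ^ 2) * thetaBasis q a v * v ^ 2 =
      -(a ^ 2 * theta q (v ^ 2) * thetaBasis q v a) := fun v hv => by
    rw [thetaBasis, thetaBasis, theta_div_comm hq0 hq hv ha, mul_comm v a]
    field_simp
  have hs0 := hswap _ n0
  have hs1 := hswap _ n1
  have hp : ∀ i, ∏ j ∈ ({2, 3, 4, 5} : Finset (Fin 6)), theta q (b j * b i) =
      theta q (b i * b 2) * theta q (b i * b 3) * theta q (b i * b 4) * theta q (b i * b 5) :=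
    fun i => by
      simp [mul_comm (b i)]
      ring
  rw [hp, hp] at hA
  set P := pairProd fun i j => qInf q (b i * b j)
  set X0 := theta q (b 0 * b 2) * theta q (b 0 * b 3) * theta q (b 0 * b 4) * theta q (b 0 * b 5)
    with hX0
  set X1 := theta q (b 1 * b 2) * theta q (b 1 * b 3) * theta q (b 1 * b 4) * theta q (b 1 * b 5)
    with hX1
  have hN0' : pairing q b (thetaBasis q (b 0)) g g' * (qInf q q * P) =
      2 * Real.pi * Complex.I * (2 * (theta q (b 0 * b 1) * X0)) := by
    rw [mul_comm (qInf q q), ← mul_assoc, hN0, hX0]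
    field_simp
  have hN1' : pairing q b (thetaBasis q (b 1)) g g' * (qInf q q * P) =
      2 * Real.pi * Complex.I * (2 * (theta q (b 0 * b 1) * X1)) := by
    rw [mul_comm (qInf q q), ← mul_assoc, hN1, hX1, mul_comm (b 1) (b 0)]
    field_simp
  have v0 : thetaBasis q (b 1) (b 0) =
      (b 0)⁻¹ * theta q (b 0 ^ 2) * (theta q (b 0 * b 1) * theta q (b 1 / b 0)) := by
    rw [thetaBasis, mul_comm (b 1) (b 0)]
  have v1 : thetaBasis q (b 0) (b 1) =
      (b 1)⁻¹ * theta q (b 1 ^ 2) * (theta q (b 0 * b 1) * theta q (b 0 / b 1)) := rfl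
  have w0 : theta q (a ^ 2) * (thetaBasis q a (b 0) / thetaBasis q (b 1) (b 0)) =
      -(a ^ 2 * thetaBasis q (b 0) a) / (b 0 * theta q (b 0 * b 1) * theta q (b 1 / b 0)) := by
    rw [v0]
    have : theta q (a ^ 2) * thetaBasis q a (b 0) =
      -(a ^ 2 * theta q (b 0 ^ 2) * thetaBasis q (b 0) a) / b 0 ^ 2 := by
      rw [← hs0]; field_simp
    rw [← mul_div_assoc, this]
    generalize theta q (b 1 / b 0) = Y at *
    generalize theta q (b 0 * b 1) = Z at *
    field_simp
  have w1 : theta q (a ^ 2) * (thetaBasis q a (b 1) / thetaBasis q (b 0) (b 1)) =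
      -(a ^ 2 * thetaBasis q (b 1) a) / (b 1 * theta q (b 0 * b 1) * theta q (b 0 / b 1)) := by
    rw [v1]
    have : theta q (a ^ 2) * thetaBasis q a (b 1) =
      -(a ^ 2 * theta q (b 1 ^ 2) * thetaBasis q (b 1) a) / b 1 ^ 2 := by
      rw [← hs1]; field_simp
    rw [← mul_div_assoc, this]
    generalize theta q (b 0 / b 1) = Y at *
    generalize theta q (b 0 * b 1) = Z at *
    field_simp
  have hsw : theta q (b 1 / b 0) = -(b 1 / b 0) * theta q (b 0 / b 1) := theta_div_comm hq0 hq n1 n0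
  rw [hT, mul_add, add_mul]
  calc _ = theta q (a ^ 2) * (thetaBasis q a (b 1) / thetaBasis q (b 0) (b 1)) *
          (pairing q b (thetaBasis q (b 0)) g g' * (qInf q q * P)) +
        theta q (a ^ 2) * (thetaBasis q a (b 0) / thetaBasis q (b 1) (b 0)) *
          (pairing q b (thetaBasis q (b 1)) g g' * (qInf q q * P)) := by ring
    _ = _ := by
      rw [hN0', hN1', w0, w1, hA, hsw]
      generalize theta q (b 0 / b 1) = Y at *
      generalize theta q (b 0 * b 1) = Z at *
      field_simp
      ring

/-- The contour integral of the weight function. -/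
theorem loopInt_weight (hq0 : q ≠ 0) (hq : ‖q‖ < 1) {b : Fin 6 → ℂ} (hb : Admissible q b)
    (hbq : ∏ j, b j = q) {g g' : ℝ → ℂ} (hg : Separates q b g g') {l : Fin 6 → ℂ}
    (hl : ∏ j, l j = q) (h0 : ∀ n : ℤ, l 0 ^ 2 ≠ q ^ n) (h1 : ∀ n : ℤ, l 1 ^ 2 ≠ q ^ n)
    (h01 : ∀ n : ℤ, l 0 / l 1 ≠ q ^ n) :
    loopInt (fun z => weight q b l z * (2 * Real.pi * Complex.I * z)⁻¹) g g' = const q b l := by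
  have hn := ne_zero_of_prod_eq hq0 hl
  have n0 := hn 0
  have n1 := hn 1
  have t0 := theta_ne_zero hq0 hq (pow_ne_zero 2 n0) h0
  have t1 := theta_ne_zero hq0 hq (pow_ne_zero 2 n1) h1
  have t01 := theta_ne_zero hq0 hq (div_ne_zero n0 n1) h01
  have t10 : theta q (l 1 / l 0) ≠ 0 := by
    rw [theta_div_comm hq0 hq n1 n0]
    exact mul_ne_zero (neg_ne_zero.2 (div_ne_zero n1 n0)) t01
  set h : ℂ → ℂ := fun z => (z ^ 2)⁻¹ * ∏ j, theta q (l j * z) with hh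
  have hd : ∀ z ≠ 0, DifferentiableAt ℂ h z := fun z hz =>
    ((differentiableAt_id.pow 2).inv (pow_ne_zero 2 hz)).mul
      (differentiableAt_prod_theta_mul hq hn hz)
  have hd' : ∀ z ≠ 0, DifferentiableAt ℂ (fun z => -h z⁻¹) z := fun z hz =>
    ((DifferentiableAt.comp z (hd _ (inv_ne_zero hz)) (differentiableAt_inv hz)) :
      DifferentiableAt ℂ (fun z => h z⁻¹) z).neg
  have e1 : loopInt (fun z => weight q b l z * (2 * Real.pi * Complex.I * z)⁻¹) g g' =
      (2 * Real.pi * Complex.I)⁻¹ * pairing q b h g g' := by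
    rw [pairing, ← loopInt_const_mul]
    refine loopInt_congr fun t _ => ?_
    simp only [weight, hh, kernel, div_eq_mul_inv, Finset.prod_mul_distrib, mul_inv]
    ring
  -- The antisymmetrization is h(z) - h(1/z), and both summands have the same pairing, so it pairs
  -- to twice the desired integral.
  have e2 := pairing_linearComb hq0 hq hb hg (a₁ := 1) (a₂ := 1) hd hd'
    (h := antisymTheta q l) fun z hz => by
      simp only [hh, antisymTheta, ← div_eq_mul_inv, inv_pow, inv_inv]
      ring
  rw [← pairing_eq_neg_inv hq0 hq hb hg hd] at e2
  have e3 := pairing_linearComb hq0 hq hb hg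
    (thetaForm_thetaBasis hq0 hq n0).differentiableAt
    (thetaForm_thetaBasis hq0 hq n1).differentiableAt
    fun z hz => antisymTheta_eq hq0 hq hl t0 t1 t01 t10 hz
  have hN0 := pairing_thetaBasis hq0 hq hb hbq hg n0
  have hN1 := pairing_thetaBasis hq0 hq hb hbq hg n1
  rw [sq_mul_antisymTheta hq0 hq hbq n0] at hN0
  rw [sq_mul_antisymTheta hq0 hq hbq n1] at hN1
  have hP : pairProd (fun i j => qInf q (b i * b j)) ≠ 0 :=
    Finset.prod_ne_zero_iff.2 fun i _ => Finset.prod_ne_zero_iff.2 fun j _ =>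
      qInf_ne_zero_of_zpow hq (hb.mul_ne i j)
  have hq1 := qInf_self_ne_zero hq
  have hpi := Complex.two_pi_I_ne_zero
  rw [e1, const, constTerm, constTerm]
  generalize pairProd (fun i j => qInf q (b i * b j)) = P at *
  generalize ∏ j, theta q (l 0 * b j) - q / l 0 ^ 2 * ∏ j, theta q (l 0 / b j) = A0 at *
  generalize ∏ j, theta q (l 1 * b j) - q / l 1 ^ 2 * ∏ j, theta q (l 1 / b j) = A1 at *
  generalize ∏ j ∈ ({2, 3, 4, 5} : Finset (Fin 6)), theta q (l j * l 1) = X1 at *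
  generalize ∏ j ∈ ({2, 3, 4, 5} : Finset (Fin 6)), theta q (l j * l 0) = X0 at *
  have e0 : pairing q b h g g' = (1 / 2) * ((l 1)⁻¹ * X1 / theta q (l 0 / l 1) *
      pairing q b (thetaBasis q (l 0)) g g' + (l 0)⁻¹ * X0 / theta q (l 1 / l 0) *
      pairing q b (thetaBasis q (l 1)) g g') := by
    rw [← e3, e2]
    ring
  have k0 : pairing q b (thetaBasis q (l 0)) g g' =
      2 * Real.pi * Complex.I * (2 * A0) / (theta q (l 0 ^ 2) * (qInf q q * P)) := by
    rw [← hN0]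
    field_simp
  have k1 : pairing q b (thetaBasis q (l 1)) g g' =
      2 * Real.pi * Complex.I * (2 * A1) / (theta q (l 1 ^ 2) * (qInf q q * P)) := by
    rw [← hN1]
    field_simp
  rw [e0, k0, k1]
  generalize 2 * Real.pi * Complex.I = π at *
  field_simp

end Evaluation

/-! ### Openness and density of the generic λ. -/

section Generic

variable {q : ℂ}

lemma differentiableAt_theta_comp {E : Type*} [NormedAddCommGroup E] [NormedSpace ℂ E]
    (hq : ‖q‖ < 1) {φ : E → ℂ} {x : E} (hφ : DifferentiableAt ℂ φ x) (h0 : φ x ≠ 0) :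
    DifferentiableAt ℂ (fun y => theta q (φ y)) x :=
  DifferentiableAt.comp x (differentiableAt_theta hq h0) hφ

/-- The numerator of `const`, multiplied by its theta denominators. -/
noncomputable def genericityForm (q : ℂ) (b l : Fin 6 → ℂ) : ℂ :=
  theta q (l 0 ^ 2) * theta q (l 1 ^ 2) * theta q (l 0 / l 1) *
    (l 0 * theta q (l 1 ^ 2) * theta q (l 1 / l 0) *
        ((∏ j ∈ ({2, 3, 4, 5} : Finset (Fin 6)), theta q (l j * l 1)) *
          (∏ j, theta q (l 0 * b j) - q / l 0 ^ 2 * ∏ j, theta q (l 0 / b j))) +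
      l 1 * theta q (l 0 ^ 2) * theta q (l 0 / l 1) *
        ((∏ j ∈ ({2, 3, 4, 5} : Finset (Fin 6)), theta q (l j * l 0)) *
          (∏ j, theta q (l 1 * b j) - q / l 1 ^ 2 * ∏ j, theta q (l 1 / b j))))

lemma differentiableAt_genericityForm (hq : ‖q‖ < 1) {b l : Fin 6 → ℂ} (hb : ∀ j, b j ≠ 0)
    (hl : ∀ j, l j ≠ 0) : DifferentiableAt ℂ (genericityForm q b) l := by
  have hp : ∀ j, DifferentiableAt ℂ (fun l : Fin 6 → ℂ => l j) l := fun j =>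
    differentiableAt_apply j l
  have c2 : ∀ i, DifferentiableAt ℂ (fun l : Fin 6 → ℂ => theta q (l i ^ 2)) l := fun i =>
    differentiableAt_theta_comp hq ((hp i).pow 2) (pow_ne_zero 2 (hl i))
  have cd : ∀ i j, DifferentiableAt ℂ (fun l : Fin 6 → ℂ => theta q (l i / l j)) l := fun i j =>
    differentiableAt_theta_comp (φ := fun l : Fin 6 → ℂ => l i / l j) hq
      (by fun_prop (disch := exact hl j)) (div_ne_zero (hl i) (hl j))
  have cm : ∀ i j, DifferentiableAt ℂ (fun l : Fin 6 → ℂ => theta q (l j * l i)) l := fun i j =>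
    differentiableAt_theta_comp hq ((hp j).mul (hp i)) (mul_ne_zero (hl j) (hl i))
  have cbm : ∀ i j, DifferentiableAt ℂ (fun l : Fin 6 → ℂ => theta q (l i * b j)) l := fun i j =>
    differentiableAt_theta_comp hq ((hp i).mul_const (b j)) (mul_ne_zero (hl i) (hb j))
  have cbd : ∀ i j, DifferentiableAt ℂ (fun l : Fin 6 → ℂ => theta q (l i / b j)) l := fun i j =>
    differentiableAt_theta_comp (φ := fun l : Fin 6 → ℂ => l i / b j) hq (by fun_prop) (div_ne_zero (hl i) (hb j))
  have hprod : ∀ (s : Finset (Fin 6)) {f : Fin 6 → (Fin 6 → ℂ) → ℂ},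
      (∀ j, DifferentiableAt ℂ (f j) l) → DifferentiableAt ℂ (fun l => ∏ j ∈ s, f j l) l :=
    fun s f hf => (HasFDerivAt.finsetProd fun j _ => (hf j).hasFDerivAt).differentiableAt
  have cX : ∀ i, DifferentiableAt ℂ (fun l : Fin 6 → ℂ =>
      ∏ j ∈ ({2, 3, 4, 5} : Finset (Fin 6)), theta q (l j * l i)) l := fun i => hprod _ (cm i)
  have cA : ∀ i, DifferentiableAt ℂ (fun l : Fin 6 → ℂ =>
      ∏ j, theta q (l i * b j) - q / l i ^ 2 * ∏ j, theta q (l i / b j)) l := fun i => by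
    have h2 : DifferentiableAt ℂ (fun l : Fin 6 → ℂ => q / l i ^ 2) l := by
      fun_prop (disch := exact pow_ne_zero 2 (hl i))
    exact (hprod _ (cbm i)).sub (h2.mul (hprod _ (cbd i)))
  exact (((c2 0).mul (c2 1)).mul (cd 0 1)).mul
    (((((hp 0).mul (c2 1)).mul (cd 1 0)).mul ((cX 1).mul (cA 0))).add
      ((((hp 1).mul (c2 0)).mul (cd 0 1)).mul ((cX 0).mul (cA 1))))

/-- All the conditions become the nonvanishing of one holomorphic function. Its leading theta
factors encode the excluded values of λ, and away from those it is a nonzero multiple of C. -/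
lemma genericLambda_iff (hq0 : q ≠ 0) (hq : ‖q‖ < 1) {b l : Fin 6 → ℂ} (hb : Admissible q b)
    (hl : ∀ j, l j ≠ 0) : GenericLambda q b l ↔ genericityForm q b l ≠ 0 := by
  have n0 := hl 0
  have n1 := hl 1
  have hP : pairProd (fun i j => qInf q (b i * b j)) ≠ 0 :=
    Finset.prod_ne_zero_iff.2 fun i _ => Finset.prod_ne_zero_iff.2 fun j _ =>
      qInf_ne_zero_of_zpow hq (hb.mul_ne i j)
  have hq1 := qInf_self_ne_zero hq
  have hth : ∀ {x : ℂ}, x ≠ 0 → ((∀ n : ℤ, x ≠ q ^ n) ↔ theta q x ≠ 0) := fun hx => by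
    rw [Ne, theta_eq_zero_iff hq0 hq hx, not_exists]
  have t10 : theta q (l 1 / l 0) = -(l 1 / l 0) * theta q (l 0 / l 1) := theta_div_comm hq0 hq n1 n0
  have key : theta q (l 0 ^ 2) ≠ 0 → theta q (l 1 ^ 2) ≠ 0 → theta q (l 0 / l 1) ≠ 0 →
      genericityForm q b l = theta q (l 0 ^ 2) * theta q (l 1 ^ 2) * theta q (l 0 / l 1) *
        (l 0 * l 1 * theta q (l 0 ^ 2) * theta q (l 1 ^ 2) * theta q (l 0 / l 1) *
          theta q (l 1 / l 0) * qInf q q * pairProd (fun i j => qInf q (b i * b j)) *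
          const q b l) := fun h0 h1 h01 => by
    rw [genericityForm, const, constTerm, constTerm, t10]
    generalize pairProd (fun i j => qInf q (b i * b j)) = P at *
    generalize ∏ j, theta q (l 0 * b j) - q / l 0 ^ 2 * ∏ j, theta q (l 0 / b j) = A0 at *
    generalize ∏ j, theta q (l 1 * b j) - q / l 1 ^ 2 * ∏ j, theta q (l 1 / b j) = A1 at *
    generalize ∏ j ∈ ({2, 3, 4, 5} : Finset (Fin 6)), theta q (l j * l 1) = X1 at *
    generalize ∏ j ∈ ({2, 3, 4, 5} : Finset (Fin 6)), theta q (l j * l 0) = X0 at *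
    field_simp
    ring
  rw [GenericLambda, hth (pow_ne_zero 2 n0), hth (pow_ne_zero 2 n1), hth (div_ne_zero n0 n1)]
  constructor
  · rintro ⟨h0, h1, h01, hC⟩
    rw [key h0 h1 h01, t10]
    have : l 1 / l 0 ≠ 0 := div_ne_zero n1 n0
    simp only [ne_eq, mul_eq_zero, neg_eq_zero, not_or]
    tauto
  · intro h
    have h' := h
    simp only [genericityForm, ne_eq, mul_eq_zero, not_or] at h'
    refine ⟨h'.1.1.1, h'.1.1.2, h'.1.2, fun hC => h ?_⟩
    rw [key h'.1.1.1 h'.1.1.2 h'.1.2, hC]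
    simp

lemma isOpen_genericLambda (hq0 : q ≠ 0) (hq : ‖q‖ < 1) {b : Fin 6 → ℂ} (hb : Admissible q b) :
    IsOpen {l : {l : Fin 6 → ℂ // ∏ j, l j = q} | GenericLambda q b l} := by
  have hc : Continuous fun l : {l : Fin 6 → ℂ // ∏ j, l j = q} => genericityForm q b l :=
    continuous_iff_continuousAt.2 fun l => ContinuousAt.comp
      (differentiableAt_genericityForm hq hb.ne_zero (ne_zero_of_prod_eq hq0 l.2)).continuousAt
      continuous_subtype_val.continuousAt
  convert isOpen_ne_fun hc (continuous_zero : Continuous fun _ => (0 : ℂ)) using 1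
  ext l
  exact genericLambda_iff hq0 hq hb (ne_zero_of_prod_eq hq0 l.2)

lemma exists_genericityForm_ne_zero (hq0 : q ≠ 0) (hq : ‖q‖ < 1) {b : Fin 6 → ℂ}
    (hb : Admissible q b) : ∃ l : Fin 6 → ℂ, ∏ j, l j = q ∧ genericityForm q b l ≠ 0 := by
  have n0 := hb.ne_zero 0
  have n1 := hb.ne_zero 1
  have t0 : theta q (b 0 ^ 2) ≠ 0 := theta_ne_zero hq0 hq (pow_ne_zero 2 n0) fun n => by
    rw [sq]; exact hb.mul_ne 0 0 n
  have t1 : theta q (b 1 ^ 2) ≠ 0 := theta_ne_zero hq0 hq (pow_ne_zero 2 n1) fun n => by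
    rw [sq]; exact hb.mul_ne 1 1 n
  have t01 : theta q (b 0 / b 1) ≠ 0 :=
    theta_ne_zero hq0 hq (div_ne_zero n0 n1) (hb.div_ne 0 1 (by decide))
  have t10 : theta q (b 1 / b 0) ≠ 0 :=
    theta_ne_zero hq0 hq (div_ne_zero n1 n0) (hb.div_ne 1 0 (by decide))
  have tA : ∏ j, theta q (b 0 * b j) ≠ 0 := Finset.prod_ne_zero_iff.2 fun j _ =>
    theta_ne_zero hq0 hq (mul_ne_zero n0 (hb.ne_zero j)) (hb.mul_ne 0 j)
  have hA : ∏ j, theta q (b 0 / b j) = 0 := Finset.prod_eq_zero (Finset.mem_univ 0)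
    (by rw [div_self n0, theta_one hq])
  -- Entry 2 makes θ(l_2 l_0) = θ(1) = 0, which removes the second term of C; l_0 = b_0 removes one
  -- product from the braces of the first. The other entries give nonzero thetas and the product q.
  refine ⟨![b 0, b 1, (b 0)⁻¹, b 1, b 1, q / b 1 ^ 3], ?_, ?_⟩
  · simp [Fin.prod_univ_six]
    field_simp
  · have h5 : theta q (q / b 1 ^ 3 * b 1) ≠ 0 := by
      rw [show q / b 1 ^ 3 * b 1 = q / b 1 ^ 2 by field_simp, theta_q_div hq0]
      exact t1
    have h2 : theta q ((b 0)⁻¹ * b 1) ≠ 0 := by rwa [← div_eq_inv_mul]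
    simp only [sq] at t0 t1
    simp [genericityForm, hA, t0, t1, t01, t10, n0, theta_one hq, h5, h2, sq]
    exact tA

/-- Logarithms with a sum fixed exactly, not merely modulo 2πi, allow two points of the hypersurface
to be joined by interpolating linearly in the logarithms. The last logarithm is defined by the sum.
-/
lemma exists_log_of_prod_eq (hq0 : q ≠ 0) {l : Fin 6 → ℂ} (hl : ∏ j, l j = q) :
    ∃ a : Fin 6 → ℂ, (∀ j, Complex.exp (a j) = l j) ∧ ∑ j, a j = Complex.log q := by
  have hn := ne_zero_of_prod_eq hq0 hl
  refine ⟨![Complex.log (l 0), Complex.log (l 1), Complex.log (l 2), Complex.log (l 3),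
    Complex.log (l 4), Complex.log q - Complex.log (l 0) - Complex.log (l 1) - Complex.log (l 2) -
      Complex.log (l 3) - Complex.log (l 4)], fun j => ?_, ?_⟩
  · fin_cases j
    · simp [Complex.exp_log (hn 0)]
    · simp [Complex.exp_log (hn 1)]
    · simp [Complex.exp_log (hn 2)]
    · simp [Complex.exp_log (hn 3)]
    · simp [Complex.exp_log (hn 4)]
    · have h0 := hn 0
      have h1 := hn 1
      have h2 := hn 2
      have h3 := hn 3
      have h4 := hn 4
      simp [Complex.exp_sub, Complex.exp_log, h0, h1, h2, h3, h4, hq0]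
      rw [← hl, Fin.prod_univ_six]
      field_simp
  · simp [Fin.sum_univ_six]

/-- Along the exponential curve from a given point to a known good one, `genericityForm` is entire
in t and nonzero at t = 1, so it cannot vanish throughout a neighbourhood of t = 0. -/
lemma dense_genericLambda (hq0 : q ≠ 0) (hq : ‖q‖ < 1) {b : Fin 6 → ℂ} (hb : Admissible q b) :
    Dense {l : {l : Fin 6 → ℂ // ∏ j, l j = q} | GenericLambda q b l} := by
  rintro ⟨l, hl⟩
  obtain ⟨l', hl', hne⟩ := exists_genericityForm_ne_zero hq0 hq hb
  obtain ⟨a, ha, has⟩ := exists_log_of_prod_eq hq0 hl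
  obtain ⟨a', ha', has'⟩ := exists_log_of_prod_eq hq0 hl'
  let L : ℂ → Fin 6 → ℂ := fun t j => Complex.exp ((1 - t) * a j + t * a' j)
  have hL : ∀ t, ∏ j, L t j = q := fun t => by
    rw [← Complex.exp_sum, Finset.sum_add_distrib, ← Finset.mul_sum, ← Finset.mul_sum, has, has',
      ← add_mul, sub_add_cancel, one_mul, Complex.exp_log hq0]
  have hL0 : L 0 = l := by
    funext j
    simp [L, ha]
  have hL1 : L 1 = l' := by
    funext j
    simp [L, ha']
  have hLd : Differentiable ℂ L := differentiable_pi.2 fun j => by fun_prop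
  have hd : Differentiable ℂ fun t => genericityForm q b (L t) := fun t =>
    DifferentiableAt.comp t
      (differentiableAt_genericityForm hq hb.ne_zero (ne_zero_of_prod_eq hq0 (hL t))) (hLd t)
  have hfreq : ∃ᶠ t in 𝓝 (0 : ℂ), genericityForm q b (L t) ≠ 0 := by
    intro h
    have han : AnalyticOnNhd ℂ (fun t => genericityForm q b (L t)) univ :=
      fun t _ => hd.analyticAt t
    have := han.eqOn_zero_of_preconnected_of_eventuallyEq_zero isPreconnected_univ
      (mem_univ (0 : ℂ)) (h.mono fun t ht => not_not.1 ht)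
    exact hne (hL1 ▸ this (mem_univ 1))
  let M : ℂ → {l : Fin 6 → ℂ // ∏ j, l j = q} := fun t => ⟨L t, hL t⟩
  have hM : Continuous M := hLd.continuous.subtype_mk _
  have hM0 : M 0 = ⟨l, hl⟩ := Subtype.ext hL0
  rw [← hM0]
  refine mem_closure_iff_frequently.2 (hM.continuousAt.tendsto.frequently (hfreq.mono fun t ht => ?_))
  exact (genericLambda_iff hq0 hq hb (ne_zero_of_prod_eq hq0 (hL t))).2 ht

end Generic

/-! ### The change of variable x = (z + 1/z)/2. -/

section Joukowski

variable {q : ℂ}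

lemma jouk_sub_jouk {z w : ℂ} (hz : z ≠ 0) (hw : w ≠ 0) :
    jouk z - jouk w = (z - w) * (z * w - 1) / (2 * z * w) := by
  rw [jouk, jouk]
  field_simp
  ring

lemma jouk_eq_iff {z w : ℂ} (hz : z ≠ 0) (hw : w ≠ 0) : jouk z = jouk w ↔ z = w ∨ z * w = 1 := by
  rw [← sub_eq_zero, jouk_sub_jouk hz hw]
  simp [hz, hw, sub_eq_zero]

lemma finite_jouk_preimage {S : Set ℂ} (hS : S.Finite) : (jouk ⁻¹' S).Finite := by
  refine hS.preimage' fun s _ => ?_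
  by_cases h : ∃ w ≠ 0, jouk w = s
  · obtain ⟨w, hw, rfl⟩ := h
    refine ((Set.finite_singleton w⁻¹).insert w |>.insert 0).subset fun z hz => ?_
    by_cases hz0 : z = 0
    · exact Or.inl hz0
    · rcases (jouk_eq_iff hz0 hw).1 hz with h | h
      · exact Or.inr (Or.inl h)
      · exact Or.inr (Or.inr (eq_inv_of_mul_eq_one_left h))
  · push Not at h
    exact (Set.finite_singleton 0).subset fun z hz => by
      by_contra hz0
      exact h z hz0 hz

/-- For this reason (a z^±)_k is a polynomial in x, or the reciprocal of one. -/
lemma one_sub_mul_one_sub {a z : ℂ} (ha : a ≠ 0) (hz : z ≠ 0) :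
    (1 - a * z) * (1 - a / z) = -2 * a * (jouk z - jouk a) := by
  rw [jouk, jouk]
  field_simp
  ring

lemma Admissible.zpow_eq {ι : Type*} (hq0 : q ≠ 0) (hq : ‖q‖ < 1) {b : ι → ℂ} (hb : Admissible q b)
    {i j : ι} {m n : ℤ} (h : b i * q ^ m = b j * q ^ n) : i = j ∧ m = n := by
  have hm := zpow_ne_zero m hq0
  have hij : i = j := by
    by_contra hij
    refine hb.div_ne i j hij (n - m) ?_
    have := hb.ne_zero j
    rw [zpow_sub₀ hq0]
    field_simp
    exact h
  subst hij
  refine ⟨rfl, ?_⟩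
  have h' := congrArg norm (mul_left_cancel₀ (hb.ne_zero i) h)
  rw [norm_zpow, norm_zpow] at h'
  exact zpow_right_injective₀ (norm_pos_iff.2 hq0) hq.ne h'

lemma Admissible.jouk_eq {ι : Type*} (hq0 : q ≠ 0) (hq : ‖q‖ < 1) {b : ι → ℂ} (hb : Admissible q b)
    {i j : ι} {m n : ℤ} (h : jouk (b i * q ^ m) = jouk (b j * q ^ n)) : i = j ∧ m = n := by
  have hm := zpow_ne_zero m hq0
  have hn := zpow_ne_zero n hq0
  rcases (jouk_eq_iff (mul_ne_zero (hb.ne_zero i) hm) (mul_ne_zero (hb.ne_zero j) hn)).1 h with h | h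
  · exact hb.zpow_eq hq0 hq h
  · refine absurd ?_ (hb.mul_ne i j (-(m + n)))
    rw [zpow_neg, zpow_add₀ hq0]
    exact eq_inv_of_mul_eq_one_left (by rw [← h]; ring)

end Joukowski

/-! ### Partial fractions. -/

section PartialFractions

open Polynomial

lemma natDegree_prod_X_sub_C {ι : Type*} (s : Finset ι) (x : ι → ℂ) :
    (∏ i ∈ s, (X - C (x i))).natDegree = s.card := by
  rw [natDegree_prod_of_monic _ _ fun i _ => monic_X_sub_C (x i)]
  simp

lemma exists_partialFraction_step {ι : Type*} {s : Finset ι} {x : ι → ℂ} {p : ℂ}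
    (hp : ∀ i ∈ s, p ≠ x i) {N : ℂ[X]} (hN : N.natDegree ≤ s.card + 1) :
    ∃ N₁ : ℂ[X], N₁.natDegree ≤ s.card ∧
      N = C (N.eval p / ∏ i ∈ s, (p - x i)) * (∏ i ∈ s, (X - C (x i))) + (X - C p) * N₁ := by
  set Q := ∏ i ∈ s, (X - C (x i)) with hQ
  set c := N.eval p / ∏ i ∈ s, (p - x i) with hc
  have hQp : Q.eval p = ∏ i ∈ s, (p - x i) := by rw [hQ, eval_prod]; simp
  have hQ0 : ∏ i ∈ s, (p - x i) ≠ 0 := Finset.prod_ne_zero_iff.2 fun i hi => sub_ne_zero.2 (hp i hi)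
  have hroot : (N - C c * Q).IsRoot p := by
    rw [IsRoot, eval_sub, eval_mul, eval_C, hQp, hc, div_mul_cancel₀ _ hQ0, sub_self]
  obtain ⟨N₁, hN₁⟩ := dvd_iff_isRoot.2 hroot
  refine ⟨N₁, ?_, by rw [← hN₁]; ring⟩
  by_cases h0 : N₁ = 0
  · simp [h0]
  have h1 : ((X - C p) * N₁).natDegree = 1 + N₁.natDegree := by
    rw [natDegree_mul (X_sub_C_ne_zero p) h0, natDegree_X_sub_C]
  have h2 : (N - C c * Q).natDegree ≤ s.card + 1 := by
    refine (natDegree_sub_le _ _).trans (max_le hN ((natDegree_C_mul_le _ _).trans ?_))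
    rw [hQ, natDegree_prod_X_sub_C]
    exact Nat.le_succ _
  rw [hN₁, h1] at h2
  omega

lemma div_eq_partialFraction {ι : Type*} {s : Finset ι} {x : ι → ℂ} {p c : ℂ} {N N₁ : ℂ[X]}
    (h : N = C c * (∏ i ∈ s, (X - C (x i))) + (X - C p) * N₁) :
    algebraMap ℂ[X] (RatFunc ℂ) N / algebraMap _ _ ((X - C p) * ∏ i ∈ s, (X - C (x i))) =
      c • (algebraMap _ (RatFunc ℂ) (X - C p))⁻¹ +
        algebraMap _ (RatFunc ℂ) N₁ / algebraMap _ _ (∏ i ∈ s, (X - C (x i))) := by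
  have h1 : algebraMap ℂ[X] (RatFunc ℂ) (X - C p) ≠ 0 :=
    RatFunc.algebraMap_ne_zero (X_sub_C_ne_zero p)
  have h2 : algebraMap ℂ[X] (RatFunc ℂ) (∏ i ∈ s, (X - C (x i))) ≠ 0 :=
    RatFunc.algebraMap_ne_zero (Finset.prod_ne_zero_iff.2 fun i _ => X_sub_C_ne_zero (x i))
  rw [h, map_add, map_mul, map_mul, map_mul, RatFunc.algebraMap_C, RatFunc.smul_eq_C_mul]
  field_simp

/-- Partial fractions: a subspace that contains `1` and the functions `1/(x - x_i)` contains all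
fractions with denominator `∏_i (x - x_i)` that are regular at infinity. -/
lemma div_prod_mem {W : Submodule ℂ (RatFunc ℂ)} (h1 : 1 ∈ W) {ι : Type*} (s : Finset ι) {x : ι → ℂ}
    (hx : Set.InjOn x s) (hW : ∀ i ∈ s, (algebraMap ℂ[X] (RatFunc ℂ) (X - C (x i)))⁻¹ ∈ W)
    {N : ℂ[X]} (hN : N.natDegree ≤ s.card) :
    algebraMap ℂ[X] (RatFunc ℂ) N / algebraMap _ _ (∏ i ∈ s, (X - C (x i))) ∈ W := by
  classical
  induction s using Finset.induction_on generalizing N with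
  | empty =>
    rw [Finset.card_empty, Nat.le_zero] at hN
    rw [eq_C_of_natDegree_eq_zero hN, Finset.prod_empty, map_one, div_one, RatFunc.algebraMap_C,
      ← mul_one (RatFunc.C _), ← RatFunc.smul_eq_C_mul]
    exact W.smul_mem _ h1
  | insert a s ha ih =>
    rw [Finset.card_insert_of_notMem ha] at hN
    obtain ⟨N₁, hN₁, h⟩ := exists_partialFraction_step (s := s) (x := x) (p := x a)
      (fun i hi e => ha (hx (Finset.mem_insert_self a s) (Finset.mem_insert_of_mem hi) e ▸ hi)) hN
    rw [Finset.prod_insert ha, div_eq_partialFraction h]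
    refine W.add_mem (W.smul_mem _ (hW a (Finset.mem_insert_self a s))) (ih ?_ ?_ hN₁)
    · exact hx.mono fun i hi => Finset.mem_insert_of_mem hi
    · exact fun i hi => hW i (Finset.mem_insert_of_mem hi)

/-- The numerator does not vanish at p, so the fraction has a nonzero residue there, and 1/(x - p)
can be solved for. -/
lemma inv_mem_of_div_prod_mem {W : Submodule ℂ (RatFunc ℂ)} (h1 : 1 ∈ W) {ι : Type*} (s : Finset ι)
    {x : ι → ℂ} {p : ℂ} (hx : Set.InjOn x s) (hp : ∀ i ∈ s, p ≠ x i)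
    (hW : ∀ i ∈ s, (algebraMap ℂ[X] (RatFunc ℂ) (X - C (x i)))⁻¹ ∈ W)
    {N : ℂ[X]} (hN : N.natDegree ≤ s.card + 1) (hNp : N.eval p ≠ 0)
    (h : algebraMap ℂ[X] (RatFunc ℂ) N / algebraMap _ _ ((X - C p) * ∏ i ∈ s, (X - C (x i))) ∈ W) :
    (algebraMap ℂ[X] (RatFunc ℂ) (X - C p))⁻¹ ∈ W := by
  obtain ⟨N₁, hN₁, h'⟩ := exists_partialFraction_step hp hN
  rw [div_eq_partialFraction h'] at h
  have hc : N.eval p / ∏ i ∈ s, (p - x i) ≠ 0 := div_ne_zero hNp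
    (Finset.prod_ne_zero_iff.2 fun i hi => sub_ne_zero.2 (hp i hi))
  rw [W.add_mem_iff_left (div_prod_mem h1 s hx hW hN₁), W.smul_mem_iff hc] at h
  exact h

end PartialFractions

/-! ### Generators of V and uniqueness of the functional. -/

section FunctionSpace

open Polynomial

variable {q : ℂ} {b : Fin 6 → ℂ}

lemma one_mem_V : (1 : RatFunc ℂ) ∈ V q b := by
  refine ⟨by simp, fun x hx => ?_, by simp⟩
  simp [IsRoot] at hx

lemma inv_mem_V {s : ℂ} (hs : s ∈ poleSet q b) :
    (algebraMap ℂ[X] (RatFunc ℂ) (X - C s))⁻¹ ∈ V q b := by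
  have h0 : algebraMap ℂ[X] (RatFunc ℂ) (X - C s) ≠ 0 :=
    RatFunc.algebraMap_ne_zero (X_sub_C_ne_zero s)
  have hd : ((algebraMap ℂ[X] (RatFunc ℂ) (X - C s))⁻¹).denom ∣ X - C s := by
    have := RatFunc.denom_div_dvd (1 : ℂ[X]) (X - C s)
    rwa [map_one, one_div] at this
  refine ⟨(irreducible_X_sub_C s).squarefree.squarefree_of_dvd hd, fun x hx => ?_, ?_⟩
  · have := hx.dvd hd
    rw [root_X_sub_C] at this
    exact this ▸ hs
  · have := RatFunc.intDegree_inv (algebraMap ℂ[X] (RatFunc ℂ) (X - C s))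
    rw [RatFunc.intDegree_polynomial, natDegree_X_sub_C, RatFunc.intDegree] at this
    omega

lemma denom_eq_prod {f : RatFunc ℂ} (hf : Squarefree f.denom) :
    f.denom = ∏ a ∈ f.denom.roots.toFinset, (X - C a) := by
  have h1 := (IsAlgClosed.splits f.denom).eq_prod_roots_of_monic f.monic_denom
  have h2 : f.denom.roots.Nodup := nodup_roots (PerfectField.separable_iff_squarefree.2 hf)
  conv_lhs => rw [h1]
  rw [Finset.prod, Multiset.toFinset_val, Multiset.dedup_eq_self.2 h2]

lemma V_le {W : Submodule ℂ (RatFunc ℂ)} (h1 : 1 ∈ W)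
    (hW : ∀ s ∈ poleSet q b, (algebraMap ℂ[X] (RatFunc ℂ) (X - C s))⁻¹ ∈ W) : V q b ≤ W := by
  rintro f ⟨hf1, hf2, hf3⟩
  have hd := denom_eq_prod hf1
  have hN : f.num.natDegree ≤ f.denom.roots.toFinset.card := by
    rw [hd, natDegree_prod_X_sub_C] at hf3
    exact hf3
  have := div_prod_mem h1 f.denom.roots.toFinset (x := fun a => a) (fun _ _ _ _ h => h)
    (fun a ha => hW a (hf2 a (by simpa using (mem_roots f.denom_ne_zero).1 (Multiset.mem_toFinset.1 ha))))
    hN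
  rwa [← hd, RatFunc.num_div_denom] at this

lemma eval_div_eq {N D : ℂ[X]} {y : ℂ} (hD : D.eval y ≠ 0) :
    (algebraMap ℂ[X] (RatFunc ℂ) N / algebraMap _ _ D).eval (RingHom.id ℂ) y =
      N.eval y / D.eval y := by
  have hD0 : D ≠ 0 := by rintro rfl; simp at hD
  set f := algebraMap ℂ[X] (RatFunc ℂ) N / algebraMap _ _ D with hf
  have hd : f.denom.eval y ≠ 0 := fun h => by
    obtain ⟨r, hr⟩ := RatFunc.denom_div_dvd N D
    rw [hr, eval_mul, ← hf, h, zero_mul] at hD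
    exact hD rfl
  have h1 : f.num * D = N * f.denom := by
    refine RatFunc.algebraMap_injective ℂ ?_
    have h2 := RatFunc.algebraMap_ne_zero (K := ℂ) hD0
    have h3 := RatFunc.algebraMap_ne_zero (K := ℂ) f.denom_ne_zero
    rw [map_mul, map_mul, ← div_eq_div_iff h3 h2, RatFunc.num_div_denom, hf]
  have h4 := congrArg (Polynomial.eval y) h1
  rw [eval_mul, eval_mul] at h4
  rw [RatFunc.eval, div_eq_div_iff (by simpa using! hd) hD]
  simpa using! h4

lemma prod_one_sub_eq {m : ℕ} {a : ℕ → ℂ} (ha : ∀ i, a i ≠ 0) {z : ℂ} (hz : z ≠ 0) :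
    (∏ i ∈ Finset.range m, (1 - a i * z)) * ∏ i ∈ Finset.range m, (1 - a i / z) =
      (∏ i ∈ Finset.range m, (-2 * a i)) *
        (∏ i ∈ Finset.range m, (X - C (jouk (a i)))).eval (jouk z) := by
  rw [eval_prod, ← Finset.prod_mul_distrib, ← Finset.prod_mul_distrib]
  refine Finset.prod_congr rfl fun i _ => ?_
  rw [one_sub_mul_one_sub (ha i) hz]
  simp

/-- The functions on which the two functionals agree form a subspace containing 1. By strong
induction on m it contains the simple fraction with pole at z = b_j q^{-(m+1)}: a test function has
this pole and, apart from it, only earlier ones. -/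
lemma IsRahmanFunctional.unique (hq0 : q ≠ 0) (hq : ‖q‖ < 1) (hb : Admissible q b)
    {J₁ J₂ : V q b →ₗ[ℂ] ℂ} (h₁ : IsRahmanFunctional q b J₁) (h₂ : IsRahmanFunctional q b J₂) :
    J₁ = J₂ := by
  set W : Submodule ℂ (RatFunc ℂ) := (LinearMap.ker (J₁ - J₂)).map (V q b).subtype with hWdef
  have hmem : ∀ f : V q b, ∀ k : Fin 6 → ℤ, ∑ j, k j = 0 →
      (∀ᶠ z in Filter.cofinite, (f : RatFunc ℂ).eval (RingHom.id ℂ) (jouk z) =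
        ∏ j, (qPoch q (b j * z) (k j) * qPoch q (b j / z) (k j))) → (f : RatFunc ℂ) ∈ W := by
    intro f k hk hf
    refine ⟨f, ?_, rfl⟩
    rw [SetLike.mem_coe, LinearMap.mem_ker, LinearMap.sub_apply, h₁ k hk f hf, h₂ k hk f hf, sub_self]
  have hone : (1 : RatFunc ℂ) ∈ W := by
    refine hmem ⟨1, one_mem_V⟩ 0 (by simp) (Filter.Eventually.of_forall fun z => ?_)
    have : ∀ a, qPoch q a 0 = 1 := fun a => by simpa using qPoch_natCast (q := q) a 0
    simp [this]
  have hinv : ∀ (j : Fin 6) (m : ℕ),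
      (algebraMap ℂ[X] (RatFunc ℂ) (X - C (jouk (b j * q ^ (-((m : ℤ) + 1))))))⁻¹ ∈ W := by
    intro j m
    induction m using Nat.strong_induction_on with
    | _ m ih =>
      obtain ⟨i, hij⟩ := exists_ne j
      set x : ℕ → ℂ := fun r => jouk (b j * q ^ (-((r : ℤ) + 1))) with hx
      have hxinj : Function.Injective x := fun r r' h => by
        have := (hb.jouk_eq hq0 hq h).2
        omega
      have haj : ∀ r : ℕ, b j * q ^ (-((r : ℤ) + 1)) ≠ 0 := fun r =>
        mul_ne_zero (hb.ne_zero j) (zpow_ne_zero _ hq0)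
      have hai : ∀ r : ℕ, b i * q ^ r ≠ 0 := fun r => mul_ne_zero (hb.ne_zero i) (pow_ne_zero _ hq0)
      set κi := ∏ r ∈ Finset.range (m + 1), (-2 * (b i * q ^ r)) with hκi
      set κj := ∏ r ∈ Finset.range (m + 1), (-2 * (b j * q ^ (-((r : ℤ) + 1)))) with hκj
      have hκi0 : κi ≠ 0 := Finset.prod_ne_zero_iff.2 fun r _ => mul_ne_zero (by norm_num) (hai r)
      have hκj0 : κj ≠ 0 := Finset.prod_ne_zero_iff.2 fun r _ => mul_ne_zero (by norm_num) (haj r)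
      set N : ℂ[X] := C (κi / κj) * ∏ r ∈ Finset.range (m + 1), (X - C (jouk (b i * q ^ r))) with hN
      have hNdeg : N.natDegree ≤ m + 1 := by
        refine (natDegree_C_mul_le _ _).trans ?_
        rw [natDegree_prod_X_sub_C, Finset.card_range]
      set D : ℂ[X] := ∏ r ∈ Finset.range (m + 1), (X - C (x r)) with hD
      have hV : algebraMap ℂ[X] (RatFunc ℂ) N / algebraMap _ _ D ∈ V q b :=
        div_prod_mem one_mem_V _ hxinj.injOn
          (fun r _ => inv_mem_V ⟨j, r + 1, by omega, by rw [hx]; push_cast; rfl⟩) (by simpa using hNdeg)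
      have hW : algebraMap ℂ[X] (RatFunc ℂ) N / algebraMap _ _ D ∈ W := by
        -- The test function has k_j = -(m + 1), k_i = m + 1 and all other exponents 0, for an
        -- arbitrary i ≠ j.
        refine hmem ⟨_, hV⟩ (Function.update (Function.update 0 j (-((m + 1 : ℕ) : ℤ))) i
          ((m + 1 : ℕ) : ℤ)) ?_ ?_
        · rw [Finset.sum_update_of_mem (Finset.mem_univ i), Finset.sum_update_of_mem (by simpa using hij.symm)]
          simp
        · have hfin : (jouk ⁻¹' {y | D.IsRoot y}).Finite :=
            finite_jouk_preimage (D.finite_setOfPred_isRoot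
              (Finset.prod_ne_zero_iff.2 fun r _ => X_sub_C_ne_zero _))
          filter_upwards [hfin.compl_mem_cofinite, (Set.finite_singleton (0 : ℂ)).compl_mem_cofinite]
            with z hz hz0
          replace hz0 : z ≠ 0 := hz0
          replace hz : D.eval (jouk z) ≠ 0 := hz
          have e0 : ∀ a, qPoch q a 0 = 1 := fun a => by simpa using qPoch_natCast (q := q) a 0
          have e1 := prod_one_sub_eq (m := m + 1) (a := fun r => b j * q ^ (-((r : ℤ) + 1))) haj hz0
          have e2 := prod_one_sub_eq (m := m + 1) (a := fun r => b i * q ^ r) hai hz0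
          rw [← Finset.mul_prod_erase _ _ (Finset.mem_univ i),
            ← Finset.mul_prod_erase _ _ (Finset.mem_erase.2 ⟨hij.symm, Finset.mem_univ j⟩),
            Finset.prod_eq_one fun r hr => by
              rw [Function.update_of_ne (Finset.ne_of_mem_erase (Finset.mem_of_mem_erase hr)),
                Function.update_of_ne (Finset.ne_of_mem_erase hr), Pi.zero_apply, e0, e0, mul_one],
            Function.update_self, Function.update_of_ne hij.symm, Function.update_self, mul_one,
            qPoch_natCast, qPoch_natCast, qPoch_neg_natCast, qPoch_neg_natCast, ← mul_inv]
          have r1 : ∀ (c : ℂ) (w : ℂ), ∏ r ∈ Finset.range (m + 1), (1 - c * w * q ^ r) =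
              ∏ r ∈ Finset.range (m + 1), (1 - c * q ^ r * w) := fun c w =>
            Finset.prod_congr rfl fun r _ => by ring
          have r2 : ∀ (c : ℂ) (w : ℂ), ∏ r ∈ Finset.range (m + 1), (1 - c * w * q ^ (-((r : ℤ) + 1))) =
              ∏ r ∈ Finset.range (m + 1), (1 - c * q ^ (-((r : ℤ) + 1)) * w) := fun c w =>
            Finset.prod_congr rfl fun r _ => by ring
          simp only [div_eq_mul_inv, r1, r2] at e1 e2 ⊢
          rw [← hκj] at e1
          rw [← hκi] at e2
          rw [e1, e2, ← div_eq_mul_inv (algebraMap _ _ N), eval_div_eq hz, hN, eval_mul, eval_C]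
          have hz' : eval (jouk z) (∏ i ∈ Finset.range (m + 1),
            (X - C (jouk (b j * q ^ (-((i : ℤ) + 1)))))) ≠ 0 := hz
          change _ / eval (jouk z) (∏ i ∈ Finset.range (m + 1),
            (X - C (jouk (b j * q ^ (-((i : ℤ) + 1)))))) = _
          field_simp
      rw [hD, Finset.prod_range_succ, mul_comm] at hW
      refine inv_mem_of_div_prod_mem hone (Finset.range m) hxinj.injOn (fun r hr e => ?_)
        (fun r hr => ih r (Finset.mem_range.1 hr)) (by simpa using hNdeg) ?_ hW
      · have := hxinj e
        simp at hr
        omega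
      -- The zeros of the numerator belong to b_i, and no point of the b_i family equals one of the
      -- b_j family, so the residue at the new pole is nonzero.
      · rw [hN, eval_mul, eval_C, eval_prod]
        refine mul_ne_zero (div_ne_zero hκi0 hκj0) (Finset.prod_ne_zero_iff.2 fun r _ => ?_)
        simp only [eval_sub, eval_X, eval_C]
        refine sub_ne_zero.2 fun e => ?_
        rw [← zpow_natCast] at e
        exact hij (hb.jouk_eq hq0 hq e).1.symm
  have hle : V q b ≤ W := V_le hone (by
    rintro s ⟨j, n, hn, rfl⟩
    have := hinv j (n - 1)
    rwa [show -(((n - 1 : ℕ) : ℤ) + 1) = -(n : ℤ) by omega] at this)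
  ext f
  obtain ⟨g, hg, hgf⟩ := hle f.2
  have : g = f := Subtype.ext hgf
  subst this
  rw [SetLike.mem_coe, LinearMap.mem_ker, LinearMap.sub_apply] at hg
  exact sub_eq_zero.1 hg

end FunctionSpace

/-! ### Pole depths and independence of the contour. -/

section Depth

open Polynomial

variable {q : ℂ} {b : Fin 6 → ℂ}

/-- The parameters `b_j q^(-n_j)`. -/
noncomputable def lowered (q : ℂ) (b : Fin 6 → ℂ) (n : Fin 6 → ℕ) (j : Fin 6) : ℂ :=
  b j * q ^ (-(n j : ℤ))

/-- The poles of `f` are among the points `(z + z⁻¹)/2` with `z = b_j q^(-m)`, `1 ≤ m ≤ n_j`. -/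
def HasDepth (q : ℂ) (b : Fin 6 → ℂ) (f : RatFunc ℂ) (n : Fin 6 → ℕ) : Prop :=
  ∀ x, f.denom.IsRoot x → ∃ (j : Fin 6) (m : ℕ), 1 ≤ m ∧ m ≤ n j ∧ x = jouk (b j * q ^ (-(m : ℤ)))

lemma HasDepth.mono {f : RatFunc ℂ} {n n' : Fin 6 → ℕ} (h : HasDepth q b f n) (hn : n ≤ n') :
    HasDepth q b f n' := fun x hx => by
  obtain ⟨j, m, h1, h2, h3⟩ := h x hx
  exact ⟨j, m, h1, h2.trans (hn j), h3⟩

lemma hasDepth_poleDepth (hq0 : q ≠ 0) (hq : ‖q‖ < 1) (hb : Admissible q b) {f : RatFunc ℂ}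
    (hf : f ∈ V q b) : HasDepth q b f (poleDepth q b f) := by
  intro x hx
  obtain ⟨j, m, hm, rfl⟩ := hf.2.1 x hx
  -- The supremum defining `poleDepth` is meaningful only for a bounded set. It is bounded because f
  -- has finitely many poles and distinct exponents give distinct points.
  refine ⟨j, m, hm, le_csSup ?_ hx, rfl⟩
  refine Set.Finite.bddAbove (Set.Finite.of_finite_image
    ((f.denom.finite_setOfPred_isRoot f.denom_ne_zero).subset ?_) (f := fun n : ℕ =>
      jouk (b j * q ^ (-(n : ℤ)))) fun r _ r' _ h => ?_)
  · rintro _ ⟨n, hn, rfl⟩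
    exact hn
  · have := (hb.jouk_eq hq0 hq h).2
    omega

lemma lowered_mul_pow (hq0 : q ≠ 0) (n : Fin 6 → ℕ) (j : Fin 6) {e : ℤ} {r : ℕ}
    (h : e = -(n j : ℤ) + r) : b j * q ^ e = lowered q b n j * q ^ r := by
  rw [lowered, h, zpow_add₀ hq0, zpow_natCast, mul_assoc]

lemma Separates.lowered_mono (hq0 : q ≠ 0) {n n' : Fin 6 → ℕ} (hn : n ≤ n') {g g' : ℝ → ℂ}
    (hg : Separates q (lowered q b n') g g') : Separates q (lowered q b n) g g' :=
  hg.mul_pow fun j => ⟨j, n' j - n j, lowered_mul_pow hq0 n' j (by have h : n j ≤ n' j := hn j; omega)⟩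

lemma Separates.ne_zpow (hq0 : q ≠ 0) {n : Fin 6 → ℕ} {g g' : ℝ → ℂ}
    (hg : Separates q (lowered q b n) g g') {t : ℝ} (ht : t ∈ Icc (0 : ℝ) 1) (j : Fin 6) {e : ℤ}
    (he : -(n j : ℤ) ≤ e) : 1 - b j * q ^ e / g t ≠ 0 ∧ 1 - b j * q ^ e * g t ≠ 0 := by
  obtain ⟨r, hr⟩ := Int.le.dest he
  rw [lowered_mul_pow hq0 n j hr.symm]
  refine ⟨fun h => hg.avoid j r t ht ?_, fun h => hg.avoid_inv j r t ht ?_⟩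
  · exact ((div_eq_one_iff_eq (hg.ne_zero t ht)).1 (sub_eq_zero.1 h).symm).symm
  · exact eq_inv_of_mul_eq_one_right (sub_eq_zero.1 h).symm

lemma Separates.jouk_ne (hb : ∀ j, b j ≠ 0) (hq0 : q ≠ 0) {n : Fin 6 → ℕ} {g g' : ℝ → ℂ}
    (hg : Separates q (lowered q b n) g g') {t : ℝ} (ht : t ∈ Icc (0 : ℝ) 1) (j : Fin 6) {e : ℤ}
    (he : -(n j : ℤ) ≤ e) : jouk (g t) ≠ jouk (b j * q ^ e) := fun h => by
  obtain ⟨h1, h2⟩ := hg.ne_zpow hq0 ht j he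
  have h0 := hg.ne_zero t ht
  rcases (jouk_eq_iff h0 (mul_ne_zero (hb j) (zpow_ne_zero _ hq0))).1 h with h | h
  · exact h1 (by rw [← h, div_self h0, sub_self])
  · exact h2 (by rw [mul_comm, h, sub_self])

lemma HasDepth.denom_ne_zero (hb : ∀ j, b j ≠ 0) (hq0 : q ≠ 0) {f : RatFunc ℂ} {n : Fin 6 → ℕ}
    (hf : HasDepth q b f n) {g g' : ℝ → ℂ} (hg : Separates q (lowered q b n) g g') {t : ℝ}
    (ht : t ∈ Icc (0 : ℝ) 1) : f.denom.eval (jouk (g t)) ≠ 0 := fun h => by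
  obtain ⟨j, m, -, hm, hx⟩ := hf _ h
  exact hg.jouk_ne hb hq0 ht j (by omega) hx

/-- A common denominator of the functions of depth `n`. -/
noncomputable def depthPoly (q : ℂ) (b : Fin 6 → ℂ) (n : Fin 6 → ℕ) : ℂ[X] :=
  ∏ j, ∏ r ∈ Finset.range (n j), (X - C (jouk (lowered q b n j * q ^ r)))

lemma depthPoly_ne_zero (n : Fin 6 → ℕ) : depthPoly q b n ≠ 0 :=
  Finset.prod_ne_zero_iff.2 fun _ _ => Finset.prod_ne_zero_iff.2 fun _ _ => X_sub_C_ne_zero _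

lemma HasDepth.exists_numerator (hq0 : q ≠ 0) {f : RatFunc ℂ} {n : Fin 6 → ℕ}
    (hf : HasDepth q b f n) (hfV : f ∈ V q b) : ∃ P : ℂ[X], ∀ y, f.denom.eval y ≠ 0 →
      f.eval (RingHom.id ℂ) y * (depthPoly q b n).eval y = P.eval y := by
  have hdvd : f.denom ∣ depthPoly q b n := by
    refine (IsAlgClosed.splits f.denom).dvd_of_roots_le_roots f.denom_ne_zero
      ((Multiset.le_iff_subset (nodup_roots (PerfectField.separable_iff_squarefree.2 hfV.1))).2
        fun x hx => ?_)
    obtain ⟨j, m, h1, h2, rfl⟩ := hf x ((mem_roots f.denom_ne_zero).1 hx)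
    rw [mem_roots (depthPoly_ne_zero n), IsRoot, depthPoly, eval_prod]
    refine Finset.prod_eq_zero (Finset.mem_univ j) ?_
    rw [eval_prod]
    refine Finset.prod_eq_zero (Finset.mem_range.2 (show n j - m < n j by omega)) ?_
    rw [lowered_mul_pow hq0 n j (r := n j - m) (by omega)]
    simp
  obtain ⟨E, hE⟩ := hdvd
  refine ⟨f.num * E, fun y hy => ?_⟩
  have : f.eval (RingHom.id ℂ) y = f.num.eval y / f.denom.eval y := rfl
  rw [this, hE, eval_mul, eval_mul]
  field_simp

/-- Replacing b_j by b_j q^{-n_j} adds n_j factors to each q-product, and paired under z ↦ 1/z they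
give `depthPoly` up to a constant. Thus the poles of f are absorbed into a kernel of the same kind.
-/
lemma Separates.kernel_eq (hb : ∀ j, b j ≠ 0) (hq0 : q ≠ 0) (hq : ‖q‖ < 1) {n : Fin 6 → ℕ}
    {g g' : ℝ → ℂ} (hg : Separates q (lowered q b n) g g') {t : ℝ} (ht : t ∈ Icc (0 : ℝ) 1) :
    kernel q b b (g t) = (∏ j, ∏ r ∈ Finset.range (n j), (-2 * (lowered q b n j * q ^ r))) *
      (depthPoly q b n).eval (jouk (g t)) *
        kernel q (lowered q b n) (lowered q b n) (g t) := by
  have hz := hg.ne_zero t ht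
  rw [depthPoly, eval_prod, ← Finset.prod_mul_distrib, kernel, kernel, ← Finset.prod_mul_distrib]
  refine Finset.prod_congr rfl fun j _ => ?_
  have hc0 : ∀ r : ℕ, lowered q b n j * q ^ r ≠ 0 := fun r =>
    mul_ne_zero (mul_ne_zero (hb j) (zpow_ne_zero _ hq0)) (pow_ne_zero _ hq0)
  rw [← prod_one_sub_eq hc0 hz]
  have e1 : lowered q b n j * q ^ n j = b j := by
    rw [← lowered_mul_pow hq0 n j (e := 0) (by omega), zpow_zero, mul_one]
  have h1 : qInf q (lowered q b n j * g t) =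
      (∏ r ∈ Finset.range (n j), (1 - lowered q b n j * q ^ r * g t)) * qInf q (b j * g t) := by
    rw [qInf_eq_prod hq _ (n j), show lowered q b n j * g t * q ^ n j = b j * g t by
      rw [mul_right_comm, e1]]
    exact congrArg (· * _) (Finset.prod_congr rfl fun r _ => by ring)
  have h2 : qInf q (lowered q b n j / g t) =
      (∏ r ∈ Finset.range (n j), (1 - lowered q b n j * q ^ r / g t)) * qInf q (b j / g t) := by
    rw [qInf_eq_prod hq _ (n j), show lowered q b n j / g t * q ^ n j = b j / g t by
      rw [div_mul_eq_mul_div, e1]]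
    exact congrArg (· * _) (Finset.prod_congr rfl fun r _ => by ring)
  have h3 : ∏ r ∈ Finset.range (n j), (1 - lowered q b n j * q ^ r * g t) ≠ 0 :=
    Finset.prod_ne_zero_iff.2 fun r _ => by
      rw [← lowered_mul_pow hq0 n j rfl]
      exact (hg.ne_zpow hq0 ht j (by omega)).2
  have h4 : ∏ r ∈ Finset.range (n j), (1 - lowered q b n j * q ^ r / g t) ≠ 0 :=
    Finset.prod_ne_zero_iff.2 fun r _ => by
      rw [← lowered_mul_pow hq0 n j rfl]
      exact (hg.ne_zpow hq0 ht j (by omega)).1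
  rw [h1, h2]
  simp only [mul_inv]
  generalize ∏ r ∈ Finset.range (n j), (1 - lowered q b n j * q ^ r * g t) = X1 at *
  generalize ∏ r ∈ Finset.range (n j), (1 - lowered q b n j * q ^ r / g t) = X2 at *
  field_simp

/-- The integrand of the functional. -/
noncomputable def rahmanIntegrand (q : ℂ) (b l : Fin 6 → ℂ) (f : RatFunc ℂ) (z : ℂ) : ℂ :=
  f.eval (RingHom.id ℂ) (jouk z) * weight q b l z * (2 * Real.pi * Complex.I * z)⁻¹

lemma weight_eq (l : Fin 6 → ℂ) (z : ℂ) :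
    weight q b l z = (z - z⁻¹) / z ^ 2 * (∏ j, theta q (l j * z)) * kernel q b b z := by
  simp only [weight, kernel, div_eq_mul_inv, Finset.prod_mul_distrib, mul_assoc]

/-- After clearing the denominator of f against `depthPoly`, the integrand is holomorphic times the
kernel with lowered parameters, which are again admissible. -/
lemma HasDepth.exists_simplePoles (hq0 : q ≠ 0) (hq : ‖q‖ < 1) (hb : Admissible q b)
    {l : Fin 6 → ℂ} (hl : ∀ j, l j ≠ 0) {f : RatFunc ℂ} {n : Fin 6 → ℕ} (hf : HasDepth q b f n)
    (hfV : f ∈ V q b) : ∃ G : ℂ → ℂ,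
      SimplePoles G ((⋃ j, outSet q (lowered q b n j)) ∪ ⋃ j, inSet q (lowered q b n j)) ∧
      ∀ {g g' : ℝ → ℂ}, Separates q (lowered q b n) g g' → ∀ t ∈ Icc (0 : ℝ) 1,
        rahmanIntegrand q b l f (g t) = G (g t) := by
  obtain ⟨P, hP⟩ := hf.exists_numerator hq0 hfV
  have hc : Admissible q (lowered q b n) := hb.zpow_mul hq0 _
  set κ := ∏ j, ∏ r ∈ Finset.range (n j), (-2 * (lowered q b n j * q ^ r))
  refine ⟨_, hc.simplePoles_kernel_mul hq0 hq (h := fun z => κ * (2 * Real.pi * Complex.I)⁻¹ *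
    P.eval (jouk z) * ((z ^ 2)⁻¹ * ∏ j, theta q (l j * z))) fun z hz => ?_, fun {g g'} hg t ht => ?_⟩
  · have hj : DifferentiableAt ℂ jouk z := (differentiableAt_id.add (differentiableAt_inv hz)).div_const 2
    exact ((P.differentiable.differentiableAt.comp z hj).const_mul _).mul
      (((differentiableAt_id.pow 2).inv (pow_ne_zero 2 hz)).mul
        (differentiableAt_prod_theta_mul hq hl hz))
  · rw [rahmanIntegrand, weight_eq, hg.kernel_eq hb.ne_zero hq0 hq ht,
      ← hP _ (hf.denom_ne_zero hb.ne_zero hq0 hg ht), mul_inv]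
    ring

lemma HasDepth.loopInt_eq (hq0 : q ≠ 0) (hq : ‖q‖ < 1) (hb : Admissible q b)
    {l : Fin 6 → ℂ} (hl : ∀ j, l j ≠ 0) {f : RatFunc ℂ} {n : Fin 6 → ℕ} (hf : HasDepth q b f n)
    (hfV : f ∈ V q b) {g₁ g₁' g₂ g₂' : ℝ → ℂ} (h₁ : Separates q (lowered q b n) g₁ g₁')
    (h₂ : Separates q (lowered q b n) g₂ g₂') :
    loopInt (rahmanIntegrand q b l f) g₁ g₁' = loopInt (rahmanIntegrand q b l f) g₂ g₂' := by
  obtain ⟨G, hG, h⟩ := hf.exists_simplePoles hq0 hq hb hl hfV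
  rw [loopInt_congr (h h₁), loopInt_congr (h h₂), hG.loopInt_eq_of_separates hq h₁ h₂]

lemma HasDepth.continuousOn (hq0 : q ≠ 0) (hq : ‖q‖ < 1) (hb : Admissible q b)
    {l : Fin 6 → ℂ} (hl : ∀ j, l j ≠ 0) {f : RatFunc ℂ} {n : Fin 6 → ℕ} (hf : HasDepth q b f n)
    (hfV : f ∈ V q b) {g g' : ℝ → ℂ} (hg : Separates q (lowered q b n) g g') :
    ContinuousOn (fun t => rahmanIntegrand q b l f (g t)) (Icc 0 1) := by
  obtain ⟨G, hG, h⟩ := hf.exists_simplePoles hq0 hq hb hl hfV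
  exact (hG.continuousOn_comp hg.isLoop.cont hg.ne_zero fun t ht => hg.notMem ht).congr (h hg)

lemma loopInt_rahmanIntegrand_add (hq0 : q ≠ 0) (hq : ‖q‖ < 1) (hb : Admissible q b)
    {l : Fin 6 → ℂ} (hl : ∀ j, l j ≠ 0) {f₁ f₂ : RatFunc ℂ} {n : Fin 6 → ℕ}
    (h₁ : HasDepth q b f₁ n) (h₂ : HasDepth q b f₂ n) (hV₁ : f₁ ∈ V q b) (hV₂ : f₂ ∈ V q b)
    {g g' : ℝ → ℂ} (hg : Separates q (lowered q b n) g g') :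
    loopInt (rahmanIntegrand q b l (f₁ + f₂)) g g' =
      loopInt (rahmanIntegrand q b l f₁) g g' + loopInt (rahmanIntegrand q b l f₂) g g' := by
  rw [← hg.isLoop.loopInt_add (h₁.continuousOn hq0 hq hb hl hV₁ hg)
    (h₂.continuousOn hq0 hq hb hl hV₂ hg)]
  refine loopInt_congr fun t ht => ?_
  rw [rahmanIntegrand, RatFunc.eval_add (RingHom.id ℂ) (jouk (g t)) (h₁.denom_ne_zero hb.ne_zero hq0 hg ht)
    (h₂.denom_ne_zero hb.ne_zero hq0 hg ht), rahmanIntegrand, rahmanIntegrand]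
  ring

lemma loopInt_rahmanIntegrand_smul (hq0 : q ≠ 0) (hb : Admissible q b)
    {l : Fin 6 → ℂ} {f : RatFunc ℂ} {n : Fin 6 → ℕ}
    (h : HasDepth q b f n) (c : ℂ) {g g' : ℝ → ℂ} (hg : Separates q (lowered q b n) g g') :
    loopInt (rahmanIntegrand q b l (c • f)) g g' = c * loopInt (rahmanIntegrand q b l f) g g' := by
  rw [← loopInt_const_mul]
  refine loopInt_congr fun t ht => ?_
  rw [rahmanIntegrand, RatFunc.smul_eq_C_mul, RatFunc.eval_mul (RingHom.id ℂ) (jouk (g t)) (by simp)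
    (h.denom_ne_zero hb.ne_zero hq0 hg ht), RatFunc.eval_C, rahmanIntegrand]
  simp only [RingHom.id_apply]
  ring

end Depth

/-! ### The integrand for Rahman's test functions. -/

section Moments

variable {q : ℂ} {b : Fin 6 → ℂ}

lemma continuousAt_qPoch {a : ℂ} {k : ℤ}
    (h : ∀ i : ℕ, (i : ℤ) < -k → 1 - a * q ^ (-((i : ℤ) + 1)) ≠ 0) :
    ContinuousAt (fun x => qPoch q x k) a := by
  cases k with
  | ofNat n =>
    simp only [qPoch]
    fun_prop
  | negSucc n =>
    simp only [qPoch]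
    refine ContinuousAt.inv₀ (by fun_prop) (Finset.prod_ne_zero_iff.2 fun i hi => h i ?_)
    have := Finset.mem_range.1 hi
    omega

/-- Rests on (a)_k / (a)_∞ = 1/(a q^k)_∞. The bound on k keeps the curve away from all the zeros and
poles involved. -/
lemma weight_mul_qPoch (hq0 : q ≠ 0) (hq : ‖q‖ < 1) {l : Fin 6 → ℂ} {k : Fin 6 → ℤ}
    {n : Fin 6 → ℕ} (hk : ∀ j, -(n j : ℤ) ≤ k j) {g g' : ℝ → ℂ}
    (hg : Separates q (lowered q b n) g g') {t : ℝ} (ht : t ∈ Icc (0 : ℝ) 1) :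
    (∏ j, (qPoch q (b j * g t) (k j) * qPoch q (b j / g t) (k j))) * weight q b l (g t) =
      weight q (fun j => b j * q ^ k j) l (g t) := by
  rw [weight, weight, mul_left_comm, ← Finset.prod_mul_distrib]
  refine congrArg _ (Finset.prod_congr rfl fun j _ => ?_)
  have hq1 : ∀ {a : ℂ}, (∀ e : ℤ, -(n j : ℤ) ≤ e → 1 - a * q ^ e ≠ 0) →
      qPoch q a (k j) * (qInf q a)⁻¹ = (qInf q (a * q ^ k j))⁻¹ := fun {a} ha => by
    have h0 : qInf q a ≠ 0 := qInf_ne_zero hq fun i e => ha i (by omega) (by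
      rw [zpow_natCast, e, sub_self])
    have h1 := qPoch_mul_qInf hq0 hq (a := a) (k := k j) fun i hi e =>
      ha (-((i : ℤ) + 1)) (by have := hk j; omega) (by rw [e, sub_self])
    have h2 : qInf q (a * q ^ k j) ≠ 0 := fun h => h0 (by rw [← h1, h, mul_zero])
    rw [← h1] at h0 ⊢
    have h3 := left_ne_zero_of_mul h0
    field_simp
  have e1 := hq1 (a := b j * g t) fun e he => by
    rw [mul_right_comm]; exact (hg.ne_zpow hq0 ht j he).2
  have e2 := hq1 (a := b j / g t) fun e he => by
    rw [div_mul_eq_mul_div]; exact (hg.ne_zpow hq0 ht j he).1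
  rw [mul_right_comm] at e1
  rw [div_mul_eq_mul_div] at e2
  simp only [div_eq_mul_inv (theta _ _), mul_inv, ← e1, ← e2]
  ring

/-- The hypothesis allows finitely many exceptional z. Both sides are continuous at the points of
the curve, so the equality holds there without exception. -/
lemma eval_jouk_eq (hq0 : q ≠ 0) (hb : ∀ j, b j ≠ 0) {f : RatFunc ℂ} {k : Fin 6 → ℤ}
    (hfk : ∀ᶠ z in Filter.cofinite, f.eval (RingHom.id ℂ) (jouk z) =
      ∏ j, (qPoch q (b j * z) (k j) * qPoch q (b j / z) (k j)))
    {n : Fin 6 → ℕ} (hf : HasDepth q b f n) (hk : ∀ j, -(n j : ℤ) ≤ k j) {g g' : ℝ → ℂ}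
    (hg : Separates q (lowered q b n) g g') {t : ℝ} (ht : t ∈ Icc (0 : ℝ) 1) :
    f.eval (RingHom.id ℂ) (jouk (g t)) =
      ∏ j, (qPoch q (b j * g t) (k j) * qPoch q (b j / g t) (k j)) := by
  have hz := hg.ne_zero t ht
  have hj : ContinuousAt jouk (g t) := (continuousAt_id.add (continuousAt_inv₀ hz)).div_const 2
  have h1 : ContinuousAt (fun z => f.eval (RingHom.id ℂ) (jouk z)) (g t) :=
    (ContinuousAt.comp (f := jouk) f.num.continuous.continuousAt hj).div
      (ContinuousAt.comp (f := jouk) f.denom.continuous.continuousAt hj)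
      (hf.denom_ne_zero hb hq0 hg ht)
  have h2 : ContinuousAt (fun z => ∏ j, (qPoch q (b j * z) (k j) * qPoch q (b j / z) (k j)))
      (g t) := tendsto_finsetProd _ fun j _ => by
    have hkj := hk j
    refine ContinuousAt.mul ?_ ?_
    · refine ContinuousAt.comp (g := fun x => qPoch q x (k j)) (f := fun z => b j * z)
        (continuousAt_qPoch fun i hi => ?_) (by fun_prop)
      rw [mul_right_comm]
      exact (hg.ne_zpow hq0 ht j (by omega)).2
    · refine ContinuousAt.comp (g := fun x => qPoch q x (k j)) (f := fun z => b j / z)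
        (continuousAt_qPoch fun i hi => ?_) (continuousAt_const.div continuousAt_id hz)
      rw [div_mul_eq_mul_div]
      exact (hg.ne_zpow hq0 ht j (by omega)).1
  have hev : ∀ᶠ z in 𝓝[≠] (g t), f.eval (RingHom.id ℂ) (jouk z) =
      ∏ j, (qPoch q (b j * z) (k j) * qPoch q (b j / z) (k j)) :=
    hfk.filter_mono (nhdsNE_le_cofinite _)
  exact tendsto_nhds_unique_of_eventuallyEq (h1.tendsto.mono_left nhdsWithin_le_nhds)
    (h2.tendsto.mono_left nhdsWithin_le_nhds) hev

end Moments

/-! ### The constant C at shifted parameters. -/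

section ShiftedConstant

variable {q : ℂ} {b : Fin 6 → ℂ}

lemma prod_zpow_of_sum_eq_zero {x : ℂ} (hx : x ≠ 0) {k : Fin 6 → ℤ} (hk : ∑ j, k j = 0) :
    ∏ j, x ^ k j = 1 := by
  rw [Fin.prod_univ_six, ← zpow_add₀ hx, ← zpow_add₀ hx, ← zpow_add₀ hx, ← zpow_add₀ hx,
    ← zpow_add₀ hx, ← Fin.sum_univ_six, hk, zpow_zero]

/-- Because ∑ k_j = 0, the signs and the powers of a cancel. The factor that remains is independent
of a and is the same for ∏ θ(a/b_j), so it comes out of the braces in C. -/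
lemma prod_theta_mul_zpow (hq0 : q ≠ 0) (hq : ‖q‖ < 1) (hb : ∀ j, b j ≠ 0) {k : Fin 6 → ℤ}
    (hk : ∑ j, k j = 0) {a : ℂ} (ha : a ≠ 0) :
    ∏ j, theta q (a * (b j * q ^ k j)) =
      (∏ j, (q ^ (k j * (k j - 1) / 2) * b j ^ k j))⁻¹ * ∏ j, theta q (a * b j) := by
  have h1 : ∀ j, theta q (a * (b j * q ^ k j)) = (-1) ^ k j * (a ^ k j)⁻¹ *
      (q ^ (k j * (k j - 1) / 2) * b j ^ k j)⁻¹ * theta q (a * b j) := fun j => by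
    rw [show a * (b j * q ^ k j) = q ^ k j * (a * b j) by ring,
      theta_zpow_mul hq0 hq (mul_ne_zero ha (hb j)), zpow_neg, mul_zpow, mul_inv, mul_inv]
    ring
  simp only [h1, Finset.prod_mul_distrib, Finset.prod_inv_distrib,
    prod_zpow_of_sum_eq_zero ha hk, prod_zpow_of_sum_eq_zero (neg_ne_zero.2 one_ne_zero) hk]
  ring

lemma prod_theta_div_zpow (hq0 : q ≠ 0) (hq : ‖q‖ < 1) (hb : ∀ j, b j ≠ 0) {k : Fin 6 → ℤ}
    (hk : ∑ j, k j = 0) {a : ℂ} (ha : a ≠ 0) :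
    ∏ j, theta q (a / (b j * q ^ k j)) =
      (∏ j, (q ^ (k j * (k j - 1) / 2) * b j ^ k j))⁻¹ * ∏ j, theta q (a / b j) := by
  have h1 : ∀ j, theta q (a / (b j * q ^ k j)) = ((-1) ^ k j)⁻¹ * a ^ k j * (q ^ k j)⁻¹ *
      (q ^ (k j * (k j - 1) / 2) * b j ^ k j)⁻¹ * theta q (a / b j) := fun j => by
    have e : -k j * (-k j - 1) / 2 = k j * (k j - 1) / 2 + k j := by
      have : -k j * (-k j - 1) = k j * (k j - 1) + 2 * k j := by ring
      omega
    rw [show a / (b j * q ^ k j) = q ^ (-k j) * (a / b j) by rw [zpow_neg]; ring,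
      theta_zpow_mul hq0 hq (div_ne_zero ha (hb j)), e, zpow_add₀ hq0, neg_neg, div_zpow, zpow_neg,
      mul_inv, mul_inv]
    ring
  simp only [h1, Finset.prod_mul_distrib, Finset.prod_inv_distrib, prod_zpow_of_sum_eq_zero ha hk,
    prod_zpow_of_sum_eq_zero hq0 hk, prod_zpow_of_sum_eq_zero (neg_ne_zero.2 one_ne_zero) hk]
  ring

lemma pairProd_mul (F G : Fin 6 → Fin 6 → ℂ) :
    pairProd (fun i j => F i j * G i j) = pairProd F * pairProd G := by
  simp only [pairProd, Finset.prod_mul_distrib]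

lemma Admissible.pairProd_ne_zero (hq : ‖q‖ < 1) (hb : Admissible q b) :
    pairProd (fun i j => qInf q (b i * b j)) ≠ 0 :=
  Finset.prod_ne_zero_iff.2 fun i _ => Finset.prod_ne_zero_iff.2 fun j _ =>
    qInf_ne_zero_of_zpow hq (hb.mul_ne i j)

lemma pairProd_qPoch_mul (hq0 : q ≠ 0) (hq : ‖q‖ < 1) (hb : Admissible q b) (k : Fin 6 → ℤ) :
    pairProd (fun i j => qPoch q (b i * b j) (k i + k j)) *
      pairProd (fun i j => qInf q (b i * q ^ k i * (b j * q ^ k j))) =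
    pairProd (fun i j => qInf q (b i * b j)) := by
  rw [← pairProd_mul]
  congr 1
  funext i j
  rw [show b i * q ^ k i * (b j * q ^ k j) = b i * b j * q ^ (k i + k j) by
    rw [zpow_add₀ hq0]; ring]
  refine qPoch_mul_qInf hq0 hq fun n _ e => hb.mul_ne i j ((n : ℤ) + 1) ?_
  rw [zpow_neg] at e
  exact (eq_inv_of_mul_eq_one_left e).trans (inv_inv _)

/-- The theta products contribute the denominator of the moment and the products (b_i b_j)_∞ its
numerator; everything else in C is free of b. -/
lemma const_zpow_mul (hq0 : q ≠ 0) (hq : ‖q‖ < 1) (hb : Admissible q b) {k : Fin 6 → ℤ}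
    (hk : ∑ j, k j = 0) {l : Fin 6 → ℂ} (hl : ∀ j, l j ≠ 0) :
    const q (fun j => b j * q ^ k j) l =
      pairProd (fun i j => qPoch q (b i * b j) (k i + k j)) /
        (∏ j, (q ^ (k j * (k j - 1) / 2) * b j ^ k j)) * const q b l := by
  have hP := pairProd_qPoch_mul hq0 hq hb k
  have hP0 := hb.pairProd_ne_zero hq
  rw [← hP] at hP0
  have hQ0 := left_ne_zero_of_mul hP0
  have hD0 := right_ne_zero_of_mul hP0
  simp only [const, constTerm]
  rw [prod_theta_mul_zpow hq0 hq hb.ne_zero hk (hl 0), prod_theta_mul_zpow hq0 hq hb.ne_zero hk (hl 1),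
    prod_theta_div_zpow hq0 hq hb.ne_zero hk (hl 0), prod_theta_div_zpow hq0 hq hb.ne_zero hk (hl 1),
    ← hP]
  generalize pairProd (fun i j => qPoch q (b i * b j) (k i + k j)) = Q at *
  generalize pairProd (fun i j => qInf q (b i * q ^ k i * (b j * q ^ k j))) = D at *
  generalize ∏ j, (q ^ (k j * (k j - 1) / 2) * b j ^ k j) = R at *
  have h : ∀ X Y Z u v w : ℂ, X * (R⁻¹ * Y - u * (R⁻¹ * Z)) / (v * w * D) =
      Q / R * (X * (Y - u * Z) / (v * w * (Q * D))) := fun X Y Z u v w => by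
    rw [show v * w * (Q * D) = Q * (v * w * D) by ring]
    field_simp
  rw [h, h, mul_add]

lemma GenericParams.admissible (hq0 : q ≠ 0) (hbq : ∏ j, b j = q) (h : GenericParams q b) :
    Admissible q b where
  ne_zero := ne_zero_of_prod_eq hq0 hbq
  div_ne i j hij n := by
    rcases lt_or_gt_of_ne hij with h' | h'
    · exact h.1 i j h' n
    · intro e
      refine h.1 j i h' (-n) ?_
      rw [zpow_neg, ← e, inv_div]
  mul_ne i j n := by
    rcases le_total i j with h' | h'
    · exact h.2 i j h' n
    · rw [mul_comm]
      exact h.2 j i h' n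

end ShiftedConstant

/-! ### The functional as a contour integral. -/

section Functional

variable {q : ℂ} {b : Fin 6 → ℂ}

lemma isContour_iff_separates {f : RatFunc ℂ} (hq0 : q ≠ 0) {x : ℂ} {γ : Path x x} :
    IsContour q b f γ ↔ IsPiecewiseC1 γ ∧ Separates q (lowered q b (poleDepth q b f)) γ.extend
      (derivWithin γ.extend (Icc 0 1)) := by
  have hI : ∀ p : ℂ, (∀ t, γ t ≠ p) ↔ ∀ t ∈ Icc (0 : ℝ) 1, γ.extend t ≠ p := fun p =>
    ⟨fun h t ht => by rw [γ.extend_apply ht]; exact h _, fun h t => by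
      have := h t t.2
      rwa [γ.extend_apply t.2] at this⟩
  have hp : ∀ (j : Fin 6) (k : ℕ), b j * q ^ ((k : ℤ) - poleDepth q b f j) =
      lowered q b (poleDepth q b f) j * q ^ k := fun j k => lowered_mul_pow hq0 _ j (by ring)
  have hpi := Complex.two_pi_I_ne_zero
  have hw : ∀ p : ℂ, windingNumber γ p = (2 * Real.pi * Complex.I)⁻¹ *
      loopInt (fun z => (z - p)⁻¹) γ.extend (derivWithin γ.extend (Icc 0 1)) := fun p => by
    rw [windingNumber, contourIntegral_eq_loopInt]
  constructor
  · intro h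
    refine ⟨h.piecewiseC1, h.piecewiseC1.isLoop, (hI _).1 h.ne_zero, fun j k => ?_, fun j k => ?_,
      fun j k => ?_, fun j k => ?_⟩
    · exact (hI _).1 (h.inside j k _ (hp j k).symm).1
    · have := (h.inside j k _ (hp j k).symm).2
      rw [hw, inv_mul_eq_one₀ hpi] at this
      exact this.symm
    · exact (hI _).1 (h.outside j k _ (congrArg _ (hp j k).symm)).1
    · have := (h.outside j k _ (congrArg _ (hp j k).symm)).2
      rw [hw] at this
      exact (mul_eq_zero.1 this).resolve_left (inv_ne_zero hpi)
  · rintro ⟨h1, h⟩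
    refine ⟨h1, (hI _).2 h.ne_zero, fun j k p hpe => ?_, fun j k p hpe => ?_⟩
    · rw [hp] at hpe
      subst hpe
      refine ⟨(hI _).2 (h.avoid j k), ?_⟩
      rw [hw, h.inside, inv_mul_cancel₀ hpi]
    · rw [hp] at hpe
      subst hpe
      refine ⟨(hI _).2 (h.avoid_inv j k), ?_⟩
      rw [hw, h.outside, mul_zero]

lemma exists_isContour (hq0 : q ≠ 0) (hq : ‖q‖ < 1) (hb : Admissible q b) (f : RatFunc ℂ) :
    ∃ (x : ℂ) (γ : Path x x), IsContour q b f γ := by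
  obtain ⟨x, γ, h⟩ := (hb.zpow_mul hq0 fun j => -(poleDepth q b f j : ℤ)).exists_contour hq0 hq
  exact ⟨x, γ, (isContour_iff_separates hq0).2 h⟩

/-- The integrand is the weight with parameters b_j q^{k_j}, whose product is still q, so
`loopInt_weight` applies to it. -/
lemma loopInt_rahmanIntegrand_moment (hq0 : q ≠ 0) (hq : ‖q‖ < 1) (hb : Admissible q b)
    (hbq : ∏ j, b j = q) {l : Fin 6 → ℂ} (hl : ∏ j, l j = q) (hgen : GenericLambda q b l)
    {f : RatFunc ℂ} {k : Fin 6 → ℤ} (hk : ∑ j, k j = 0)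
    (hfk : ∀ᶠ z in Filter.cofinite, f.eval (RingHom.id ℂ) (jouk z) =
      ∏ j, (qPoch q (b j * z) (k j) * qPoch q (b j / z) (k j)))
    {n : Fin 6 → ℕ} (hf : HasDepth q b f n) (hkn : ∀ j, -(n j : ℤ) ≤ k j) {g g' : ℝ → ℂ}
    (hg : Separates q (lowered q b n) g g') :
    loopInt (rahmanIntegrand q b l f) g g' =
      pairProd (fun i j => qPoch q (b i * b j) (k i + k j)) /
        (∏ j, (q ^ (k j * (k j - 1) / 2) * b j ^ k j)) * const q b l := by
  rw [← const_zpow_mul hq0 hq hb hk (ne_zero_of_prod_eq hq0 hl)]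
  have hd : ∏ j, b j * q ^ k j = q := by
    rw [Finset.prod_mul_distrib, hbq, prod_zpow_of_sum_eq_zero hq0 hk, mul_one]
  have hgd : Separates q (fun j => b j * q ^ k j) g g' := hg.mul_pow fun j =>
    ⟨j, (k j + n j).toNat, lowered_mul_pow hq0 n j (by have := hkn j; omega)⟩
  rw [← loopInt_weight hq0 hq (hb.zpow_mul hq0 k) hd hgd hl hgen.1 hgen.2.1 hgen.2.2.1]
  refine loopInt_congr fun t ht => ?_
  rw [rahmanIntegrand, eval_jouk_eq hq0 hb.ne_zero hfk hf hkn hg ht, weight_mul_qPoch hq0 hq hkn hg ht]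

/-- Rahman's functional as a contour integral. -/
theorem exists_rahmanFunctional (hq0 : q ≠ 0) (hq : ‖q‖ < 1) (hb : Admissible q b)
    (hbq : ∏ j, b j = q) {l : Fin 6 → ℂ} (hl : ∏ j, l j = q) (hgen : GenericLambda q b l) :
    ∃ J : V q b →ₗ[ℂ] ℂ, IsRahmanFunctional q b J ∧
      ∀ (f : V q b) (x : ℂ) (γ : Path x x), IsContour q b f γ →
        J f = (const q b l)⁻¹ * contourIntegral (rahmanIntegrand q b l f) γ := by
  have hl0 := ne_zero_of_prod_eq hq0 hl
  -- One curve is fixed for each depth vector, so that functions of different depths can be compared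
  -- on a common curve.
  choose x γ hγ hsep using fun n : Fin 6 → ℕ =>
    (hb.zpow_mul hq0 fun j => -(n j : ℤ)).exists_contour hq0 hq
  have hdepth := fun f : V q b => hasDepth_poleDepth hq0 hq hb f.2
  set I : V q b → (Fin 6 → ℕ) → ℂ := fun f n =>
    loopInt (rahmanIntegrand q b l f) (γ n).extend (derivWithin (γ n).extend (Icc 0 1)) with hI
  -- A curve made for larger depths also separates for smaller ones, so enlarging n does not change
  -- the integral.
  have hmono : ∀ (f : V q b) {n : Fin 6 → ℕ}, poleDepth q b f ≤ n → I f n = I f (poleDepth q b f) :=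
    fun f n hn => (hdepth f).loopInt_eq hq0 hq hb hl0 f.2
      (Separates.lowered_mono hq0 hn (hsep n)) (hsep _)
  let J : V q b →ₗ[ℂ] ℂ :=
    { toFun := fun f => (const q b l)⁻¹ * I f (poleDepth q b f)
      map_add' := fun f₁ f₂ => by
        -- The join includes the depth of the sum, so that all three integrals can be moved to one
        -- curve.
        have h1 : poleDepth q b f₁ ≤ poleDepth q b f₁ ⊔ poleDepth q b f₂ ⊔
          poleDepth q b (f₁ + f₂ : V q b) := le_sup_left.trans le_sup_left
        have h2 : poleDepth q b f₂ ≤ poleDepth q b f₁ ⊔ poleDepth q b f₂ ⊔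
          poleDepth q b (f₁ + f₂ : V q b) := le_sup_right.trans le_sup_left
        rw [← hmono _ h1, ← hmono _ h2, ← hmono (f₁ + f₂) le_sup_right, ← mul_add]
        exact congrArg _ (loopInt_rahmanIntegrand_add hq0 hq hb hl0 ((hdepth f₁).mono h1)
          ((hdepth f₂).mono h2) f₁.2 f₂.2 (hsep _))
      map_smul' := fun c f => by
        have h1 : poleDepth q b f ≤ poleDepth q b f ⊔ poleDepth q b (c • f : V q b) := le_sup_left
        rw [← hmono _ h1, ← hmono (c • f) le_sup_right, RingHom.id_apply, smul_eq_mul, mul_left_comm]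
        exact congrArg _ (loopInt_rahmanIntegrand_smul hq0 hb ((hdepth f).mono h1) c (hsep _)) }
  refine ⟨J, fun k hk f hf => ?_, fun f y δ hδ => ?_⟩
  -- Enlarging the depth by |k_j| makes the curve enclose every b_j q^{k_j + r}, r ≥ 0, including
  -- those that are not poles of f.
  · have h1 : poleDepth q b f ≤ poleDepth q b f ⊔ fun j => (k j).natAbs := le_sup_left
    change (const q b l)⁻¹ * I f (poleDepth q b f) = _
    rw [← hmono f h1, hI]
    beta_reduce
    have hkn : ∀ j, -((poleDepth q b f ⊔ fun j => (k j).natAbs) j : ℤ) ≤ k j := fun j => by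
      have h2 : (k j).natAbs ≤ (poleDepth q b f ⊔ fun j => (k j).natAbs) j :=
        le_sup_right (a := poleDepth q b f j)
      omega
    rw [loopInt_rahmanIntegrand_moment hq0 hq hb hbq hl hgen hk hf ((hdepth f).mono h1) hkn (hsep _),
      mul_comm, mul_assoc, mul_inv_cancel₀ hgen.2.2.2, mul_one]
  · have h1 := (hdepth f).loopInt_eq hq0 hq hb hl0 f.2 (hsep _)
      ((isContour_iff_separates hq0).1 hδ).2
    rw [contourIntegral_eq_loopInt, ← h1]
    rfl

end Functional

end Rahman

theorem mainTheorem8 (q : ℂ) (hq0 : 0 < ‖q‖) (hq1 : ‖q‖ < 1)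
    (b : Fin 6 → ℂ) (hb : ∏ j, b j = q) (hgen : Rahman.GenericParams q b) :
    (∃! J : Rahman.V q b →ₗ[ℂ] ℂ, Rahman.IsRahmanFunctional q b J) ∧
    (IsOpen {l : {l : Fin 6 → ℂ // ∏ j, l j = q} | Rahman.GenericLambda q b l} ∧
      Dense {l : {l : Fin 6 → ℂ // ∏ j, l j = q} | Rahman.GenericLambda q b l}) ∧
    (∀ f : Rahman.V q b, ∃ (x : ℂ) (γ : Path x x), Rahman.IsContour q b f γ) ∧
    ∀ J : Rahman.V q b →ₗ[ℂ] ℂ, Rahman.IsRahmanFunctional q b J →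
      ∀ l : Fin 6 → ℂ, ∏ j, l j = q → Rahman.GenericLambda q b l →
      ∀ (f : Rahman.V q b) (x : ℂ) (γ : Path x x), Rahman.IsContour q b f γ →
        J f = (Rahman.const q b l)⁻¹ *
          Rahman.contourIntegral (fun z =>
            (f : RatFunc ℂ).eval (RingHom.id ℂ) (Rahman.jouk z) * Rahman.weight q b l z *
              (2 * Real.pi * Complex.I * z)⁻¹) γ := by
  have h0 : q ≠ 0 := norm_pos_iff.1 hq0
  have hadm := hgen.admissible h0 hb
  refine ⟨?_, ⟨Rahman.isOpen_genericLambda h0 hq1 hadm, Rahman.dense_genericLambda h0 hq1 hadm⟩,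
    fun f => Rahman.exists_isContour h0 hq1 hadm f, fun J hJ l hl hlam f x γ hγ => ?_⟩
  -- A single generic λ suffices for existence.
  · obtain ⟨l, hl, hne⟩ := Rahman.exists_genericityForm_ne_zero h0 hq1 hadm
    obtain ⟨J, hJ, -⟩ := Rahman.exists_rahmanFunctional h0 hq1 hadm hb hl
      ((Rahman.genericLambda_iff h0 hq1 hadm (Rahman.ne_zero_of_prod_eq h0 hl)).2 hne)
    exact ⟨J, hJ, fun J' hJ' => hJ'.unique h0 hq1 hadm hJ⟩
  -- Each generic λ yields a functional with the same moments, so by uniqueness it is the given J.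
  · obtain ⟨J', hJ', h⟩ := Rahman.exists_rahmanFunctional h0 hq1 hadm hb hl hlam
    rw [hJ.unique h0 hq1 hadm hJ', h f x γ hγ]
    rfl
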